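/- Let $K$ be a field, $n\ge 0$, $S=K[X_1,\dots,X_n]$, let $I\subseteq S$ be a monomial ideal (not necessarily square-free), $R=S/I$, $x_j$ the image of $X_j$ in $R$, and $\mathfrak m=(x_1,\dots,x_n)\subseteq R$. Let $G(I)$ be the set of minimal monomial generators of $I$; for a monomial $u=X_1^{b_1}\cdots X_n^{b_n}$ put $\nu_j(u)=b_j$, and let $\rho_j=\max\{\nu_j(u) : u\in G(I)\}$ (with $\rho_j=0$ if $I=0$). A simplicial complex on $[n]=\{1,\dots,n\}$ is a family of subsets of $[n]$ closed under taking subsets; it may be empty, or consist of $\emptyset$ only. $\tilde H_p(\,\cdot\,;K)$, $p\in\mathbb Z$, denotes the homology of the augmented oriented chain complex with coefficients in $K$, in which a face $F$ has dimension $|F|-1$ (so $\emptyset$, if it is a face, has dimension $-1$; the homology of the empty complex is $0$). Let $\Delta$ be the simplicial complex with Stanley–Reisner ideal $\sqrt I$, that is, $F\in\Delta$ if and only if $\prod_{j\in F}X_j\notin\sqrt I$. For $a\in\mathbb Z^n$ let $G_a=\{j : a_j<0\}$ and $$\Delta_a=\bigl\{F\setminus G_a \;:\; G_a\subseteq F\subseteq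 [n],\ \text{and for every } u\in G(I) \text{ there is } j\notin F \text{ with } \nu_j(u)>a_j\ge 0\bigr\}.$$ Let $i\ge 0$, and let $H^i_{\mathfrak m}(R)=\varinjlim_k \operatorname{Ext}^i_R(R/\mathfrak m^k,R)$ be the local cohomology module. Let $C^\bullet$ be the Čech complex of $R$ with respect to $x_1,\dots,x_n$, with terms $C^t=\bigoplus_{|F|=t}R_{x_F}$, $x_F=\prod_{j\in F}x_j$, whose differential is given by the natural maps $R_{x_F}\to R_{x_{F'}}$ with sign $(-1)^s$ for $F=F'\setminus\{j_s\}$, $F'=\{j_0<\dots<j_t\}$; its terms and its cohomology are $\mathbb Z^n$-graded by $\deg x_j=e_j$, the $j$-th unit vector. Then $H^i_{\mathfrak m}(R)\cong H^i(C^\bullet)$ as $R$-modules. The grading that this carries over to $H^i_{\mathfrak m}(R)$ makes it a $\mathbb Z^n$-graded module, $H^i_{\mathfrak m}(R)=\bigoplus_{a}H^i_{\mathfrak m}(R)_a$ with $x_jH^i_{\mathfrak m}(R)_a\subseteq H^i_{\mathfrak m}(R)_{a+e_j}$, whose components are finite dimensional over $K$, and its Hilbert series is $$\sum_{a\in\mathbb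 Z^n}\dim_K H^i_{\mathfrak m}(R)_a\,\mathbf t^a=\sum_{F\in\Delta}\ \sum_{\substack{a\in\mathbb Z^n,\ G_a=F\\ a_j\le\rho_j-1,\ j=1,\dots,n}}\dim_K\tilde H_{i-|F|-1}(\Delta_a;K)\,\mathbf t^a,\qquad \mathbf t^a=t_1^{a_1}\cdots t_n^{a_n}.$$ -/

import Mathlib

noncomputable section

namespace MonomialLC

universe u

/-! ### Monomial ideals -/

/-- An ideal of `K[X_1, …, X_n]` is a monomial ideal if it is generated by a set of monomials. -/
def IsMonomialIdeal {K : Type u} [Field K] {n : ℕ} (I : Ideal (MvPolynomial (Fin n) K)) : Prop :=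
  ∃ B : Set (Fin n →₀ ℕ), I = Ideal.span ((fun b => MvPolynomial.monomial b (1 : K)) '' B)

/-- `G(I)`: the (exponent vectors of the) minimal monomial generators of a monomial ideal `I`,
that is, of the monomials in `I` that are minimal for divisibility. -/
def minGens {K : Type u} [Field K] {n : ℕ} (I : Ideal (MvPolynomial (Fin n) K)) :
    Set (Fin n →₀ ℕ) :=
  {b | Minimal (fun c : Fin n →₀ ℕ => MvPolynomial.monomial c (1 : K) ∈ I) b}

theorem minGens_finite {K : Type u} [Field K] {n : ℕ} (I : Ideal (MvPolynomial (Fin n) K)) :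
    (minGens I).Finite :=
  (setOfPred_minimal_antichain _).finite_of_partiallyWellOrderedOn (Set.isPWO_of_wellQuasiOrderedLE _)

/-- `ρ_j = max {ν_j(u) : u ∈ G(I)}`, with the convention `ρ_j = 0` if `G(I)` is empty. -/
def rho {K : Type u} [Field K] {n : ℕ} (I : Ideal (MvPolynomial (Fin n) K)) (j : Fin n) : ℕ :=
  (minGens_finite I).toFinset.sup (fun u => u j)

/-- `G_a = {j : a_j < 0}`. -/
def negSupport {n : ℕ} (a : Fin n → ℤ) : Finset (Fin n) :=
  Finset.univ.filter (fun j => a j < 0)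

/-! ### Simplicial complexes and reduced homology -/

/-- A simplicial complex on `{1, …, n}`: a family of subsets closed under taking subsets.
It may be empty, it may consist of the empty face alone, and not every point has to be a vertex. -/
abbrev SimplicialCx (n : ℕ) : Type := LowerSet (Finset (Fin n))

/-- The finite set of faces of a simplicial complex. -/
def faces {n : ℕ} (D : SimplicialCx n) : Finset (Finset (Fin n)) :=
  (Set.toFinite (D : Set (Finset (Fin n)))).toFinset

/-- The number of elements of `F` that are smaller than `j`; if `j ∈ F = {j_0 < ⋯ < j_i}` then
this is the `s` with `j = j_s`. -/
def position {n : ℕ} (F : Finset (Fin n)) (j : Fin n) : ℕ :=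
  (F.filter (fun k => k < j)).card

/-- The boundary map on the vector space with basis all the subsets of `{1, …, n}`; the subset `F`
is the basis vector `Pi.single F 1`. It sends `{i_0 < ⋯ < i_k}` to
`∑_s (-1)^s ({i_0, …, i_k} ∖ {i_s})`. -/
def boundary (K : Type u) [Field K] (n : ℕ) :
    (Finset (Fin n) → K) →ₗ[K] (Finset (Fin n) → K) :=
  Fintype.linearCombination K fun F : Finset (Fin n) =>
    ∑ j ∈ F, (-1 : K) ^ position F j • (Pi.single (F.erase j) 1 : Finset (Fin n) → K)

/-- The chains of dimension `p` of the augmented oriented chain complex of `D` with coefficients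
in `K`: the combinations of the faces with `p + 1` elements. The empty face has dimension `-1`. -/
def chains (K : Type u) [Field K] {n : ℕ} (D : SimplicialCx n) (p : ℤ) :
    Submodule K (Finset (Fin n) → K) :=
  Submodule.pi {F | ¬ (F ∈ D ∧ (F.card : ℤ) = p + 1)} (fun _ => ⊥)

/-- The cycles of dimension `p`. -/
def cycles (K : Type u) [Field K] {n : ℕ} (D : SimplicialCx n) (p : ℤ) :
    Submodule K (Finset (Fin n) → K) :=
  chains K D p ⊓ LinearMap.ker (boundary K n)

/-- The boundaries of dimension `p`. -/
def boundaries (K : Type u) [Field K] {n : ℕ} (D : SimplicialCx n) (p : ℤ) :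
    Submodule K (Finset (Fin n) → K) :=
  (chains K D (p + 1)).map (boundary K n)

/-- Reduced simplicial homology `H̃_p(D; K)`, for `p ∈ ℤ`. -/
abbrev ReducedHomology (K : Type u) [Field K] {n : ℕ} (D : SimplicialCx n) (p : ℤ) : Type u :=
  cycles K D p ⧸ (boundaries K D p).submoduleOf (cycles K D p)

/-- The simplicial complex `Δ` whose Stanley–Reisner ideal is `√I`:
`F` is a face if and only if `∏_{j ∈ F} X_j ∉ √I`. -/
def radicalComplex {K : Type u} [Field K] {n : ℕ} (I : Ideal (MvPolynomial (Fin n) K)) :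
    SimplicialCx n where
  carrier := {F | ∏ j ∈ F, (MvPolynomial.X j : MvPolynomial (Fin n) K) ∉ I.radical}
  lower' := fun _ _ hGF hF hG => hF (Ideal.mem_of_dvd _ (Finset.prod_dvd_prod_of_subset _ _ _ hGF) hG)

/-- The simplicial complex `Δ_a`: it consists of the sets `F ∖ G_a`, where `F ⊇ G_a` is such that
for all `u ∈ G(I)` there is `j ∉ F` with `ν_j(u) > a_j ≥ 0`. -/
def degreeComplex {K : Type u} [Field K] {n : ℕ} (I : Ideal (MvPolynomial (Fin n) K))
    (a : Fin n → ℤ) : SimplicialCx n where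
  carrier := {L | ∃ F : Finset (Fin n), negSupport a ⊆ F ∧
    (∀ u ∈ minGens I, ∃ j, j ∉ F ∧ a j < (u j : ℤ) ∧ 0 ≤ a j) ∧ L = F \ negSupport a}
  lower' := by
    rintro L L' hL ⟨F, hF, hu, rfl⟩
    refine ⟨L' ∪ negSupport a, Finset.subset_union_right, fun u hG => ?_, ?_⟩
    · obtain ⟨j, hj, h⟩ := hu u hG
      refine ⟨j, fun hj' => hj ?_, h⟩
      rcases Finset.mem_union.1 hj' with h1 | h1
      · exact (Finset.mem_sdiff.1 (hL h1)).1
      · exact hF h1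
    · ext j
      have := @hL j
      simp only [Finset.mem_sdiff, Finset.mem_union] at this ⊢
      tauto

/-! ### The Čech complex of `R = S/I` and its multigrading -/

/-- `R = S/I` with `S = K[X_1, …, X_n]`. -/
abbrev QuotRing {K : Type u} [Field K] {n : ℕ} (I : Ideal (MvPolynomial (Fin n) K)) : Type u :=
  MvPolynomial (Fin n) K ⧸ I

/-- `x_j`, the image of `X_j` in `R`. -/
def x {K : Type u} [Field K] {n : ℕ} (I : Ideal (MvPolynomial (Fin n) K)) (j : Fin n) :
    QuotRing I :=
  Ideal.Quotient.mk I (MvPolynomial.X j)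

/-- `𝔪 = (x_1, …, x_n) ⊆ R`. -/
def maxIdeal {K : Type u} [Field K] {n : ℕ} (I : Ideal (MvPolynomial (Fin n) K)) :
    Ideal (QuotRing I) :=
  Ideal.span (Set.range (x I))

/-- `x_F = ∏_{j ∈ F} x_j ∈ R`. -/
def xProd {K : Type u} [Field K] {n : ℕ} (I : Ideal (MvPolynomial (Fin n) K))
    (F : Finset (Fin n)) : QuotRing I :=
  ∏ j ∈ F, x I j

/-- The localization `R_{x_F}`. -/
abbrev Loc {K : Type u} [Field K] {n : ℕ} (I : Ideal (MvPolynomial (Fin n) K))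
    (F : Finset (Fin n)) : Type u :=
  Localization.Away (xProd I F)

theorem isUnit_xProd {K : Type u} [Field K] {n : ℕ} (I : Ideal (MvPolynomial (Fin n) K))
    {F F' : Finset (Fin n)} (h : F ⊆ F') :
    IsUnit (algebraMap (QuotRing I) (Loc I F') (xProd I F)) :=
  isUnit_of_dvd_unit (map_dvd _ (Finset.prod_dvd_prod_of_subset _ _ _ h))
    (IsLocalization.Away.algebraMap_isUnit (xProd I F'))

/-- The natural map `R_{x_F} → R_{x_{F'}}` for `F ⊆ F'`. -/
def nat {K : Type u} [Field K] {n : ℕ} (I : Ideal (MvPolynomial (Fin n) K))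
    {F F' : Finset (Fin n)} (h : F ⊆ F') : Loc I F →ₐ[QuotRing I] Loc I F' :=
  IsLocalization.Away.liftAlgHom (xProd I F) (f := Algebra.ofId (QuotRing I) (Loc I F'))
    (isUnit_xProd I h)

/-- The sum of all the terms of the Čech complex. -/
abbrev CechTotal {K : Type u} [Field K] {n : ℕ} (I : Ideal (MvPolynomial (Fin n) K)) : Type u :=
  (F : Finset (Fin n)) → Loc I F

/-- The term `C^t = ⨁_{|F| = t} R_{x_F}` of the Čech complex, for `t ∈ ℤ`. -/
def cechTerm {K : Type u} [Field K] {n : ℕ} (I : Ideal (MvPolynomial (Fin n) K)) (t : ℤ) :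
    Submodule (QuotRing I) (CechTotal I) :=
  Submodule.pi {F : Finset (Fin n) | (F.card : ℤ) ≠ t} (fun _ => ⊥)

/-- The differential of the Čech complex: its component `R_{x_F} → R_{x_{F'}}`, for
`F = F' ∖ {j_s}` with `F' = {j_0 < ⋯ < j_t}`, is `(-1)^s` times the natural map. -/
def cechDifferential {K : Type u} [Field K] {n : ℕ} (I : Ideal (MvPolynomial (Fin n) K)) :
    CechTotal I →ₗ[QuotRing I] CechTotal I :=
  LinearMap.pi fun F' => ∑ j ∈ F',
    (-1 : QuotRing I) ^ position F' j •
      ((nat I (F'.erase_subset j)).toLinearMap ∘ₗ LinearMap.proj (F'.erase j))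

/-- The cocycles in `C^t`. -/
def cechCocycles {K : Type u} [Field K] {n : ℕ} (I : Ideal (MvPolynomial (Fin n) K)) (t : ℤ) :
    Submodule (QuotRing I) (CechTotal I) :=
  cechTerm I t ⊓ LinearMap.ker (cechDifferential I)

/-- The coboundaries in `C^t`. -/
def cechCoboundaries {K : Type u} [Field K] {n : ℕ} (I : Ideal (MvPolynomial (Fin n) K)) (t : ℤ) :
    Submodule (QuotRing I) (CechTotal I) :=
  (cechTerm I (t - 1)).map (cechDifferential I)

/-- The cohomology `H^t(C^•)` of the Čech complex. -/
abbrev CechCohomology {K : Type u} [Field K] {n : ℕ} (I : Ideal (MvPolynomial (Fin n) K))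
    (t : ℤ) : Type u :=
  cechCocycles I t ⧸ (cechCoboundaries I t).submoduleOf (cechCocycles I t)

/-- The component of degree `a ∈ ℤ^n` of `R_{x_F}`: it is spanned over `K` by the fractions
`x^b / (x_F)^l` of degree `a`, that is, with `b_j - l = a_j` for `j ∈ F` and `b_j = a_j` for
`j ∉ F`. -/
def locDegree {K : Type u} [Field K] {n : ℕ} (I : Ideal (MvPolynomial (Fin n) K))
    (F : Finset (Fin n)) (a : Fin n → ℤ) : Submodule K (Loc I F) :=
  Submodule.span K {y | ∃ (b : Fin n →₀ ℕ) (l : ℕ),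
    (∀ j, (b j : ℤ) - (if j ∈ F then (l : ℤ) else 0) = a j) ∧
    y = IsLocalization.mk' (Loc I F)
      (Ideal.Quotient.mk I (MvPolynomial.monomial b (1 : K)))
      (⟨xProd I F ^ l, l, rfl⟩ : Submonoid.powers (xProd I F))}

/-- The component of degree `a ∈ ℤ^n` of `H^t(C^•)`: the classes of the cocycles all of whose
entries are homogeneous of degree `a`. -/
def cechDegree {K : Type u} [Field K] {n : ℕ} (I : Ideal (MvPolynomial (Fin n) K)) (t : ℤ)
    (a : Fin n → ℤ) : Submodule K (CechCohomology I t) :=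
  ((Submodule.pi Set.univ (fun F => locDegree I F a)).comap
      ((cechCocycles I t).subtype.restrictScalars K)).map
    (((cechCoboundaries I t).submoduleOf (cechCocycles I t)).mkQ.restrictScalars K)

/-! ### Local cohomology and Hilbert series -/

/-- The local cohomology module `H^i_𝔪(R)`. -/
def LocalCoh {K : Type u} [Field K] {n : ℕ} (I : Ideal (MvPolynomial (Fin n) K)) (i : ℕ) :
    Type u :=
  ((localCohomology (maxIdeal I) i).obj (ModuleCat.of (QuotRing I) (QuotRing I)) :
    ModuleCat.{u} (QuotRing I))

instance {K : Type u} [Field K] {n : ℕ} (I : Ideal (MvPolynomial (Fin n) K)) (i : ℕ) :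
    AddCommGroup (LocalCoh I i) :=
  inferInstanceAs (AddCommGroup
    ((localCohomology (maxIdeal I) i).obj (ModuleCat.of (QuotRing I) (QuotRing I))))

instance {K : Type u} [Field K] {n : ℕ} (I : Ideal (MvPolynomial (Fin n) K)) (i : ℕ) :
    Module (QuotRing I) (LocalCoh I i) :=
  inferInstanceAs (Module (QuotRing I)
    ((localCohomology (maxIdeal I) i).obj (ModuleCat.of (QuotRing I) (QuotRing I))))

instance {K : Type u} [Field K] {n : ℕ} (I : Ideal (MvPolynomial (Fin n) K)) (i : ℕ) :
    Module K (LocalCoh I i) :=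
  Module.compHom _ (algebraMap K (QuotRing I))

instance {K : Type u} [Field K] {n : ℕ} (I : Ideal (MvPolynomial (Fin n) K)) (i : ℕ) :
    IsScalarTower K (QuotRing I) (LocalCoh I i) :=
  ⟨fun k r m =>
    (congrArg (· • m) (Algebra.smul_def k r)).trans (mul_smul (algebraMap K (QuotRing I) k) r m)⟩

/-- The component of degree `a` of `H^i_𝔪(R)`, for the `ℤ^n`-grading that is carried over from the
Čech complex by an isomorphism `e : H^i_𝔪(R) ≅ H^i(C^•)`. -/
def localCohDegree {K : Type u} [Field K] {n : ℕ} (I : Ideal (MvPolynomial (Fin n) K)) (i : ℕ)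
    (e : LocalCoh I i ≃ₗ[QuotRing I] CechCohomology I i) (a : Fin n → ℤ) :
    Submodule K (LocalCoh I i) :=
  (cechDegree I i a).comap (e.toLinearMap.restrictScalars K)

/-- The Hilbert series `∑_a (dim_K M_a) t^a` of a `ℤ^n`-graded vector space `M = ⨁_a M_a`. A formal
series `∑_a c_a t^a` over `a ∈ ℤ^n` is represented by its family of coefficients `a ↦ c_a`. -/
def hilbertSeries {K : Type u} [Field K] {n : ℕ} {M : Type u} [AddCommGroup M] [Module K M]
    (gr : (Fin n → ℤ) → Submodule K M) : (Fin n → ℤ) → ℕ :=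
  fun a => Module.finrank K (gr a)

/-- The formal series `∑_{a ∈ A} c_a t^a`. -/
def formalSum {n : ℕ} (A : Set (Fin n → ℤ)) (c : (Fin n → ℤ) → ℕ) : (Fin n → ℤ) → ℕ :=
  A.indicator c

end MonomialLC

end

/-! The proof has two independent halves.

Comparison with the Čech complex. Over a Noetherian ring, `H^i_𝔪(M)` and the Čech cohomology of `M`
are compared for all modules `M` by dimension shifting. In degree 0 both are the submodule of
elements killed by a power of `𝔪` (`toModule_range`, `modCocycles_zero`). Embed `M` in an injective
module `E` with cokernel `N`. If the higher cohomology of `E` vanishes, then `H^{i+1}(M)` is the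
cokernel of `H^i(E) → H^i(N)`, and `H^i(E) = 0` as soon as `i ≥ 1`. Hence one isomorphism per module
suffices for the induction, and naturality is needed in degree 0 only
(`nonempty_localCohomology_equiv`). For local cohomology the exact sequence and the vanishing pass
to the filtered colimit from `Ext`. For the Čech complex the sequence comes from exactness of
localization, and the vanishing on `E` (`modCocycles_le_of_injective`) is the real point. A cocycle
lives in a finitely generated `N ⊆ E`. By Artin–Rees some `𝔪^k N` meets the `𝔪`-torsion of `N`
trivially, so `N` embeds in `N/𝔪^k N × ∏_j N_{x_j}`, and by injectivity the inclusion `N ⊆ E`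
extends to this product. The first factor is torsion, so its Čech complex is zero in positive
degrees; on each other factor some `x_j` acts bijectively, so its Čech complex is exact. Therefore
the cocycle is a coboundary.

Hilbert series. Each `R_{x_F}` is `ℤ^n`-graded because `I` is monomial: there is a coaction `X_j ↦
x_j t^{e_j}`, whose coefficients are the projections (`locProj_family`). All fractions of a given
degree `a` coincide, so the component of degree `a` has dimension at most one; it is nonzero exactly
when `G_a ⊆ F` and `F ∖ G_a ∈ Δ_a` (`degFrac_ne_zero_iff`). Up to signs the strand of degree `a` of
the Čech complex is therefore the augmented cochain complex of `Δ_a`, shifted by `|G_a| + 1`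
(`cechDifferential_cochainMap`). Boundary and coboundary are transposes of each other, so over a
field the dimensions of cohomology and homology agree (`finrank_cechDegree_eq`). Two vanishing
statements cut the sum down. If `a_j ≥ ρ_j`, passing from `F` to `F ∪ {j}` is bijective in degree
`a` and the strand is exact; if `G_a ∉ Δ`, then `Δ_a` is empty. -/

section

open CategoryTheory Limits

universe w₁ w₂ w₃ w₄

namespace CategoryTheory

/-! ### Connecting maps of left derived functors for a short exact sequence of functors. -/

section LeftDerived

variable {C : Type w₁} [Category.{w₂} C] {D : Type w₃} [Category.{w₄} D]
  [Abelian C] [HasProjectiveResolutions C] [Abelian D]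

/-- The short complex of chain complexes obtained by applying a short complex of additive functors
to a chain complex. -/
@[simps]
noncomputable def mapComplexShortComplex {F₁ F₂ F₃ : C ⥤ D} [F₁.Additive] [F₂.Additive]
    [F₃.Additive] (α : F₁ ⟶ F₂) (β : F₂ ⟶ F₃) (h : α ≫ β = 0) (P : ChainComplex C ℕ) :
    ShortComplex (ChainComplex D ℕ) where
  X₁ := (F₁.mapHomologicalComplex _).obj P
  X₂ := (F₂.mapHomologicalComplex _).obj P
  X₃ := (F₃.mapHomologicalComplex _).obj P
  f := (NatTrans.mapHomologicalComplex α _).app P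
  g := (NatTrans.mapHomologicalComplex β _).app P
  zero := by
    ext k
    have := congrArg (fun f => f.app (P.X k)) h
    exact this

/-- Functoriality of `mapComplexShortComplex` in the complex. -/
@[simps]
noncomputable def mapComplexShortComplexMap {F₁ F₂ F₃ : C ⥤ D} [F₁.Additive] [F₂.Additive]
    [F₃.Additive] (α : F₁ ⟶ F₂) (β : F₂ ⟶ F₃) (h : α ≫ β = 0) {P Q : ChainComplex C ℕ}
    (φ : P ⟶ Q) : mapComplexShortComplex α β h P ⟶ mapComplexShortComplex α β h Q where
  τ₁ := (F₁.mapHomologicalComplex _).map φ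
  τ₂ := (F₂.mapHomologicalComplex _).map φ
  τ₃ := (F₃.mapHomologicalComplex _).map φ
  comm₁₂ := ((NatTrans.mapHomologicalComplex α _).naturality φ)
  comm₂₃ := ((NatTrans.mapHomologicalComplex β _).naturality φ)

section

variable {F₁ F₂ F₃ : C ⥤ D} [F₁.Additive] [F₂.Additive] [F₃.Additive]
    (α : F₁ ⟶ F₂) (β : F₂ ⟶ F₃) (h : α ≫ β = 0)
    (hP : ∀ X : C, Projective X → (ShortComplex.mk (α.app X) (β.app X)
      (by rw [← NatTrans.comp_app, h, NatTrans.app_zero])).ShortExact)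

-- Exactness of the functors is only assumed on projective objects, and these are the only terms of
-- the resolution. This weak hypothesis matters: `Hom(X, -)` is exact just for projective `X`.
omit [HasProjectiveResolutions C] in
include hP in
theorem mapComplexShortComplex_shortExact {X : C} (P : ProjectiveResolution X) :
    (mapComplexShortComplex α β h P.complex).ShortExact :=
  HomologicalComplex.shortExact_of_degreewise_shortExact _ fun k => hP (P.complex.X k) inferInstance

/-- The connecting homomorphism in homology, after applying a short exact sequence of functors to
a projective resolution. -/
noncomputable def resolutionConnecting {X : C} (P : ProjectiveResolution X) (i : ℕ) :
    (HomologicalComplex.homologyFunctor D (ComplexShape.down ℕ) (i + 1)).obj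
      ((F₃.mapHomologicalComplex _).obj P.complex) ⟶
    (HomologicalComplex.homologyFunctor D (ComplexShape.down ℕ) i).obj
      ((F₁.mapHomologicalComplex _).obj P.complex) :=
  (mapComplexShortComplex_shortExact α β h hP P).δ (i + 1) i (by simp)

omit [HasProjectiveResolutions C] in
theorem resolutionConnecting_naturality {X Y : C} (P : ProjectiveResolution X)
    (Q : ProjectiveResolution Y) (φ : P.complex ⟶ Q.complex) (i : ℕ) :
    resolutionConnecting α β h hP P i ≫
      (HomologicalComplex.homologyFunctor D (ComplexShape.down ℕ) i).map
        ((F₁.mapHomologicalComplex _).map φ) =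
    (HomologicalComplex.homologyFunctor D (ComplexShape.down ℕ) (i + 1)).map
        ((F₃.mapHomologicalComplex _).map φ) ≫ resolutionConnecting α β h hP Q i :=
  HomologicalComplex.HomologySequence.δ_naturality
    (mapComplexShortComplexMap α β h φ) (mapComplexShortComplex_shortExact α β h hP P)
    (mapComplexShortComplex_shortExact α β h hP Q) (i + 1) i (by simp)

/-- The connecting homomorphism of left derived functors. -/
noncomputable def leftDerivedConnecting (i : ℕ) : F₃.leftDerived (i + 1) ⟶ F₁.leftDerived i where
  app X :=
    ((projectiveResolution X).isoLeftDerivedObj F₃ (i + 1)).hom ≫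
      resolutionConnecting α β h hP (projectiveResolution X) i ≫
        ((projectiveResolution X).isoLeftDerivedObj F₁ i).inv
  naturality X Y f := by
    -- Any lift of `f` to the resolutions computes the derived maps, and the connecting map is
    -- already natural for maps of complexes.
    obtain ⟨φ, comm⟩ : ∃ φ : (projectiveResolution X).complex ⟶ (projectiveResolution Y).complex,
        φ.f 0 ≫ (projectiveResolution Y).π.f 0 = (projectiveResolution X).π.f 0 ≫ f :=
      ⟨ProjectiveResolution.lift f _ _, ProjectiveResolution.lift_commutes_zero f _ _⟩
    have n := resolutionConnecting_naturality α β h hP (projectiveResolution X)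
      (projectiveResolution Y) φ i
    rw [ProjectiveResolution.isoLeftDerivedObj_hom_naturality_assoc f _ _ φ comm F₃ (i + 1),
      Category.assoc, Category.assoc,
      ProjectiveResolution.isoLeftDerivedObj_inv_naturality f _ _ φ comm F₁ i]
    simp only [Functor.comp_map, reassoc_of% n]

/-- This is the homology sequence of the chosen resolution, transported along `isoLeftDerivedObj`.
-/
theorem leftDerivedConnecting_exact₁ (i : ℕ) (X : C) :
    ∃ w, (ShortComplex.mk ((leftDerivedConnecting α β h hP i).app X)
      ((NatTrans.leftDerived α i).app X) w).Exact := by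
  let P := projectiveResolution X
  have e := (mapComplexShortComplex_shortExact α β h hP P).homology_exact₁ (i + 1) i (by simp)
  have c₁ : (leftDerivedConnecting α β h hP i).app X ≫ (P.isoLeftDerivedObj F₁ i).hom =
      (P.isoLeftDerivedObj F₃ (i + 1)).hom ≫ resolutionConnecting α β h hP P i := by
    simp [leftDerivedConnecting, P]
  have c₂ : (NatTrans.leftDerived α i).app X ≫ (P.isoLeftDerivedObj F₂ i).hom =
      (P.isoLeftDerivedObj F₁ i).hom ≫
      (HomologicalComplex.homologyFunctor D (ComplexShape.down ℕ) i).map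
        ((NatTrans.mapHomologicalComplex α _).app P.complex) := by
    rw [ProjectiveResolution.leftDerived_app_eq α P i, Category.assoc, Category.assoc,
      Iso.inv_hom_id, Category.comp_id]
  have w₀ : resolutionConnecting α β h hP P i ≫
      (HomologicalComplex.homologyFunctor D (ComplexShape.down ℕ) i).map
        ((NatTrans.mapHomologicalComplex α _).app P.complex) = 0 :=
    (mapComplexShortComplex_shortExact α β h hP P).δ_comp (i + 1) i (by simp)
  have w : (leftDerivedConnecting α β h hP i).app X ≫ (NatTrans.leftDerived α i).app X = 0 := by
    rw [← cancel_mono (P.isoLeftDerivedObj F₂ i).hom, Category.assoc, c₂, reassoc_of% c₁, w₀]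
    simp
  refine ⟨w, ?_⟩
  exact (ShortComplex.exact_iff_of_iso (ShortComplex.isoMk (S₁ := ShortComplex.mk _ _ w)
    (S₂ := ShortComplex.mk _ _ w₀) (P.isoLeftDerivedObj F₃ (i + 1))
    (P.isoLeftDerivedObj F₁ i) (P.isoLeftDerivedObj F₂ i) c₁.symm c₂.symm)).2 e

theorem leftDerivedConnecting_exact₃ (i : ℕ) (X : C) :
    ∃ w, (ShortComplex.mk ((NatTrans.leftDerived β (i + 1)).app X)
      ((leftDerivedConnecting α β h hP i).app X) w).Exact := by
  let P := projectiveResolution X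
  have e := (mapComplexShortComplex_shortExact α β h hP P).homology_exact₃ (i + 1) i (by simp)
  have c₁ : (leftDerivedConnecting α β h hP i).app X ≫ (P.isoLeftDerivedObj F₁ i).hom =
      (P.isoLeftDerivedObj F₃ (i + 1)).hom ≫ resolutionConnecting α β h hP P i := by
    simp [leftDerivedConnecting, P]
  have c₂ : (NatTrans.leftDerived β (i + 1)).app X ≫ (P.isoLeftDerivedObj F₃ (i + 1)).hom =
      (P.isoLeftDerivedObj F₂ (i + 1)).hom ≫
      (HomologicalComplex.homologyFunctor D (ComplexShape.down ℕ) (i + 1)).map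
        ((NatTrans.mapHomologicalComplex β _).app P.complex) := by
    rw [ProjectiveResolution.leftDerived_app_eq β P (i + 1), Category.assoc, Category.assoc,
      Iso.inv_hom_id, Category.comp_id]
  have w₀ : (HomologicalComplex.homologyFunctor D (ComplexShape.down ℕ) (i + 1)).map
        ((NatTrans.mapHomologicalComplex β _).app P.complex) ≫
      resolutionConnecting α β h hP P i = 0 :=
    (mapComplexShortComplex_shortExact α β h hP P).comp_δ (i + 1) i (by simp)
  have w : (NatTrans.leftDerived β (i + 1)).app X ≫
      (leftDerivedConnecting α β h hP i).app X = 0 := by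
    rw [← cancel_mono (P.isoLeftDerivedObj F₁ i).hom, Category.assoc, c₁, reassoc_of% c₂, w₀]
    simp
  refine ⟨w, ?_⟩
  exact (ShortComplex.exact_iff_of_iso (ShortComplex.isoMk (S₁ := ShortComplex.mk _ _ w)
    (S₂ := ShortComplex.mk _ _ w₀) (P.isoLeftDerivedObj F₂ (i + 1))
    (P.isoLeftDerivedObj F₃ (i + 1)) (P.isoLeftDerivedObj F₁ i) c₂.symm c₁.symm)).2 e

end

/-- The natural transformation `F.leftDerived 0 ⟶ F` is natural in `F`. -/
theorem leftDerived_comp_fromLeftDerivedZero {F G : C ⥤ D} [F.Additive] [G.Additive] (α : F ⟶ G)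
    (X : C) : (NatTrans.leftDerived α 0).app X ≫ G.fromLeftDerivedZero.app X =
      F.fromLeftDerivedZero.app X ≫ α.app X := by
  let P := projectiveResolution X
  rw [ProjectiveResolution.leftDerived_app_eq α P, P.fromLeftDerivedZero_eq G,
    P.fromLeftDerivedZero_eq F]
  simp only [Category.assoc, Iso.inv_hom_id_assoc]
  have h₁ : (HomologicalComplex.homologyFunctor D (ComplexShape.down ℕ) 0).map
        ((NatTrans.mapHomologicalComplex α (ComplexShape.down ℕ)).app P.complex) ≫
      (ChainComplex.isoHomologyι₀ ((G.mapHomologicalComplex (ComplexShape.down ℕ)).obj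
        P.complex)).hom = (ChainComplex.isoHomologyι₀ _).hom ≫
      HomologicalComplex.opcyclesMap
        ((NatTrans.mapHomologicalComplex α (ComplexShape.down ℕ)).app P.complex) 0 :=
    HomologicalComplex.homologyι_naturality _ _
  have h₂ : HomologicalComplex.opcyclesMap
        ((NatTrans.mapHomologicalComplex α (ComplexShape.down ℕ)).app P.complex) 0 ≫
        P.fromLeftDerivedZero' G = P.fromLeftDerivedZero' F ≫ α.app X := by
    rw [← cancel_epi (HomologicalComplex.pOpcycles _ _),
      HomologicalComplex.p_opcyclesMap_assoc,
      ProjectiveResolution.pOpcycles_comp_fromLeftDerivedZero',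
      ProjectiveResolution.pOpcycles_comp_fromLeftDerivedZero'_assoc]
    exact (α.naturality (P.π.f 0)).symm
  exact congrArg _ ((Category.assoc _ _ _).symm.trans ((congrArg (· ≫ _) h₁).trans
    ((Category.assoc _ _ _).trans ((congrArg (_ ≫ ·) h₂).trans (Category.assoc _ _ _).symm))))

end LeftDerived
end CategoryTheory

end

section

open CategoryTheory Limits Opposite

universe u

namespace CategoryTheory

/-! ### The long exact sequence of `Ext` in the second variable. -/

section ExtSES

variable {R : Type u} [CommRing R]

/-- `Hom(-, Y)` as a functor to the opposite category. -/
noncomputable abbrev homTo (Y : ModuleCat.{u} R) : ModuleCat.{u} R ⥤ (ModuleCat.{u} R)ᵒᵖ :=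
  ((linearYoneda R (ModuleCat.{u} R)).obj Y).rightOp

/-- Functoriality of `homTo`. -/
noncomputable abbrev homToMap {Y Z : ModuleCat.{u} R} (f : Y ⟶ Z) : homTo Z ⟶ homTo Y :=
  NatTrans.rightOp ((linearYoneda R (ModuleCat.{u} R)).map f)

variable {S : ShortComplex (ModuleCat.{u} R)}

theorem homToMap_comp_zero (S : ShortComplex (ModuleCat.{u} R)) :
    homToMap S.g ≫ homToMap S.f = 0 := by
  ext X
  apply Quiver.Hom.unop_inj
  ext (φ : X ⟶ S.X₁)
  change (φ ≫ S.f) ≫ S.g = 0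
  simp

/-- `Ext` is derived in its first variable, so a sequence in the second variable is a sequence of
functors `Hom(-, S.X_k)`. On projectives it is exact; passing to the opposite category exchanges its
ends. -/
theorem homTo_shortExact (hS : S.ShortExact) (X : ModuleCat.{u} R) (hX : Projective X) :
    (ShortComplex.mk ((homToMap S.g).app X) ((homToMap S.f).app X)
      (by rw [← NatTrans.comp_app, homToMap_comp_zero, NatTrans.app_zero])).ShortExact := by
  have := hS.mono_f
  have := hS.epi_g
  let T : ShortComplex (ModuleCat.{u} R) := 
    ShortComplex.mk (((linearYoneda R (ModuleCat.{u} R)).map S.f).app (op X))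
      (((linearYoneda R (ModuleCat.{u} R)).map S.g).app (op X)) (by
        ext (φ : X ⟶ S.X₁)
        change (φ ≫ S.f) ≫ S.g = 0
        simp)
  have hT : T.ShortExact := by
    refine ShortComplex.ShortExact.mk' ((ShortComplex.moduleCat_exact_iff _).2 ?_) ?_ ?_
    · intro (φ : X ⟶ S.X₂) (hφ : φ ≫ S.g = 0)
      exact ⟨hS.exact.lift φ hφ, hS.exact.lift_f φ hφ⟩
    · rw [ModuleCat.mono_iff_injective]
      intro (φ : X ⟶ S.X₁) (ψ : X ⟶ S.X₁) (h : φ ≫ S.f = ψ ≫ S.f)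
      exact (cancel_mono S.f).1 h
    · rw [ModuleCat.epi_iff_surjective]
      intro (φ : X ⟶ S.X₃)
      exact ⟨Projective.factorThru φ S.g, Projective.factorThru_comp φ S.g⟩
  exact hT.op

/-- The connecting map `Ext^i(-, X₃) ⟶ Ext^{i+1}(-, X₁)` of a short exact sequence. -/
noncomputable def extConnecting (hS : S.ShortExact) (i : ℕ) :
    (Ext R (ModuleCat.{u} R) i).flip.obj S.X₃ ⟶ (Ext R (ModuleCat.{u} R) (i + 1)).flip.obj S.X₁ :=
  NatTrans.leftOp (leftDerivedConnecting _ _ (homToMap_comp_zero S) (homTo_shortExact hS) i)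

theorem extConnecting_exact (hS : S.ShortExact) (i : ℕ) (X : (ModuleCat.{u} R)ᵒᵖ) :
    Function.Exact (((Ext R (ModuleCat.{u} R) i).flip.map S.g).app X)
      ((extConnecting hS i).app X) := by
  obtain ⟨w, e⟩ := leftDerivedConnecting_exact₁ _ _ (homToMap_comp_zero S)
    (homTo_shortExact hS) i X.unop
  exact (ShortComplex.ShortExact.moduleCat_exact_iff_function_exact _).1 e.unop

theorem extConnecting_exact' (hS : S.ShortExact) (i : ℕ) (X : (ModuleCat.{u} R)ᵒᵖ) :
    Function.Exact ((extConnecting hS i).app X)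
      (((Ext R (ModuleCat.{u} R) (i + 1)).flip.map S.f).app X) := by
  obtain ⟨w, e⟩ := leftDerivedConnecting_exact₃ _ _ (homToMap_comp_zero S)
    (homTo_shortExact hS) i X.unop
  exact (ShortComplex.ShortExact.moduleCat_exact_iff_function_exact _).1 e.unop

/-- `Hom(-, J)` keeps the projective resolution exact in positive degrees: a cocycle descends to the
next boundary module and extends from there by injectivity of `J`. -/
theorem isZero_ext_succ_of_injective (X J : ModuleCat.{u} R) [Injective J] (i : ℕ) :
    IsZero (((Ext R (ModuleCat.{u} R) (i + 1)).obj (op X)).obj J) := by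
  let P := projectiveResolution X
  refine IsZero.of_iso ?_ (P.isoExt (R := R) (i + 1) J)
  rw [← HomologicalComplex.exactAt_iff_isZero_homology,
    HomologicalComplex.exactAt_iff' _ i (i + 1) (i + 2) (by simp) (by simp),
    ShortComplex.moduleCat_exact_iff]
  intro (φ : P.complex.X (i + 1) ⟶ J) (hφ : P.complex.d (i + 2) (i + 1) ≫ φ = 0)
  have e : (P.complex.sc' (i + 2) (i + 1) i).Exact :=
    (P.complex.exactAt_iff' _ _ _ (by simp) (by simp)).1 (P.complex_exactAt_succ i)
  exact ⟨e.descToInjective φ hφ, e.comp_descToInjective φ hφ⟩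

/-- Left exactness of `Hom(-, Y)`, seen in the opposite category; it is what identifies the zeroth
derived functor with `Hom(-, Y)`. -/
instance (Y : ModuleCat.{u} R) : PreservesFiniteColimits (homTo Y) := by
  have : PreservesLimits ((linearYoneda R (ModuleCat.{u} R)).obj Y ⋙ forget (ModuleCat.{u} R)) :=
    inferInstanceAs (PreservesLimits (yoneda.obj Y))
  have : PreservesLimits ((linearYoneda R (ModuleCat.{u} R)).obj Y) :=
    preservesLimits_of_reflects_of_preserves _ (forget (ModuleCat.{u} R))
  exact preservesFiniteColimits_rightOp _

/-- `Hom(-, Y) ≅ Ext^0(-, Y)`. -/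
noncomputable def homIsoExtZero (Y : ModuleCat.{u} R) :
    (linearYoneda R (ModuleCat.{u} R)).obj Y ≅ (Ext R (ModuleCat.{u} R) 0).flip.obj Y where
  hom := NatTrans.leftOp (homTo Y).fromLeftDerivedZero
  inv := NatTrans.leftOp (homTo Y).leftDerivedZeroIsoSelf.inv
  hom_inv_id := congrArg NatTrans.leftOp (homTo Y).leftDerivedZeroIsoSelf.inv_hom_id
  inv_hom_id := congrArg NatTrans.leftOp (homTo Y).leftDerivedZeroIsoSelf.hom_inv_id

theorem homIsoExtZero_naturality {Y Z : ModuleCat.{u} R} (f : Y ⟶ Z) :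
    (linearYoneda R (ModuleCat.{u} R)).map f ≫ (homIsoExtZero Z).hom =
      (homIsoExtZero Y).hom ≫ (Ext R (ModuleCat.{u} R) 0).flip.map f := by
  ext1
  ext1 X
  exact (congrArg Quiver.Hom.unop (leftDerived_comp_fromLeftDerivedZero (homToMap f) X.unop)).symm

end ExtSES
end CategoryTheory

end

section

open CategoryTheory Limits Opposite

universe u

namespace CategoryTheory

/-! ### Exactness of filtered colimits of modules. -/

section FilteredColimits

variable {R : Type u} [CommRing R] {D : Type} [SmallCategory D] [IsFiltered D]

instance : PreservesFilteredColimitsOfSize.{0, 0} (forget (ModuleCat.{u} R)) :=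
  preservesFilteredColimitsOfSize_shrink.{0, u, 0, u} _

/-- Filtered colimits of modules are exact. -/
theorem exact_of_isColimit_of_exact {A B C : D ⥤ ModuleCat.{u} R} (f : A ⟶ B) (g : B ⟶ C)
    {a : Cocone A} {b : Cocone B} {c : Cocone C} (ha : IsColimit a) (hb : IsColimit b)
    (hc : IsColimit c) (f' : a.pt ⟶ b.pt) (g' : b.pt ⟶ c.pt)
    (hf : ∀ k, a.ι.app k ≫ f' = f.app k ≫ b.ι.app k)
    (hg : ∀ k, b.ι.app k ≫ g' = g.app k ≫ c.ι.app k)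
    (h : ∀ k, Function.Exact (f.app k) (g.app k)) : Function.Exact f' g' := by
  have hf' : ∀ k x, f' (a.ι.app k x) = b.ι.app k (f.app k x) := fun k x =>
    congrArg (fun m => m.hom x) (hf k)
  have hg' : ∀ k x, g' (b.ι.app k x) = c.ι.app k (g.app k x) := fun k x =>
    congrArg (fun m => m.hom x) (hg k)
  intro y
  constructor
  · intro hy
    obtain ⟨k, y, rfl⟩ := Concrete.isColimit_exists_rep B hb y
    rw [hg'] at hy
    -- An element that vanishes in the colimit already vanishes at some later index `l`, and
    -- exactness is used there.
    obtain ⟨l, p, q, hpq⟩ := (Concrete.isColimit_rep_eq_iff_exists C hc (g.app k y)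
      (0 : C.obj k)).1 (hy.trans (map_zero (c.ι.app k).hom).symm)
    have hz : g.app l (B.map p y) = 0 := by
      have := congrArg (fun m => m.hom y) (g.naturality p)
      exact this.trans (hpq.trans (map_zero (C.map q).hom))
    obtain ⟨x, hx⟩ := (h l _).1 hz
    refine ⟨a.ι.app l x, ?_⟩
    rw [hf', hx]
    exact congrArg (fun m => m.hom y) (b.w p)
  · rintro ⟨x, rfl⟩
    obtain ⟨k, x, rfl⟩ := Concrete.isColimit_exists_rep A ha x
    rw [hf', hg', (h k _).2 ⟨x, rfl⟩]
    exact map_zero (c.ι.app k).hom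

end FilteredColimits

end CategoryTheory

namespace localCohomology

/-! ### The long exact sequence of local cohomology and its vanishing on injectives. -/

section

variable {R : Type u} [CommRing R] (J : Ideal R)

/-- The directed system `Ext^i(R/J^k, M)`. -/
noncomputable abbrev extSystem (i : ℕ) (M : ModuleCat.{u} R) : ℕᵒᵖᵒᵖ ⥤ ModuleCat.{u} R :=
  (ringModIdeals (idealPowersDiagram J)).op ⋙ (Ext R (ModuleCat.{u} R) i).flip.obj M

/-- Local cohomology as a cocone over `Ext^i(R/J^k, M)`. -/
noncomputable abbrev extCocone (i : ℕ) (M : ModuleCat.{u} R) : Cocone (extSystem J i M) :=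
  ((evaluation _ _).obj M).mapCocone (colimit.cocone (diagram (idealPowersDiagram J) i))

/-- Local cohomology is the colimit of `Ext^i(R/J^k, M)`. -/
noncomputable def isColimitExtCocone (i : ℕ) (M : ModuleCat.{u} R) :
    IsColimit (extCocone J i M) :=
  isColimitOfPreserves ((evaluation _ _).obj M) (colimit.isColimit _)

theorem extCocone_naturality (i : ℕ) {M N : ModuleCat.{u} R} (f : M ⟶ N) (k : ℕᵒᵖᵒᵖ) :
    (extCocone J i M).ι.app k ≫ (localCohomology J i).map f =
      ((Ext R (ModuleCat.{u} R) i).flip.map f).app _ ≫ (extCocone J i N).ι.app k :=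
  (((colimit.cocone (diagram (idealPowersDiagram J) i)).ι.app k).naturality f).symm

variable {S : ShortComplex (ModuleCat.{u} R)} (hS : S.ShortExact)

/-- The connecting homomorphism in local cohomology. -/
noncomputable def connecting (i : ℕ) :
    (localCohomology J i).obj S.X₃ ⟶ (localCohomology J (i + 1)).obj S.X₁ :=
  IsColimit.map (isColimitExtCocone J i S.X₃) (extCocone J (i + 1) S.X₁)
    (Functor.whiskerLeft _ (extConnecting hS i))

theorem ι_connecting (i : ℕ) (k : ℕᵒᵖᵒᵖ) :
    (extCocone J i S.X₃).ι.app k ≫ connecting J hS i =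
      (extConnecting hS i).app _ ≫ (extCocone J (i + 1) S.X₁).ι.app k :=
  IsColimit.ι_map _ _ _ _

theorem connecting_exact (i : ℕ) :
    Function.Exact ((localCohomology J i).map S.g) (connecting J hS i) :=
  exact_of_isColimit_of_exact (Functor.whiskerLeft _ ((Ext R (ModuleCat.{u} R) i).flip.map S.g))
    (Functor.whiskerLeft _ (extConnecting hS i)) (isColimitExtCocone J i S.X₂)
    (isColimitExtCocone J i S.X₃) (isColimitExtCocone J (i + 1) S.X₁) _ _
    (extCocone_naturality J i S.g) (ι_connecting J hS i)
    (fun _ => extConnecting_exact hS i _)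

theorem connecting_exact' (i : ℕ) :
    Function.Exact (connecting J hS i) ((localCohomology J (i + 1)).map S.f) :=
  exact_of_isColimit_of_exact (Functor.whiskerLeft _ (extConnecting hS i))
    (Functor.whiskerLeft _ ((Ext R (ModuleCat.{u} R) (i + 1)).flip.map S.f))
    (isColimitExtCocone J i S.X₃) (isColimitExtCocone J (i + 1) S.X₁)
    (isColimitExtCocone J (i + 1) S.X₂) _ _
    (ι_connecting J hS i) (extCocone_naturality J (i + 1) S.f)
    (fun _ => extConnecting_exact' hS i _)

theorem subsingleton_succ_of_injective (i : ℕ) (E : ModuleCat.{u} R) [Injective E] :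
    Subsingleton ((localCohomology J (i + 1)).obj E) := by
  refine ⟨fun x y => ?_⟩
  obtain ⟨k, x, rfl⟩ := Concrete.isColimit_exists_rep _ (isColimitExtCocone J (i + 1) E) x
  obtain ⟨l, y, rfl⟩ := Concrete.isColimit_exists_rep _ (isColimitExtCocone J (i + 1) E) y
  have hx : ∀ (k : ℕᵒᵖᵒᵖ) (z : (extSystem J (i + 1) E).obj k), z = 0 := fun k z => 
    (ModuleCat.subsingleton_of_isZero (isZero_ext_succ_of_injective
      ((ringModIdeals (idealPowersDiagram J)).obj k.unop) E i)).elim _ _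
  rw [hx k x, hx l y]
  exact (map_zero ((extCocone J (i + 1) E).ι.app k).hom).trans
    (map_zero ((extCocone J (i + 1) E).ι.app l).hom).symm

/-- The next term of the sequence is the cohomology of `S.X₂` in degree `i + 1`, which is zero. -/
theorem connecting_surjective (i : ℕ) [Injective S.X₂] :
    Function.Surjective (connecting J hS i) := fun x =>
  (connecting_exact' J hS i x).1 ((subsingleton_succ_of_injective J i S.X₂).elim _ _)

end

end localCohomology

end

section

open CategoryTheory Limits Opposite

universe u

namespace localCohomology

/-! ### Zeroth local cohomology is the torsion submodule. -/

section

variable {R : Type u} [CommRing R] (J : Ideal R)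

/-- Evaluation at `1`, from `Hom(R/J^k, M)` to `M`. -/
noncomputable def evalOne (M : ModuleCat.{u} R) (k : ℕᵒᵖᵒᵖ) :
    ((linearYoneda R (ModuleCat.{u} R)).obj M).obj
      ((ringModIdeals (idealPowersDiagram J)).op.obj k) ⟶ M :=
  ModuleCat.ofHom
    { toFun := fun φ : (ringModIdeals (idealPowersDiagram J)).obj k.unop ⟶ M =>
        φ.hom (Ideal.Quotient.mk _ 1)
      map_add' := fun _ _ => rfl
      map_smul' := fun _ _ => rfl }

theorem evalOne_injective (M : ModuleCat.{u} R) (k : ℕᵒᵖᵒᵖ) :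
    Function.Injective (evalOne J M k) := by
  intro (φ : ModuleCat.of R (R ⧸ J ^ k.unop.unop) ⟶ M) 
    (ψ : ModuleCat.of R (R ⧸ J ^ k.unop.unop) ⟶ M) h
  apply ModuleCat.hom_ext
  exact Submodule.linearMap_qext _ (LinearMap.ext_ring h)

/-- A map from the cyclic module `R/J^k` is the choice of an element annihilated by `J^k`. -/
theorem evalOne_range (M : ModuleCat.{u} R) (k : ℕᵒᵖᵒᵖ) (m : M) :
    (∃ φ, evalOne J M k φ = m) ↔ ∀ r ∈ J ^ k.unop.unop, r • m = 0 := by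
  constructor
  · rintro ⟨φ, rfl⟩ r hr
    change r • (ModuleCat.Hom.hom (show ModuleCat.of R (R ⧸ J ^ k.unop.unop) ⟶ M from φ))
      (Ideal.Quotient.mk _ 1) = 0
    rw [← map_smul]
    have : r • (Ideal.Quotient.mk (J ^ k.unop.unop) 1) = 0 := by
      rw [← Ideal.Quotient.mk_eq_mk, ← Submodule.Quotient.mk_smul, Submodule.Quotient.mk_eq_zero]
      simpa using hr
    exact (congrArg _ this).trans (map_zero _)
  · intro h
    refine ⟨ModuleCat.ofHom ((J ^ k.unop.unop).liftQ (LinearMap.toSpanSingleton R M m) ?_), ?_⟩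
    · intro r hr
      exact h r hr
    · exact one_smul R m

/-- The natural map from zeroth local cohomology to the module. -/
noncomputable def toModule (M : ModuleCat.{u} R) : (localCohomology J 0).obj M ⟶ M :=
  (isColimitExtCocone J 0 M).desc
    { pt := M
      ι :=
        { app := fun k => (homIsoExtZero M).inv.app _ ≫ evalOne J M k
          naturality := fun k l f => by
            have := (homIsoExtZero M).inv.naturality
              ((ringModIdeals (idealPowersDiagram J)).op.map f)
            refine (Category.assoc _ _ _).symm.trans ((congrArg (· ≫ _) this).trans ?_)
            exact (Category.assoc _ _ _).trans (Category.comp_id _).symm } }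

theorem ι_toModule (M : ModuleCat.{u} R) (k : ℕᵒᵖᵒᵖ) :
    (extCocone J 0 M).ι.app k ≫ toModule J M = (homIsoExtZero M).inv.app _ ≫ evalOne J M k :=
  (isColimitExtCocone J 0 M).fac _ k

theorem toModule_naturality {M N : ModuleCat.{u} R} (f : M ⟶ N) :
    (localCohomology J 0).map f ≫ toModule J N = toModule J M ≫ f := by
  refine (isColimitExtCocone J 0 M).hom_ext fun k => ?_
  have h₁ := extCocone_naturality J 0 f k
  have h₂ : ((Ext R (ModuleCat.{u} R) 0).flip.map f).app _ ≫ (homIsoExtZero N).inv.app _ =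
      (homIsoExtZero M).inv.app ((ringModIdeals (idealPowersDiagram J)).op.obj k) ≫
        ((linearYoneda R (ModuleCat.{u} R)).map f).app _ := by
    have h := NatTrans.congr_app ((Iso.comp_inv_eq _).2 (homIsoExtZero_naturality f).symm) 
      ((ringModIdeals (idealPowersDiagram J)).op.obj k)
    rw [← cancel_epi ((homIsoExtZero M).hom.app
      ((ringModIdeals (idealPowersDiagram J)).op.obj k))]
    refine (Category.assoc _ _ _).symm.trans (h.trans ?_)
    exact (Iso.hom_inv_id_app_assoc (homIsoExtZero M) _ _).symm
  calc (extCocone J 0 M).ι.app k ≫ (localCohomology J 0).map f ≫ toModule J N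
      = ((Ext R (ModuleCat.{u} R) 0).flip.map f).app _ ≫ (extCocone J 0 N).ι.app k ≫
          toModule J N :=
        (Category.assoc _ _ _).symm.trans ((congrArg (· ≫ _) h₁).trans (Category.assoc _ _ _))
    _ = ((Ext R (ModuleCat.{u} R) 0).flip.map f).app _ ≫
          (homIsoExtZero N).inv.app _ ≫ evalOne J N k := congrArg (_ ≫ ·) (ι_toModule J N k)
    _ = ((homIsoExtZero M).inv.app _ ≫
        ((linearYoneda R (ModuleCat.{u} R)).map f).app _) ≫ evalOne J N k :=
        (Category.assoc _ _ _).symm.trans (congrArg (· ≫ _) h₂)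
    _ = (homIsoExtZero M).inv.app _ ≫ evalOne J M k ≫ f := Category.assoc _ _ _
    _ = ((extCocone J 0 M).ι.app k ≫ toModule J M) ≫ f :=
        (Category.assoc _ _ _).symm.trans (congrArg (· ≫ f) (ι_toModule J M k).symm)
    _ = _ := Category.assoc _ _ _

theorem homIsoExtZero_inv_bijective (M : ModuleCat.{u} R) (X : (ModuleCat.{u} R)ᵒᵖ) :
    Function.Bijective ((homIsoExtZero M).inv.app X) :=
  ConcreteCategory.bijective_of_isIso ((homIsoExtZero M).inv.app X)

theorem toModule_ι_apply (M : ModuleCat.{u} R) (k : ℕᵒᵖᵒᵖ) (x : (extSystem J 0 M).obj k) :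
    toModule J M ((extCocone J 0 M).ι.app k x) = evalOne J M k ((homIsoExtZero M).inv.app _ x) :=
  congrArg (fun m => m.hom x) (ι_toModule J M k)

theorem toModule_injective (M : ModuleCat.{u} R) : Function.Injective (toModule J M) := by
  refine (injective_iff_map_eq_zero (toModule J M).hom).2 fun x hx => ?_
  obtain ⟨k, x, rfl⟩ := Concrete.isColimit_exists_rep _ (isColimitExtCocone J 0 M) x
  have h := (toModule_ι_apply J M k x).symm.trans hx
  have : x = 0 := (homIsoExtZero_inv_bijective M _).1 <| evalOne_injective J M k <|
    h.trans ((congrArg _ (map_zero ((homIsoExtZero M).inv.app _).hom)).trans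
      (map_zero (evalOne J M k).hom)).symm
  rw [this]
  exact map_zero ((extCocone J 0 M).ι.app k).hom

/-- The stage `Ext^0(R/J^k, M)` contributes the elements killed by `J^k`, and the colimit is the
union of these. -/
theorem toModule_range (M : ModuleCat.{u} R) (m : M) :
    (∃ x, toModule J M x = m) ↔ ∃ k : ℕ, ∀ r ∈ J ^ k, r • m = 0 := by
  constructor
  · rintro ⟨x, rfl⟩
    obtain ⟨k, x, rfl⟩ := Concrete.isColimit_exists_rep _ (isColimitExtCocone J 0 M) x
    exact ⟨k.unop.unop, (evalOne_range J M k _).1 ⟨_, (toModule_ι_apply J M k x).symm⟩⟩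
  · rintro ⟨k, hk⟩
    obtain ⟨φ, hφ⟩ := (evalOne_range J M (op (op k)) m).2 hk
    obtain ⟨x, rfl⟩ := (homIsoExtZero_inv_bijective M _).2 φ
    exact ⟨_, (toModule_ι_apply J M (op (op k)) x).trans hφ⟩

end

end localCohomology

end

section


universe u v

namespace MonomialLC

/-! ### Dimension shifting for complexes given by total modules. -/

section DimensionShift

variable {R : Type*} [CommRing R] {X Y Z : Type*} [AddCommGroup X] [Module R X]
  [AddCommGroup Y] [Module R Y] [AddCommGroup Z] [Module R Z]

/-- Dimension shifting: in a short exact sequence of complexes whose middle term has no cohomology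
in degree `t + 1`, the cohomology of the first term in degree `t + 1` is a quotient of that of the
last term in degree `t`. The complexes are given by their total modules, with the submodules of
elements of each degree. -/
theorem nonempty_equiv_of_shortExact (dX : X →ₗ[R] X) (dY : Y →ₗ[R] Y) (dZ : Z →ₗ[R] Z)
    (tX : ℤ → Submodule R X) (tY : ℤ → Submodule R Y) (tZ : ℤ → Submodule R Z)
    (F : X →ₗ[R] Y) (G : Y →ₗ[R] Z) (hF : Function.Injective F) (hFG : Function.Exact F G)
    (hdF : ∀ x, F (dX x) = dY (F x)) (hdG : ∀ y, G (dY y) = dZ (G y))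
    (hdd : ∀ y, dY (dY y) = 0) (htF : ∀ t x, F x ∈ tY t ↔ x ∈ tX t)
    (htG : ∀ t, (tY t).map G = tZ t) (hd : ∀ t, ∀ y ∈ tY t, dY y ∈ tY (t + 1)) (t : ℤ)
    (hv : tY (t + 1) ⊓ LinearMap.ker dY ≤ (tY t).map dY) :
    Nonempty (((tX (t + 1) ⊓ LinearMap.ker dX : Submodule R X) ⧸
        ((tX t).map dX).submoduleOf (tX (t + 1) ⊓ LinearMap.ker dX)) ≃ₗ[R]
      ((tZ t ⊓ LinearMap.ker dZ : Submodule R Z) ⧸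
        ((tZ (t - 1)).map dZ ⊔ (tY t ⊓ LinearMap.ker dY).map G).submoduleOf
          (tZ t ⊓ LinearMap.ker dZ))) := by
  -- The relation behind the snake lemma. Both `w ↦ F⁻¹(dY w)` and `w ↦ G w` map `W` onto the two
  -- subquotients, so it remains to see that their kernels agree.
  let W : Submodule R Y := (LinearMap.range F).comap dY ⊓ tY t
  have hGF : ∀ x, G (F x) = 0 := fun x => (hFG _).2 ⟨x, rfl⟩
  let φ₀ : W →ₗ[R] X := (LinearEquiv.ofInjective F hF).symm.toLinearMap ∘ₗ
    ((dY ∘ₗ W.subtype).codRestrict (LinearMap.range F) fun w => w.2.1)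
  have hφ₀ : ∀ w, F (φ₀ w) = dY w := fun w => by
    have := (LinearEquiv.ofInjective F hF).apply_symm_apply
      ((dY ∘ₗ W.subtype).codRestrict (LinearMap.range F) (fun w => w.2.1) w)
    exact congrArg Subtype.val this
  let φ₁ : W →ₗ[R] (tX (t + 1) ⊓ LinearMap.ker dX : Submodule R X) :=
    φ₀.codRestrict _ fun w => by
      refine ⟨(htF _ _).1 ?_, hF ?_⟩
      · rw [hφ₀]; exact hd t w w.2.2
      · rw [hdF, hφ₀, hdd, map_zero]
  let φ := (((tX t).map dX).submoduleOf (tX (t + 1) ⊓ LinearMap.ker dX)).mkQ ∘ₗ φ₁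
  let ψ₁ : W →ₗ[R] (tZ t ⊓ LinearMap.ker dZ : Submodule R Z) :=
    (G ∘ₗ W.subtype).codRestrict _ fun w => by
      refine ⟨(htG t).le ⟨w, w.2.2, rfl⟩, ?_⟩
      obtain ⟨x, hx⟩ := w.2.1
      change dZ (G w) = 0
      rw [← hdG, ← hx, hGF]
  let ψ := (((tZ (t - 1)).map dZ ⊔ (tY t ⊓ LinearMap.ker dY).map G).submoduleOf
          (tZ t ⊓ LinearMap.ker dZ)).mkQ ∘ₗ ψ₁
  have hφ : Function.Surjective φ := by
    refine (Submodule.mkQ_surjective _).comp ?_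
    rintro ⟨z, hz₁, hz₂⟩
    have h₁ : F z ∈ tY (t + 1) ⊓ LinearMap.ker dY :=
      ⟨(htF _ _).2 hz₁, by
        change dY (F z) = 0
        rw [← hdF, LinearMap.mem_ker.1 hz₂, map_zero]⟩
    -- The only use of the vanishing of the middle cohomology in degree `t + 1`.
    obtain ⟨y, hy, hyz⟩ := hv h₁
    refine ⟨⟨y, ⟨z, hyz.symm⟩, hy⟩, Subtype.ext (hF ?_)⟩
    exact (hφ₀ _).trans hyz
  have hψ : Function.Surjective ψ := by
    refine (Submodule.mkQ_surjective _).comp ?_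
    rintro ⟨z, hz₁, hz₂⟩
    obtain ⟨y, hy, rfl⟩ := (htG t).ge hz₁
    exact ⟨⟨y, (hFG _).1 ((hdG y).trans hz₂), hy⟩, rfl⟩
  have hker : LinearMap.ker φ = LinearMap.ker ψ := by
    ext w
    have e₁ : w ∈ LinearMap.ker φ ↔ φ₀ w ∈ (tX t).map dX :=
      (Submodule.Quotient.mk_eq_zero _)
    have e₂ : w ∈ LinearMap.ker ψ ↔
        G w ∈ (tZ (t - 1)).map dZ ⊔ (tY t ⊓ LinearMap.ker dY).map G :=
      (Submodule.Quotient.mk_eq_zero _)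
    rw [e₁, e₂]
    constructor
    · rintro ⟨x, hx, hxw⟩
      refine Submodule.mem_sup_right ⟨w - F x, ⟨sub_mem w.2.2 ((htF _ _).2 hx), ?_⟩, ?_⟩
      · change dY (w - F x) = 0
        rw [map_sub, ← hdF, hxw, hφ₀, sub_self]
      · rw [map_sub, hGF, sub_zero]
    · intro h
      obtain ⟨_, ⟨z, hz, rfl⟩, _, ⟨y, ⟨hy, hy'⟩, rfl⟩, h⟩ := Submodule.mem_sup.1 h
      obtain ⟨y', hy₁, rfl⟩ := (htG _).ge hz
      -- Subtracting a coboundary and a cocycle of `Y` moves `w` into the image of `F`; the preimage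
      -- `x` then satisfies `dX x = φ₀ w`.
      have : G (w - dY y' - y) = 0 := by
        rw [map_sub, map_sub, hdG, ← h]; abel
      obtain ⟨x, hx⟩ := (hFG _).1 this
      refine ⟨x, (htF _ _).1 ?_, hF ?_⟩
      · rw [hx]
        refine sub_mem (sub_mem w.2.2 ?_) hy
        have := hd _ _ hy₁
        rwa [sub_add_cancel] at this
      · rw [hφ₀, hdF, hx, map_sub, map_sub, hdd, LinearMap.mem_ker.1 hy', sub_zero, sub_zero]
  exact ⟨(φ.quotKerEquivOfSurjective hφ).symm ≪≫ₗ Submodule.quotEquivOfEq _ _ hker ≪≫ₗ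
    ψ.quotKerEquivOfSurjective hψ⟩

end DimensionShift

section SubsetSystem

/-! ### Complexes indexed by the subsets of `{1, …, n}` -/

variable {n : ℕ} {R : Type*} [CommRing R]
  {A : Finset (Fin n) → Type*} [∀ F, AddCommGroup (A F)] [∀ F, Module R (A F)]
  {B : Finset (Fin n) → Type*} [∀ F, AddCommGroup (B F)] [∀ F, Module R (B F)]

/-- The differential on the product of a system of modules indexed by subsets. -/
noncomputable def subsetD (ι : ∀ {F F' : Finset (Fin n)}, F ⊆ F' → A F →ₗ[R] A F') :
    (∀ F, A F) →ₗ[R] (∀ F, A F) :=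
  LinearMap.pi fun F' => ∑ j ∈ F',
    (-1 : R) ^ position F' j • (ι (F'.erase_subset j) ∘ₗ LinearMap.proj (F'.erase j))

/-- The elements of degree `t`. -/
def subsetTerm (R : Type*) [CommRing R] (A : Finset (Fin n) → Type*) [∀ F, AddCommGroup (A F)]
    [∀ F, Module R (A F)] (t : ℤ) : Submodule R (∀ F, A F) :=
  Submodule.pi {F : Finset (Fin n) | (F.card : ℤ) ≠ t} (fun _ => ⊥)

variable (ι : ∀ {F F' : Finset (Fin n)}, F ⊆ F' → A F →ₗ[R] A F')
  (κ : ∀ {F F' : Finset (Fin n)}, F ⊆ F' → B F →ₗ[R] B F')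

theorem subsetD_apply (z : ∀ F, A F) (F : Finset (Fin n)) :
    subsetD ι z F = ∑ j ∈ F, (-1 : R) ^ position F j • ι (F.erase_subset j) (z (F.erase j)) := by
  simp [subsetD]

/-- Deleting a smaller element lowers the position by one, deleting a larger one does not change it.
This asymmetry is the source of the sign in `d² = 0`. -/
theorem position_erase_of_lt {F : Finset (Fin n)} {j k : Fin n} (h : j < k) (hj : j ∈ F) :
    position F k = position (F.erase j) k + 1 := by
  unfold position
  rw [Finset.filter_erase, Finset.card_erase_add_one]
  simp [hj, h]

theorem position_erase_of_gt {F : Finset (Fin n)} {j k : Fin n} (h : j < k) :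
    position (F.erase k) j = position F j := by
  unfold position
  rw [Finset.filter_erase, Finset.erase_eq_of_notMem]
  simp [h.le]

theorem subsetD_mem {t : ℤ} {z : ∀ F, A F} (hz : z ∈ subsetTerm R A t) :
    subsetD ι z ∈ subsetTerm R A (t + 1) := by
  intro F hF
  change subsetD ι z F = 0
  rw [subsetD_apply]
  refine Finset.sum_eq_zero fun j hj => ?_
  rw [hz (F.erase j), map_zero, smul_zero]
  have := Finset.card_erase_add_one hj
  have hF' : (F.card : ℤ) ≠ t + 1 := hF
  change ((F.erase j).card : ℤ) ≠ t
  omega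

variable (hι : ∀ {F F' F'' : Finset (Fin n)} (h : F ⊆ F') (h' : F' ⊆ F'') (y : A F),
  ι h' (ι h y) = ι (h.trans h') y)

-- The summands for `(j, k)` and `(k, j)` pass through the same set `F ∖ {j, k}` and carry opposite
-- signs, so they cancel in pairs.
include hι in
theorem subsetD_subsetD (z : ∀ F, A F) : subsetD ι (subsetD ι z) = 0 := by
  ext F
  rw [subsetD_apply]
  have h₁ : ∀ j ∈ F, (-1 : R) ^ position F j • ι (F.erase_subset j) (subsetD ι z (F.erase j)) =
      ∑ k ∈ F.erase j, (-1 : R) ^ (position F j + position (F.erase j) k) •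
        ι (((F.erase j).erase_subset k).trans (F.erase_subset j)) (z ((F.erase j).erase k)) := by
    intro j _
    rw [subsetD_apply, map_sum, Finset.smul_sum]
    refine Finset.sum_congr rfl fun k _ => ?_
    rw [map_smul, hι, smul_smul, pow_add]
  rw [Finset.sum_congr rfl h₁, Finset.sum_sigma']
  -- The module depends on the set, so values at equal sets are compared only after mapping them
  -- into the module at `F`.
  have key : ∀ {G G' : Finset (Fin n)} (e : G = G') (h : G ⊆ F) (h' : G' ⊆ F),
      ι h (z G) = ι h' (z G') := by
    rintro G _ rfl _ _; rfl
  refine Finset.sum_involution (fun p _ => ⟨p.2, p.1⟩) ?_ ?_ ?_ ?_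
  · rintro ⟨j, k⟩ hp
    simp only [Finset.mem_sigma, Finset.mem_erase] at hp
    obtain ⟨hj, hkj, hk⟩ := hp
    dsimp only
    rw [key (Finset.erase_right_comm (a := k) (b := j))
      (((F.erase k).erase_subset j).trans (F.erase_subset k))
      (((F.erase j).erase_subset k).trans (F.erase_subset j)), ← add_smul]
    convert zero_smul R _
    rcases lt_or_gt_of_ne hkj with h | h
    · rw [position_erase_of_lt h hk, position_erase_of_gt h]
      ring
    · rw [position_erase_of_lt h hj, position_erase_of_gt h]
      ring
  · rintro ⟨j, k⟩ hp _ h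
    simp only [Finset.mem_sigma, Finset.mem_erase] at hp
    simp only [Sigma.mk.injEq] at h
    exact hp.2.1 h.1
  · rintro ⟨j, k⟩ hp
    simp only [Finset.mem_sigma, Finset.mem_erase] at hp ⊢
    exact ⟨hp.2.2, hp.2.1.symm, hp.1⟩
  · rintro ⟨j, k⟩ _; rfl

include hι in
/-- If the maps `A F → A (F ∪ {j})` are bijective for some fixed `j` then the complex is exact. -/
theorem subset_exact_of_bijective (j : Fin n)
    (hj : ∀ F (_ : j ∉ F), Function.Bijective (ι (Finset.subset_insert j F))) (t : ℤ) :
    subsetTerm R A t ⊓ LinearMap.ker (subsetD ι) ≤ (subsetTerm R A (t - 1)).map (subsetD ι) := by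
  rintro z ⟨hz, hdz⟩
  have key : ∀ {G G' : Finset (Fin n)} (e : G = G') (F : Finset (Fin n)) (z : ∀ F, A F)
      (h : G ⊆ F) (h' : G' ⊆ F), ι h (z G) = ι h' (z G') := by
    rintro G _ rfl _ _ _ _; rfl
  choose! s hs using fun F hF => (hj F hF).2
  -- The contracting homotopy in the direction `j`. As `w` is zero on sets containing `j`, only the
  -- term that removes `j` survives in `d w` at such a set, and the sign makes this term equal to
  -- `z`.
  let w : ∀ F, A F := fun F =>
    if j ∈ F then 0 else s F ((-1 : R) ^ position (insert j F) j • z (insert j F))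
  have hw₀ : ∀ F, j ∈ F → w F = 0 := fun F h => if_pos h
  have hw₁ : ∀ F (_ : j ∉ F), ι (Finset.subset_insert j F) (w F) =
      (-1 : R) ^ position (insert j F) j • z (insert j F) := fun F h => by
    simp only [w, if_neg h]
    exact hs F h _
  have hw : w ∈ subsetTerm R A (t - 1) := by
    intro F hF
    have hF' : (F.card : ℤ) ≠ t - 1 := hF
    by_cases h : j ∈ F
    · exact hw₀ F h
    · apply (hj F h).1
      rw [hw₁ F h, map_zero, hz (insert j F), smul_zero]
      have := Finset.card_insert_of_notMem h
      change ((insert j F).card : ℤ) ≠ t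
      omega
  refine ⟨w, hw, ?_⟩
  have h₁ : ∀ F, j ∈ F → subsetD ι w F = z F := by
    intro F hF
    rw [subsetD_apply, Finset.sum_eq_single_of_mem j hF]
    · have h₂ : ∀ G (h : G ⊆ F), insert j G = F → j ∉ G →
          ι h (w G) = (-1 : R) ^ position F j • z F := by
        rintro G h rfl hG
        exact hw₁ G hG
      have h₂ := h₂ _ (F.erase_subset j) (Finset.insert_erase hF) (Finset.notMem_erase j F)
      rw [h₂, smul_smul, ← mul_pow]
      simp
    · intro k _ hkj
      rw [hw₀ _ (Finset.mem_erase.2 ⟨hkj.symm, hF⟩), map_zero, smul_zero]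
  -- The cocycle `z'` vanishes on the sets containing `j`. Its differential at `F ∪ {j}` thus
  -- reduces to the image of `z' F`, and injectivity gives `z' F = 0` as well.
  let z' := z - subsetD ι w
  have hz' : subsetD ι z' = 0 := by
    rw [map_sub, subsetD_subsetD ι hι, LinearMap.mem_ker.1 hdz, sub_zero]
  have h₂ : ∀ F, j ∈ F → z' F = 0 := fun F hF => sub_eq_zero.2 (h₁ F hF).symm
  have h₃ : ∀ F, j ∉ F → z' F = 0 := by
    intro F hF
    have h := congrFun hz' (insert j F)
    rw [subsetD_apply, Finset.sum_eq_single_of_mem j (Finset.mem_insert_self j F)] at h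
    · have h' := congrArg (fun y => (-1 : R) ^ position (insert j F) j • y) h
      simp only [smul_smul, ← mul_pow, Pi.zero_apply, smul_zero] at h'
      rw [key (Finset.erase_insert hF) _ z' _ (Finset.subset_insert j F)] at h'
      apply (hj F hF).1
      simpa using h'
    · intro k hk hkj
      rw [h₂ _ (Finset.mem_erase.2 ⟨hkj.symm, Finset.mem_insert_self j F⟩), map_zero, smul_zero]
  have h₄ : z' = 0 := funext fun F => if hF : j ∈ F then h₂ F hF else h₃ F hF
  exact (sub_eq_zero.1 h₄).symm

/-- The map on products induced by a morphism of systems. -/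
def subsetMap (f : ∀ F, A F →ₗ[R] B F) : (∀ F, A F) →ₗ[R] (∀ F, B F) :=
  LinearMap.pi fun F => f F ∘ₗ LinearMap.proj F

@[simp]
theorem subsetMap_apply (f : ∀ F, A F →ₗ[R] B F) (z : ∀ F, A F) (F : Finset (Fin n)) :
    subsetMap f z F = f F (z F) := rfl

theorem subsetMap_subsetD (f : ∀ F, A F →ₗ[R] B F)
    (hf : ∀ {F F' : Finset (Fin n)} (h : F ⊆ F') (y : A F), f F' (ι h y) = κ h (f F y))
    (z : ∀ F, A F) : subsetMap f (subsetD ι z) = subsetD κ (subsetMap f z) := by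
  ext F
  rw [subsetMap_apply, subsetD_apply, subsetD_apply, map_sum]
  exact Finset.sum_congr rfl fun j _ => by rw [map_smul, hf, subsetMap_apply]

theorem subsetMap_mem {f : ∀ F, A F →ₗ[R] B F} {t : ℤ} {z : ∀ F, A F}
    (hz : z ∈ subsetTerm R A t) : subsetMap f z ∈ subsetTerm R B t := fun F hF => by
  change f F (z F) = 0
  rw [hz F hF, map_zero]

theorem subsetMap_mem_iff {f : ∀ F, A F →ₗ[R] B F} (hf : ∀ F, Function.Injective (f F)) {t : ℤ}
    {z : ∀ F, A F} : subsetMap f z ∈ subsetTerm R B t ↔ z ∈ subsetTerm R A t :=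
  ⟨fun h F hF => hf F ((h F hF).trans (map_zero _).symm), subsetMap_mem⟩

theorem map_subsetMap_subsetTerm {f : ∀ F, A F →ₗ[R] B F} (hf : ∀ F, Function.Surjective (f F))
    (t : ℤ) : (subsetTerm R A t).map (subsetMap f) = subsetTerm R B t := by
  apply le_antisymm
  · rintro _ ⟨z, hz, rfl⟩
    exact subsetMap_mem hz
  · intro z hz
    choose s hs using hf
    -- The chosen preimage of `0` need not be `0`, so the lift is set to zero outside degree `t`.
    refine ⟨fun F => if (F.card : ℤ) = t then s F (z F) else 0, fun F hF => if_neg hF, ?_⟩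
    ext F
    rw [subsetMap_apply]
    split_ifs with h
    · exact hs F _
    · rw [map_zero]; exact (hz F h).symm

theorem subsetMap_injective {f : ∀ F, A F →ₗ[R] B F} (hf : ∀ F, Function.Injective (f F)) :
    Function.Injective (subsetMap f) := fun _ _ h => funext fun F => hf F (congrFun h F)

end SubsetSystem

end MonomialLC

end

section


universe u

namespace MonomialLC

section CechModule

/-! ### The Čech complex with coefficients in a module -/

variable {n : ℕ} {R : Type u} [CommRing R] (x : Fin n → R)

/-- The powers of `x_F`. -/
abbrev xPowers (F : Finset (Fin n)) : Submonoid R := Submonoid.powers (∏ j ∈ F, x j)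

/-- The localization of `M` at `x_F`. -/
abbrev CechMod (M : Type u) [AddCommGroup M] [Module R M] (F : Finset (Fin n)) : Type u :=
  LocalizedModule (xPowers x F) M

variable {M N P : Type u} [AddCommGroup M] [Module R M] [AddCommGroup N] [Module R N]
  [AddCommGroup P] [Module R P]

variable (M) in
/-- The map from `M` to the localization of `M` at `x_F`. -/
noncomputable abbrev cechMk (F : Finset (Fin n)) : M →ₗ[R] CechMod x M F :=
  LocalizedModule.mkLinearMap (xPowers x F) M

/-- `x_F` divides `x_{F'}`, so inverting the latter inverts the former. The localization map `f` is
left arbitrary in order to cover the ring `Loc I F'` too. -/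
theorem isUnit_of_subset {Q : Type u} [AddCommGroup Q] [Module R Q] {F F' : Finset (Fin n)}
    (h : F ⊆ F') (f : M →ₗ[R] Q) [IsLocalizedModule (xPowers x F') f] (s : xPowers x F) :
    IsUnit (algebraMap R (Module.End R Q) s) := by
  obtain ⟨_, k, rfl⟩ := s
  obtain ⟨c, hc⟩ := pow_dvd_pow_of_dvd (Finset.prod_dvd_prod_of_subset F F' x h) k
  have hu : IsUnit (algebraMap R (Module.End R Q) ((∏ j ∈ F', x j) ^ k)) :=
    IsLocalizedModule.map_units (S := xPowers x F') f ⟨_, k, rfl⟩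
  rw [hc, map_mul] at hu
  have hcomm : Commute (algebraMap R (Module.End R Q) ((∏ j ∈ F, x j) ^ k))
      (algebraMap R (Module.End R Q) c) := Algebra.commutes _ _
  exact (hcomm.isUnit_mul_iff.1 hu).1

variable (M) in
/-- The natural maps of the Čech complex. -/
noncomputable def cechι {F F' : Finset (Fin n)} (h : F ⊆ F') : CechMod x M F →ₗ[R] CechMod x M F' :=
  IsLocalizedModule.lift (xPowers x F) (cechMk x M F) (cechMk x M F')
    (isUnit_of_subset x h (cechMk x M F'))

theorem cechι_cechMk {F F' : Finset (Fin n)} (h : F ⊆ F') (m : M) :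
    cechι x M h (cechMk x M F m) = cechMk x M F' m :=
  IsLocalizedModule.lift_apply _ _ _ _ _

/-- A map out of `M_{x_F}` into a module on which `x_F` is invertible is determined on `M`. All
identities between natural maps are checked this way. -/
theorem cech_hom_ext {Q : Type u} [AddCommGroup Q] [Module R Q] {F F' : Finset (Fin n)} (h : F ⊆ F')
    (q : N →ₗ[R] Q) [IsLocalizedModule (xPowers x F') q] {f g : CechMod x M F →ₗ[R] Q}
    (hfg : ∀ m, f (cechMk x M F m) = g (cechMk x M F m)) : f = g :=
  IsLocalizedModule.ext (xPowers x F) (cechMk x M F) (isUnit_of_subset x h q) (LinearMap.ext hfg)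

theorem cechι_cechι {F F' F'' : Finset (Fin n)} (h : F ⊆ F') (h' : F' ⊆ F'') (y : CechMod x M F) :
    cechι x M h' (cechι x M h y) = cechι x M (h.trans h') y := by
  have := cech_hom_ext x (M := M) (f := cechι x M h' ∘ₗ cechι x M h) (g := cechι x M (h.trans h'))
    (h.trans h') (cechMk x M F'') fun m => by
      rw [LinearMap.comp_apply, cechι_cechMk, cechι_cechMk, cechι_cechMk]
  exact LinearMap.congr_fun this y

/-- Functoriality of the localizations in the module. -/
noncomputable def cechMap (f : M →ₗ[R] N) (F : Finset (Fin n)) :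
    CechMod x M F →ₗ[R] CechMod x N F :=
  IsLocalizedModule.map (xPowers x F) (cechMk x M F) (cechMk x N F) f

theorem cechMap_cechMk (f : M →ₗ[R] N) (F : Finset (Fin n)) (m : M) :
    cechMap x f F (cechMk x M F m) = cechMk x N F (f m) :=
  IsLocalizedModule.map_apply _ _ _ _ _

theorem cechMap_cechι (f : M →ₗ[R] N) {F F' : Finset (Fin n)} (h : F ⊆ F') (y : CechMod x M F) :
    cechMap x f F' (cechι x M h y) = cechι x N h (cechMap x f F y) := by
  have := cech_hom_ext x (f := cechMap x f F' ∘ₗ cechι x M h) (g := cechι x N h ∘ₗ cechMap x f F)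
    h (cechMk x N F') fun m => by
      rw [LinearMap.comp_apply, LinearMap.comp_apply, cechι_cechMk, cechMap_cechMk, cechMap_cechMk,
        cechι_cechMk]
  exact LinearMap.congr_fun this y

theorem cechMap_comp (g : N →ₗ[R] P) (f : M →ₗ[R] N) (F : Finset (Fin n)) (y : CechMod x M F) :
    cechMap x (g ∘ₗ f) F y = cechMap x g F (cechMap x f F y) := by
  have := cech_hom_ext x (f := cechMap x (g ∘ₗ f) F) (g := cechMap x g F ∘ₗ cechMap x f F)
    subset_rfl (cechMk x P F) fun m => by
      rw [LinearMap.comp_apply, cechMap_cechMk, cechMap_cechMk, cechMap_cechMk,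
        LinearMap.comp_apply]
  exact LinearMap.congr_fun this y

theorem cechMap_sum {σ : Type*} (s : Finset σ) (f : σ → M →ₗ[R] N) (F : Finset (Fin n))
    (y : CechMod x M F) : cechMap x (∑ o ∈ s, f o) F y = ∑ o ∈ s, cechMap x (f o) F y := by
  simp [cechMap]

theorem cechMap_injective {f : M →ₗ[R] N} (hf : Function.Injective f) (F : Finset (Fin n)) :
    Function.Injective (cechMap x f F) := IsLocalizedModule.map_injective _ _ _ f hf

theorem cechMap_surjective {f : M →ₗ[R] N} (hf : Function.Surjective f) (F : Finset (Fin n)) :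
    Function.Surjective (cechMap x f F) := IsLocalizedModule.map_surjective _ _ _ f hf

theorem cechMap_exact {f : M →ₗ[R] N} {g : N →ₗ[R] P} (h : Function.Exact f g)
    (F : Finset (Fin n)) : Function.Exact (cechMap x f F) (cechMap x g F) :=
  IsLocalizedModule.map_exact _ _ _ _ f g h

variable (M) in
/-- The cocycles of degree `t` of the Čech complex of `M`. -/
noncomputable def modCocycles (t : ℤ) : Submodule R (∀ F, CechMod x M F) :=
  subsetTerm R (CechMod x M) t ⊓ LinearMap.ker (subsetD (cechι x M))

variable (M) in
/-- The coboundaries of degree `t` of the Čech complex of `M`. -/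
noncomputable def modCoboundaries (t : ℤ) : Submodule R (∀ F, CechMod x M F) :=
  (subsetTerm R (CechMod x M) (t - 1)).map (subsetD (cechι x M))

theorem subsetMap_cechMap_subsetD (f : M →ₗ[R] N) (z : ∀ F, CechMod x M F) :
    subsetMap (cechMap x f) (subsetD (cechι x M) z) =
      subsetD (cechι x N) (subsetMap (cechMap x f) z) :=
  subsetMap_subsetD _ _ _ (cechMap_cechι x f) z

theorem subsetMap_mem_modCocycles (f : M →ₗ[R] N) {t : ℤ} {z : ∀ F, CechMod x M F}
    (hz : z ∈ modCocycles x M t) : subsetMap (cechMap x f) z ∈ modCocycles x N t := by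
  refine ⟨subsetMap_mem hz.1, ?_⟩
  change subsetD _ _ = 0
  rw [← subsetMap_cechMap_subsetD, LinearMap.mem_ker.1 hz.2, map_zero]

theorem subsetMap_mem_modCoboundaries (f : M →ₗ[R] N) {t : ℤ} {z : ∀ F, CechMod x M F}
    (hz : z ∈ modCoboundaries x M t) : subsetMap (cechMap x f) z ∈ modCoboundaries x N t := by
  obtain ⟨y, hy, rfl⟩ := hz
  exact ⟨_, subsetMap_mem hy, (subsetMap_cechMap_subsetD x f y).symm⟩

/-- A module all of whose elements are killed by powers of the `x_j` has no higher Čech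
cohomology. -/
theorem modCocycles_le_of_torsion (h : ∀ (j : Fin n) (m : M), ∃ k : ℕ, x j ^ k • m = 0) (t : ℤ)
    (ht : 0 < t) : modCocycles x M t ≤ modCoboundaries x M t := by
  intro z hz
  suffices z = 0 by rw [this]; exact zero_mem _
  funext F
  by_cases hF : (F.card : ℤ) = t
  -- Positive degree enters here: some `x_j` is inverted, and it acts locally nilpotently.
  · obtain ⟨j, hj⟩ : F.Nonempty := Finset.card_pos.1 (by omega)
    have : Subsingleton (CechMod x M F) := by
      rw [LocalizedModule.subsingleton_iff]
      intro m
      obtain ⟨k, hk⟩ := h j m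
      obtain ⟨c, hc⟩ := pow_dvd_pow_of_dvd (Finset.dvd_prod_of_mem x hj) k
      refine ⟨_, ⟨k, rfl⟩, ?_⟩
      change (∏ j ∈ F, x j) ^ k • m = 0
      rw [hc, mul_comm, mul_smul, hk, smul_zero]
    exact Subsingleton.elim _ _
  · exact hz.1 F hF

/-- If `x_j` acts bijectively on `M` then the Čech complex of `M` is exact. -/
theorem modCocycles_le_of_bijective (j : Fin n) (h : Function.Bijective fun m : M => x j • m)
    (t : ℤ) : modCocycles x M t ≤ modCoboundaries x M t := by
  refine subset_exact_of_bijective _ (cechι_cechι x) j (fun F hF => ?_) t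
  have hbij : ∀ k, Function.Bijective fun m : M => x j ^ k • m := fun k => by
    have := h.iterate k
    rwa [smul_iterate] at this
  -- Since `x_j` is already invertible on `M`, localizing at `x_F` inverts `x_{F ∪ {j}}` too. The
  -- natural map is then the comparison of two localizations of `M` at `x_F`.
  have : IsLocalizedModule (xPowers x F) (cechMk x M (insert j F)) := by
    refine ⟨isUnit_of_subset x (Finset.subset_insert j F) (cechMk x M (insert j F)), fun y => ?_, fun {m m'} e => ?_⟩
    · obtain ⟨⟨m, ⟨_, k, rfl⟩⟩, e⟩ := IsLocalizedModule.surj (xPowers x (insert j F))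
        (cechMk x M (insert j F)) y
      obtain ⟨m, rfl⟩ := (hbij k).2 m
      refine ⟨⟨m, ⟨_, k, rfl⟩⟩, ?_⟩
      have hu := isUnit_of_subset x (F := {j}) (F' := insert j F) (by simp) (cechMk x M (insert j F))
        ⟨_, k, rfl⟩
      apply ((Module.End.isUnit_iff _).1 hu).1
      change (∏ i ∈ {j}, x i) ^ k • (∏ i ∈ F, x i) ^ k • y =
        (∏ i ∈ {j}, x i) ^ k • cechMk x M (insert j F) m
      rw [smul_smul, ← mul_pow, Finset.prod_singleton, ← Finset.prod_insert hF, ← map_smul]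
      exact e
    · obtain ⟨⟨_, k, rfl⟩, e⟩ := IsLocalizedModule.exists_of_eq (S := xPowers x (insert j F))
        (f := cechMk x M (insert j F)) e
      refine ⟨⟨_, k, rfl⟩, (hbij k).1 ?_⟩
      change x j ^ k • (∏ i ∈ F, x i) ^ k • m = x j ^ k • (∏ i ∈ F, x i) ^ k • m'
      rw [smul_smul, smul_smul, ← mul_pow, ← Finset.prod_insert hF]
      exact e
  have e : cechι x M (Finset.subset_insert j F) = (IsLocalizedModule.linearEquiv (xPowers x F)
      (cechMk x M F) (cechMk x M (insert j F))).toLinearMap :=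
    cech_hom_ext x (Finset.subset_insert j F) (cechMk x M (insert j F)) fun m => by
      rw [cechι_cechMk]
      exact (IsLocalizedModule.linearEquiv_apply _ _ _ m).symm
  rw [e]
  exact LinearEquiv.bijective _

/-- An element is killed by a power of `(x_1, …, x_n)` if it is killed by powers of the `x_j`. -/
theorem exists_pow_smul_eq_zero_iff (m : M) :
    (∃ k : ℕ, ∀ r ∈ Ideal.span (Set.range x) ^ k, r • m = 0) ↔ ∀ j, ∃ k : ℕ, x j ^ k • m = 0 := by
  constructor
  · rintro ⟨k, hk⟩ j
    exact ⟨k, hk _ (Ideal.pow_mem_pow (Ideal.subset_span (Set.mem_range_self j)) k)⟩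
  · intro h
    let a : Ideal R := LinearMap.ker (LinearMap.toSpanSingleton R M m)
    have h₁ : Ideal.span (Set.range x) ≤ a.radical := by
      rw [Ideal.span_le]
      rintro _ ⟨j, rfl⟩
      exact h j
    obtain ⟨k, hk⟩ := Ideal.exists_pow_le_of_le_radical_of_fg h₁
      (Submodule.fg_span (Set.finite_range x))
    exact ⟨k, fun r hr => hk hr⟩

variable (M) in
/-- The elements killed by powers of the `x_j`. -/
def torsionPart : Submodule R M where
  carrier := {m | ∃ k : ℕ, ∀ r ∈ Ideal.span (Set.range x) ^ k, r • m = 0}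
  zero_mem' := ⟨0, fun _ _ => smul_zero _⟩
  add_mem' := by
    rintro a b ⟨k, hk⟩ ⟨l, hl⟩
    refine ⟨k + l, fun r hr => ?_⟩
    rw [smul_add, hk r (Ideal.pow_le_pow_right (Nat.le_add_right _ _) hr),
      hl r (Ideal.pow_le_pow_right (Nat.le_add_left _ _) hr), add_zero]
  smul_mem' := by
    rintro c a ⟨k, hk⟩
    exact ⟨k, fun r hr => by rw [smul_comm, hk r hr, smul_zero]⟩

/-- In a finitely generated module over a Noetherian ring, some power of `(x_1, …, x_n)` times the
module meets the torsion trivially. -/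
theorem exists_pow_smul_inf_torsionPart [IsNoetherianRing R] [Module.Finite R M] :
    ∃ k : ℕ, Ideal.span (Set.range x) ^ k • (⊤ : Submodule R M) ⊓ torsionPart x M = ⊥ := by
  have : IsNoetherian R M := isNoetherian_of_isNoetherianRing_of_finite R M
  -- The torsion `T` is finitely generated, so a single power of the ideal annihilates it.
  obtain ⟨c, hc⟩ : ∃ c : ℕ, ∀ m ∈ torsionPart x M, ∀ r ∈ Ideal.span (Set.range x) ^ c, r • m = 0 := by
    obtain ⟨s, hs⟩ := IsNoetherian.noetherian (torsionPart x M)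
    have h₁ : ∀ m ∈ s, ∃ k : ℕ, ∀ r ∈ Ideal.span (Set.range x) ^ k, r • m = 0 := fun m hm => by
      have : m ∈ torsionPart x M := hs.le (Submodule.subset_span hm)
      exact this
    choose! k hk using h₁
    refine ⟨s.sup k, fun m hm r hr => ?_⟩
    rw [← hs] at hm
    induction hm using Submodule.span_induction with
    | mem m hm => exact hk m hm r (Ideal.pow_le_pow_right (Finset.le_sup hm) hr)
    | zero => exact smul_zero _
    | add a b _ _ ha hb => rw [smul_add, ha, hb, add_zero]
    | smul d a _ ha => rw [smul_comm, ha, smul_zero]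
  -- Artin–Rees: `J^{k+c} M ∩ T = J^c (J^k M ∩ T) ⊆ J^c T = 0`.
  obtain ⟨k, hk⟩ := Ideal.exists_pow_inf_eq_pow_smul (Ideal.span (Set.range x)) (torsionPart x M)
  refine ⟨k + c, ?_⟩
  rw [hk _ (Nat.le_add_right _ _), Nat.add_sub_cancel_left, eq_bot_iff, Submodule.smul_le]
  intro r hr m hm
  exact hc m hm.2 r hr

end CechModule
end MonomialLC

end

section


universe u

namespace MonomialLC

/-! ### Čech cohomology of injective modules, dimension shifting, and degree zero. -/

section CechModule

variable {n : ℕ} {R : Type u} [CommRing R] (x : Fin n → R)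
variable {M N P : Type u} [AddCommGroup M] [Module R M] [AddCommGroup N] [Module R N]
  [AddCommGroup P] [Module R P]

theorem mem_torsionPart_iff (m : M) : m ∈ torsionPart x M ↔ ∀ j, ∃ k : ℕ, x j ^ k • m = 0 :=
  exists_pow_smul_eq_zero_iff x m

theorem cechMk_eq_zero_iff (F : Finset (Fin n)) (m : M) :
    cechMk x M F m = 0 ↔ ∃ k : ℕ, (∏ j ∈ F, x j) ^ k • m = 0 := by
  rw [IsLocalizedModule.eq_zero_iff (xPowers x F)]
  constructor
  · rintro ⟨⟨_, k, rfl⟩, h⟩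
    exact ⟨k, h⟩
  · rintro ⟨k, h⟩
    exact ⟨⟨_, k, rfl⟩, h⟩

theorem bijective_smul_cechMod_singleton (j : Fin n) :
    Function.Bijective fun m : CechMod x M {j} => x j • m := by
  have := IsLocalizedModule.map_units (S := xPowers x {j}) (cechMk x M {j}) ⟨_, 1, rfl⟩
  simp only [Finset.prod_singleton, pow_one] at this
  exact (Module.End.isUnit_iff _).1 this

/-- Every cocycle with values in `M` comes from one with values in a finitely generated
submodule. -/
theorem exists_fg_modCocycles {t : ℤ} {z : ∀ F, CechMod x M F} (hz : z ∈ modCocycles x M t) :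
    ∃ N : Submodule R M, N.FG ∧ ∃ y ∈ modCocycles x N t, subsetMap (cechMap x N.subtype) y = z := by
  choose p hp using fun F => IsLocalizedModule.mk'_surjective (xPowers x F) (cechMk x M F) (z F)
  -- Finitely many subsets `F`, hence finitely many numerators. The cocycle condition descends to
  -- `N` because localization preserves the inclusion `N ⊆ M`.
  let N : Submodule R M := Submodule.span R (Set.range fun F => (p F).1)
  have hN : ∀ F, (p F).1 ∈ N := fun F => Submodule.subset_span ⟨F, rfl⟩
  let y : ∀ F, CechMod x N F := fun F =>
    IsLocalizedModule.mk' (cechMk x N F) (⟨(p F).1, hN F⟩ : N) (p F).2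
  have hy : subsetMap (cechMap x N.subtype) y = z := by
    funext F
    rw [subsetMap_apply, ← hp F]
    exact IsLocalizedModule.map_mk' _ _ _ _ _ _
  have hi := cechMap_injective x N.injective_subtype
  refine ⟨N, Submodule.fg_span (Set.finite_range _), y, ⟨?_, ?_⟩, hy⟩
  · exact (subsetMap_mem_iff hi).1 (hy ▸ hz.1)
  · refine subsetMap_injective hi ?_
    rw [subsetMap_cechMap_subsetD, hy, map_zero]
    exact hz.2

/-- Over a Noetherian ring, an injective module has no higher Čech cohomology. -/
theorem modCocycles_le_of_injective [IsNoetherianRing R] [Module.Injective.{u, u} R M] (t : ℤ)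
    (ht : 0 < t) : modCocycles x M t ≤ modCoboundaries x M t := by
  intro z hz
  obtain ⟨N, hN, y, hy, rfl⟩ := exists_fg_modCocycles x hz
  have : Module.Finite R N := Module.Finite.iff_fg.2 hN
  obtain ⟨k, hk⟩ := exists_pow_smul_inf_torsionPart (M := N) x
  let T : Submodule R N := Ideal.span (Set.range x) ^ k • ⊤
  -- The kernel of `N → N/T` is `T` and that of `N → ∏_j N_{x_j}` is the torsion of `N`. By the
  -- choice of `k` they meet in zero, so `N` embeds in `Q`.
  let Q : Type u := (N ⧸ T) × (∀ j : Fin n, CechMod x N {j})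
  let q₁ : N →ₗ[R] N ⧸ T := T.mkQ
  let q₂ : ∀ j : Fin n, N →ₗ[R] CechMod x N {j} := fun j => cechMk x N {j}
  let q : N →ₗ[R] Q := q₁.prod (LinearMap.pi q₂)
  have hq : Function.Injective q := by
    refine (injective_iff_map_eq_zero q).2 fun m hm => ?_
    have h₁ : m ∈ T := (Submodule.Quotient.mk_eq_zero T).1 (congrArg Prod.fst hm)
    have h₂ : m ∈ torsionPart x N := (mem_torsionPart_iff x m).2 fun j => by
      have := (cechMk_eq_zero_iff x {j} m).1 (congrFun (congrArg Prod.snd hm) j)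
      simpa using this
    have : m ∈ T ⊓ torsionPart x N := ⟨h₁, h₂⟩
    rwa [hk] at this
  obtain ⟨g, hg⟩ := Module.Injective.out q hq N.subtype
  -- The inclusion `N ⊆ M` becomes a sum of maps, each through one factor of `Q`. The cocycle is a
  -- coboundary in each factor, hence so is its image in `M`.
  have hsum : N.subtype = (g ∘ₗ LinearMap.inl R _ _) ∘ₗ q₁ +
      ∑ j, (g ∘ₗ LinearMap.inr R _ _ ∘ₗ LinearMap.single R _ j) ∘ₗ q₂ j := by
    ext m
    rw [← hg]
    have h : q m = LinearMap.inl R (N ⧸ T) (∀ j : Fin n, CechMod x N {j}) (q₁ m) +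
        ∑ j, LinearMap.inr R (N ⧸ T) (∀ j : Fin n, CechMod x N {j})
          (LinearMap.single R _ j (q₂ j m)) := by
      have h' : ∑ j, LinearMap.single R (fun j => CechMod x N {j}) j (q₂ j m) = fun j => q₂ j m :=
        Finset.univ_sum_single fun j => q₂ j m
      rw [← map_sum, h']
      exact Prod.ext (add_zero _).symm (zero_add _).symm
    rw [h, map_add, map_sum, LinearMap.add_apply, LinearMap.sum_apply]
    rfl
  have e : subsetMap (cechMap x N.subtype) y =
      subsetMap (cechMap x (g ∘ₗ LinearMap.inl R _ _)) (subsetMap (cechMap x q₁) y) +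
        ∑ j, subsetMap (cechMap x (g ∘ₗ LinearMap.inr R _ _ ∘ₗ LinearMap.single R _ j))
          (subsetMap (cechMap x (q₂ j)) y) := by
    funext F
    rw [Pi.add_apply, Finset.sum_apply]
    simp only [subsetMap_apply, ← cechMap_comp]
    rw [← cechMap_sum, hsum]
    simp [cechMap]
  rw [e]
  refine add_mem (subsetMap_mem_modCoboundaries x _ ?_)
    (sum_mem fun j _ => subsetMap_mem_modCoboundaries x _ ?_)
  · refine modCocycles_le_of_torsion x (fun j m => ⟨k, ?_⟩) t ht (subsetMap_mem_modCocycles x q₁ hy)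
    obtain ⟨m, rfl⟩ := T.mkQ_surjective m
    rw [← map_smul]
    exact (Submodule.Quotient.mk_eq_zero T).2 (Submodule.smul_mem_smul
      (Ideal.pow_mem_pow (Ideal.subset_span (Set.mem_range_self j)) k) Submodule.mem_top)
  · exact modCocycles_le_of_bijective x j (bijective_smul_cechMod_singleton x j) t
      (subsetMap_mem_modCocycles x (q₂ j) hy)

variable (M) in
/-- The Čech cohomology of a module. -/
abbrev ModCohomology (t : ℤ) : Type u :=
  modCocycles x M t ⧸ (modCoboundaries x M t).submoduleOf (modCocycles x M t)

/-- Dimension shifting for Čech cohomology. -/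
theorem nonempty_modCohomology_succ_equiv {f : M →ₗ[R] N} {g : N →ₗ[R] P}
    (hf : Function.Injective f) (hfg : Function.Exact f g) (hg : Function.Surjective g) (t : ℤ)
    (hv : modCocycles x N (t + 1) ≤ modCoboundaries x N (t + 1)) :
    Nonempty (ModCohomology x M (t + 1) ≃ₗ[R] (modCocycles x P t ⧸
      (modCoboundaries x P t ⊔ (modCocycles x N t).map (subsetMap (cechMap x g))).submoduleOf
        (modCocycles x P t))) := by
  have h := nonempty_equiv_of_shortExact (subsetD (cechι x M)) (subsetD (cechι x N))
    (subsetD (cechι x P)) (subsetTerm R (CechMod x M)) (subsetTerm R (CechMod x N))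
    (subsetTerm R (CechMod x P)) (subsetMap (cechMap x f)) (subsetMap (cechMap x g))
    (subsetMap_injective (cechMap_injective x hf))
    (fun y => by
      constructor
      · intro h
        choose w hw using fun F => (cechMap_exact x hfg F (y F)).1 (congrFun h F)
        exact ⟨w, funext hw⟩
      · rintro ⟨w, rfl⟩
        exact funext fun F => (cechMap_exact x hfg F _).2 ⟨w F, rfl⟩)
    (subsetMap_cechMap_subsetD x f) (subsetMap_cechMap_subsetD x g)
    (subsetD_subsetD _ (cechι_cechι x)) (fun t z => subsetMap_mem_iff (cechMap_injective x hf))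
    (map_subsetMap_subsetTerm (cechMap_surjective x hg)) (fun t y => subsetD_mem _) t
    (hv.trans (by rw [modCoboundaries, add_sub_cancel_right]))
  have e : modCoboundaries x M (t + 1) = (subsetTerm R (CechMod x M) t).map (subsetD (cechι x M)) := by
    rw [modCoboundaries, add_sub_cancel_right]
  unfold ModCohomology
  rw [e]
  exact h

variable (M) in
/-- The inclusion of the torsion into the Čech complex, in degree `0`. -/
noncomputable def cechZero : M →ₗ[R] (∀ F, CechMod x M F) :=
  LinearMap.single R (CechMod x M) ∅ ∘ₗ cechMk x M ∅

theorem cechMk_empty_bijective : Function.Bijective (cechMk x M ∅) := by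
  constructor
  · refine (injective_iff_map_eq_zero _).2 fun m hm => ?_
    obtain ⟨k, hk⟩ := (cechMk_eq_zero_iff x ∅ m).1 hm
    simpa using hk
  · intro y
    obtain ⟨⟨m, ⟨_, k, rfl⟩⟩, e⟩ := IsLocalizedModule.surj (xPowers x ∅) (cechMk x M ∅) y
    refine ⟨m, e.symm.trans ?_⟩
    change (∏ j ∈ ∅, x j) ^ k • y = y
    simp

theorem cechZero_injective : Function.Injective (cechZero x M) := by
  intro a b h
  exact (cechMk_empty_bijective x).1 (Pi.single_injective _ h)

theorem subsetMap_cechZero (f : M →ₗ[R] N) (m : M) :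
    subsetMap (cechMap x f) (cechZero x M m) = cechZero x N (f m) := by
  funext F
  simp only [subsetMap_apply, cechZero, LinearMap.comp_apply, LinearMap.coe_single]
  by_cases hF : F = ∅
  · subst hF
    rw [Pi.single_eq_same, Pi.single_eq_same, cechMap_cechMk]
  · rw [Pi.single_eq_of_ne hF, Pi.single_eq_of_ne hF, map_zero]

/-- A cochain of degree 0 is an element `m` of `M = M_{x_∅}`, and its differential at `{j}` is the
image of `m` in `M_{x_j}`, which is zero iff a power of `x_j` kills `m`. -/
theorem modCocycles_zero : modCocycles x M 0 = (torsionPart x M).map (cechZero x M) := by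
  have hterm : ∀ m, cechZero x M m ∈ subsetTerm R (CechMod x M) 0 := fun m F hF =>
    Pi.single_eq_of_ne (fun h => hF (by simp [h])) _
  have hd : ∀ m j, subsetD (cechι x M) (cechZero x M m) {j} = cechMk x M {j} m := fun m j => by
    rw [subsetD_apply, Finset.sum_singleton]
    have h₁ : position {j} j = 0 := by simp [position]
    have h₂ : ∀ (G : Finset (Fin n)) (h : G ⊆ {j}), G = ∅ →
        cechι x M h (cechZero x M m G) = cechMk x M {j} m := by
      rintro G h rfl
      simp only [cechZero, LinearMap.comp_apply, LinearMap.coe_single, Pi.single_eq_same]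
      exact cechι_cechMk x h m
    rw [h₁, pow_zero, one_smul, h₂ _ _ (Finset.erase_singleton j)]
  have hz : ∀ m, m ∈ torsionPart x M ↔ ∀ j, cechMk x M {j} m = 0 := fun m => by
    rw [mem_torsionPart_iff]
    simp only [cechMk_eq_zero_iff, Finset.prod_singleton]
  apply le_antisymm
  · rintro z ⟨hz₁, hz₂⟩
    obtain ⟨m, hm⟩ := (cechMk_empty_bijective x).2 (z ∅)
    have e : cechZero x M m = z := by
      funext F
      simp only [cechZero, LinearMap.comp_apply, LinearMap.coe_single]
      by_cases hF : F = ∅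
      · subst hF
        rw [Pi.single_eq_same, hm]
      · rw [Pi.single_eq_of_ne hF]
        exact (hz₁ F (by simpa using hF)).symm
    refine ⟨m, (hz m).2 fun j => ?_, e⟩
    rw [← hd, e]
    exact congrFun hz₂ {j}
  · rintro _ ⟨m, hm, rfl⟩
    refine ⟨hterm m, funext fun F => ?_⟩
    by_cases hF : F.card = 1
    · obtain ⟨j, rfl⟩ := Finset.card_eq_one.1 hF
      rw [hd]
      exact (hz m).1 hm j
    · exact subsetD_mem _ (hterm m) F (by
        change (F.card : ℤ) ≠ 0 + 1
        exact_mod_cast hF)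

theorem modCoboundaries_zero : modCoboundaries x M 0 = ⊥ := by
  rw [eq_bot_iff]
  rintro _ ⟨y, hy, rfl⟩
  have : y = 0 := funext fun F => hy F (by
    change (F.card : ℤ) ≠ 0 - 1
    omega)
  rw [this, map_zero]
  exact zero_mem _

end CechModule
end MonomialLC

end

section

open CategoryTheory Limits

universe u

namespace MonomialLC

/-! ### Local cohomology equals Čech cohomology over a Noetherian ring. -/

section Comparison

variable {n : ℕ} {R : Type u} [CommRing R] (x : Fin n → R)

/-- The ideal generated by the `x_j`. -/
abbrev spanIdeal : Ideal R := Ideal.span (Set.range x)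

/-- Zeroth local cohomology as a submodule of the Čech complex. -/
noncomputable def zeroToCech (M : ModuleCat.{u} R) :
    (localCohomology (spanIdeal x) 0).obj M →ₗ[R] (∀ F, CechMod x M F) :=
  cechZero x M ∘ₗ (localCohomology.toModule (spanIdeal x) M).hom

theorem zeroToCech_injective (M : ModuleCat.{u} R) : Function.Injective (zeroToCech x M) :=
  (cechZero_injective x).comp (localCohomology.toModule_injective (spanIdeal x) M)

theorem range_zeroToCech (M : ModuleCat.{u} R) :
    LinearMap.range (zeroToCech x M) = modCocycles x M 0 := by
  rw [modCocycles_zero, zeroToCech, LinearMap.range_comp]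
  congr 1
  ext m
  exact localCohomology.toModule_range (spanIdeal x) M m

theorem zeroToCech_naturality {M N : ModuleCat.{u} R} (f : M ⟶ N)
    (y : (localCohomology (spanIdeal x) 0).obj M) :
    zeroToCech x N ((localCohomology (spanIdeal x) 0).map f y) =
      subsetMap (cechMap x f.hom) (zeroToCech x M y) := by
  have := congrArg (fun m => m.hom y) (localCohomology.toModule_naturality (spanIdeal x) f)
  exact (congrArg (cechZero x N) this).trans (subsetMap_cechZero x f.hom _).symm

/-- Zeroth local cohomology as the cocycles of degree `0`. -/
noncomputable def zeroEquiv (M : ModuleCat.{u} R) :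
    (localCohomology (spanIdeal x) 0).obj M ≃ₗ[R] modCocycles x M 0 :=
  LinearEquiv.ofInjective (zeroToCech x M) (zeroToCech_injective x M) ≪≫ₗ
    LinearEquiv.ofEq _ _ (range_zeroToCech x M)

theorem nonempty_localCohomology_zero_equiv (M : ModuleCat.{u} R) :
    Nonempty ((localCohomology (spanIdeal x) 0).obj M ≃ₗ[R] ModCohomology x M 0) := by
  refine ⟨zeroEquiv x M ≪≫ₗ (Submodule.quotEquivOfEqBot _ ?_).symm⟩
  rw [modCoboundaries_zero, Submodule.submoduleOf, Submodule.comap_bot, Submodule.ker_subtype]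

theorem exists_shortExact_injective (M : ModuleCat.{u} R) :
    ∃ (E N : ModuleCat.{u} R) (f : M ⟶ E) (g : E ⟶ N) (w : f ≫ g = 0),
      (ShortComplex.mk f g w).ShortExact ∧ Injective E :=
  ⟨Injective.under M, _, Injective.ι M, cokernel.π (Injective.ι M), cokernel.condition _,
    ShortComplex.ShortExact.mk' (ShortComplex.exact_cokernel (Injective.ι M)) inferInstance
      inferInstance, inferInstance⟩

variable [IsNoetherianRing R]

/-- Over a Noetherian ring, local cohomology with support in an ideal is isomorphic to the Čech
cohomology with respect to generators of the ideal. -/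
theorem nonempty_localCohomology_equiv (i : ℕ) (M : ModuleCat.{u} R) :
    Nonempty ((localCohomology (spanIdeal x) i).obj M ≃ₗ[R] ModCohomology x M i) := by
  induction i generalizing M with
  | zero => exact nonempty_localCohomology_zero_equiv x M
  | succ i ih =>
    obtain ⟨E, N, f, g, w, hS, hE⟩ := exists_shortExact_injective M
    have hE' : Module.Injective.{u, u} R E := (Module.injective_iff_injective_object R E).2 hE
    have hE₂ : Injective (ShortComplex.mk f g w).X₂ := hE
    have hfg : Function.Exact f.hom g.hom :=
      (ShortComplex.ShortExact.moduleCat_exact_iff_function_exact _).1 hS.exact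
    have hf : Function.Injective f.hom := (ModuleCat.mono_iff_injective f).1 hS.mono_f
    have hg : Function.Surjective g.hom := (ModuleCat.epi_iff_surjective g).1 hS.epi_g
    obtain ⟨e⟩ := nonempty_modCohomology_succ_equiv x hf hfg hg i
      (modCocycles_le_of_injective x _ (by positivity))
    rw [Nat.cast_succ]
    let δ : (localCohomology (spanIdeal x) i).obj N →ₗ[R]
        (localCohomology (spanIdeal x) (i + 1)).obj M :=
      (localCohomology.connecting (spanIdeal x) hS i).hom
    have hδ : Function.Surjective δ := localCohomology.connecting_surjective (spanIdeal x) hS i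
    have hδ' : Function.Exact ((localCohomology (spanIdeal x) i).map g).hom δ :=
      localCohomology.connecting_exact (spanIdeal x) hS i
    -- From degree 0 to 1 the term `H^0(E)` survives, and its images in the two theories are matched
    -- by naturality of `zeroToCech`. In higher degrees `H^i(E)` is zero on both sides and the
    -- induction hypothesis for `N` is enough.
    rcases i with _ | i
    · let φ : modCocycles x N 0 →ₗ[R] (localCohomology (spanIdeal x) 1).obj M :=
        δ ∘ₗ (zeroEquiv x N).symm.toLinearMap
      have hφ : Function.Surjective φ := hδ.comp (zeroEquiv x N).symm.surjective
      refine ⟨(φ.quotKerEquivOfSurjective hφ).symm ≪≫ₗ Submodule.quotEquivOfEq _ _ ?_ ≪≫ₗ e.symm⟩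
      ext z
      obtain ⟨y, rfl⟩ := (zeroEquiv x N).surjective z
      have h₁ : zeroEquiv x N y ∈ LinearMap.ker φ ↔ δ y = 0 := by
        change δ ((zeroEquiv x N).symm (zeroEquiv x N y)) = 0 ↔ _
        rw [LinearEquiv.symm_apply_apply]
      rw [h₁]
      have h₂ : modCoboundaries x N ((0 : ℕ) : ℤ) = ⊥ := modCoboundaries_zero x
      rw [h₂, bot_sup_eq, hδ' y]
      change _ ↔ zeroToCech x N y ∈ (modCocycles x E 0).map (subsetMap (cechMap x g.hom))
      rw [← range_zeroToCech]
      constructor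
      · rintro ⟨v, rfl⟩
        exact ⟨_, ⟨v, rfl⟩, (zeroToCech_naturality x g v).symm⟩
      · rintro ⟨_, ⟨v, rfl⟩, hv⟩
        exact ⟨v, zeroToCech_injective x N ((zeroToCech_naturality x g v).trans hv)⟩
    · have hinj : Function.Injective δ := by
        refine (injective_iff_map_eq_zero δ).2 fun y hy => ?_
        obtain ⟨v, rfl⟩ := (hδ' y).1 hy
        have := localCohomology.subsingleton_succ_of_injective (spanIdeal x) i E
        rw [Subsingleton.elim v 0, map_zero]
      obtain ⟨e'⟩ := ih N
      refine ⟨(LinearEquiv.ofBijective δ ⟨hinj, hδ⟩).symm ≪≫ₗ e' ≪≫ₗ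
        Submodule.quotEquivOfEq _ _ ?_ ≪≫ₗ e.symm⟩
      congr 1
      refine (sup_eq_left.2 ?_).symm
      rintro _ ⟨z, hz, rfl⟩
      exact subsetMap_mem_modCoboundaries x _
        (modCocycles_le_of_injective x _ (by positivity) hz)

end Comparison

/-! ### From localized modules to the rings `R_{x_F}`. -/

section Transport

theorem nonempty_subquotient_equiv {R X Y : Type*} [CommRing R] [AddCommGroup X] [Module R X]
    [AddCommGroup Y] [Module R Y] (E : X ≃ₗ[R] Y) (Z B : Submodule R X) (Z' B' : Submodule R Y)
    (hZ : ∀ z, E z ∈ Z' ↔ z ∈ Z) (hB : ∀ z, E z ∈ B' ↔ z ∈ B) :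
    Nonempty ((Z ⧸ B.submoduleOf Z) ≃ₗ[R] (Z' ⧸ B'.submoduleOf Z')) := by
  have hZ' : Z.map E.toLinearMap = Z' := by
    ext y
    obtain ⟨z, rfl⟩ := E.surjective y
    rw [hZ]
    constructor
    · rintro ⟨w, hw, e⟩
      exact E.injective e ▸ hw
    · exact fun h => ⟨z, h, rfl⟩
  refine ⟨Submodule.Quotient.equiv _ _
    (LinearEquiv.submoduleMap E Z ≪≫ₗ LinearEquiv.ofEq _ _ hZ') ?_⟩
  ext ⟨y, hy⟩
  obtain ⟨z, rfl⟩ := E.surjective y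
  constructor
  · rintro ⟨w, hw, hwz⟩
    have h : E w = E z := congrArg Subtype.val hwz
    exact (hB z).2 (E.injective h ▸ hw)
  · intro h
    exact ⟨⟨z, (hZ z).1 hy⟩, (hB z).1 h, rfl⟩

variable {K : Type u} [Field K] {n : ℕ} (I : Ideal (MvPolynomial (Fin n) K))

instance isLocalizedModule_loc (F : Finset (Fin n)) :
    IsLocalizedModule (xPowers (x I) F) (Algebra.linearMap (QuotRing I) (Loc I F)) :=
  inferInstanceAs (IsLocalizedModule (Submonoid.powers (xProd I F))
    (Algebra.linearMap (QuotRing I) (Localization (Submonoid.powers (xProd I F)))))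

/-- The localization of the ring as a localized module. -/
noncomputable def locEquiv (F : Finset (Fin n)) : CechMod (x I) (QuotRing I) F ≃ₗ[QuotRing I] Loc I F :=
  IsLocalizedModule.iso (xPowers (x I) F) (Algebra.linearMap (QuotRing I) (Loc I F))

theorem locEquiv_cechMk (F : Finset (Fin n)) (r : QuotRing I) :
    locEquiv I F (cechMk (x I) (QuotRing I) F r) = algebraMap (QuotRing I) (Loc I F) r :=
  IsLocalizedModule.iso_mk_one _ _ r

theorem locEquiv_cechι {F F' : Finset (Fin n)} (h : F ⊆ F') (y : CechMod (x I) (QuotRing I) F) :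
    locEquiv I F' (cechι (x I) (QuotRing I) h y) = nat I h (locEquiv I F y) := by
  have := cech_hom_ext (x I) (f := (locEquiv I F').toLinearMap ∘ₗ cechι (x I) (QuotRing I) h)
    (g := (nat I h).toLinearMap ∘ₗ (locEquiv I F).toLinearMap) h
    (Algebra.linearMap (QuotRing I) (Loc I F')) fun m => by
      simp only [LinearMap.comp_apply, LinearEquiv.coe_coe, cechι_cechMk, locEquiv_cechMk,
        AlgHom.toLinearMap_apply, AlgHom.commutes]
  exact LinearMap.congr_fun this y

theorem cechDifferential_eq : cechDifferential I =
    subsetD (A := Loc I) (fun {_ _} h => (nat I h).toLinearMap) := rfl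

/-- Local cohomology of `S/I` is isomorphic to the Čech cohomology. -/
theorem nonempty_localCoh_equiv (i : ℕ) :
    Nonempty (LocalCoh I i ≃ₗ[QuotRing I] CechCohomology I i) := by
  obtain ⟨e⟩ := nonempty_localCohomology_equiv (x I) i (ModuleCat.of (QuotRing I) (QuotRing I))
  let E : (∀ F, CechMod (x I) (QuotRing I) F) ≃ₗ[QuotRing I] CechTotal I :=
    LinearEquiv.piCongrRight (locEquiv I)
  have hE : ∀ z, E z = subsetMap (fun F => (locEquiv I F).toLinearMap) z := fun _ => rfl
  have hd : ∀ z, E (subsetD (cechι (x I) (QuotRing I)) z) = cechDifferential I (E z) := fun z => by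
    rw [hE, hE, cechDifferential_eq]
    exact subsetMap_subsetD _ _ _ (locEquiv_cechι I) z
  have ht : ∀ t z, E z ∈ cechTerm I t ↔ z ∈ subsetTerm (QuotRing I) (CechMod (x I) (QuotRing I)) t :=
    fun t z => subsetMap_mem_iff (fun F => (locEquiv I F).injective)
  obtain ⟨e'⟩ := nonempty_subquotient_equiv E (modCocycles (x I) (QuotRing I) i)
    (modCoboundaries (x I) (QuotRing I) i) (cechCocycles I i) (cechCoboundaries I i)
    (fun z => by
      refine and_congr (ht _ z) ?_
      change cechDifferential I (E z) = 0 ↔ subsetD _ z = 0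
      rw [← hd, LinearEquiv.map_eq_zero_iff])
    (fun z => by
      constructor
      · rintro ⟨y, hy, hyz⟩
        obtain ⟨y, rfl⟩ := E.surjective y
        refine ⟨y, (ht _ y).1 hy, E.injective ?_⟩
        rw [hd, hyz]
      · rintro ⟨y, hy, rfl⟩
        exact ⟨E y, (ht _ y).2 hy, (hd y).symm⟩)
  exact ⟨e ≪≫ₗ e'⟩

end Transport
end MonomialLC

end

section


universe u

namespace MonomialLC

/-! ### Direct sum decompositions by projections. -/

section Projections

variable {K V V' σ : Type*} [Field K] [AddCommGroup V] [Module K V] [AddCommGroup V'] [Module K V']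

/-- A family of projections onto submodules that span and are pairwise annihilated. -/
structure IsProjectionFamily (W : σ → Submodule K V) (p : σ → V →ₗ[K] V) : Prop where
  apply_self : ∀ a, ∀ v ∈ W a, p a v = v
  apply_ne : ∀ a b, a ≠ b → ∀ v ∈ W b, p a v = 0
  iSup_eq_top : ⨆ a, W a = ⊤

namespace IsProjectionFamily

variable {W : σ → Submodule K V} {p : σ → V →ₗ[K] V} {W' : σ → Submodule K V'}
  {p' : σ → V' →ₗ[K] V'}

/-- `p a` fixes `W a` and kills all the other submodules, so `W a` meets their sum in zero. -/
theorem isInternal [DecidableEq σ] (h : IsProjectionFamily W p) : DirectSum.IsInternal W := by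
  refine DirectSum.isInternal_submodule_of_iSupIndep_of_iSup_eq_top ?_ h.iSup_eq_top
  rw [iSupIndep_def]
  intro a
  rw [Submodule.disjoint_def]
  intro v hv hv'
  have : ⨆ b, ⨆ (_ : b ≠ a), W b ≤ LinearMap.ker (p a) :=
    iSup₂_le fun b hb v hv => h.apply_ne a b hb.symm v hv
  rw [← h.apply_self a v hv]
  exact this hv'

theorem mem (h : IsProjectionFamily W p) (a : σ) (v : V) : p a v ∈ W a := by
  have hv : v ∈ ⨆ a, W a := h.iSup_eq_top ▸ Submodule.mem_top
  classical
  refine Submodule.iSup_induction W (motive := fun v => p a v ∈ W a) hv (fun b v hv => ?_) ?_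
    fun v w hv hw => ?_
  · by_cases hab : a = b
    · subst hab
      rwa [h.apply_self a v hv]
    · rw [h.apply_ne a b hab v hv]
      exact zero_mem _
  · rw [map_zero]; exact zero_mem _
  · rw [map_add]; exact add_mem hv hw

theorem exists_sum (h : IsProjectionFamily W p) (v : V) :
    ∃ s : Finset σ, v = ∑ a ∈ s, p a v := by
  have hv : v ∈ ⨆ a, W a := h.iSup_eq_top ▸ Submodule.mem_top
  obtain ⟨f, hf, rfl⟩ := (Submodule.mem_iSup_iff_exists_finsupp W v).1 hv
  refine ⟨f.support, ?_⟩
  have : ∀ a, p a (∑ i ∈ f.support, f i) = f a := fun a => by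
    rw [map_sum, Finset.sum_eq_single a, h.apply_self a _ (hf a)]
    · exact fun b _ hb => h.apply_ne a b hb.symm _ (hf b)
    · intro ha
      rw [Finsupp.notMem_support_iff.1 ha, map_zero]
  exact Finset.sum_congr rfl fun a _ => (this a).symm

theorem comm (h : IsProjectionFamily W p) (h' : IsProjectionFamily W' p') (f : V →ₗ[K] V')
    (hf : ∀ a, ∀ v ∈ W a, f v ∈ W' a) (a : σ) (v : V) : f (p a v) = p' a (f v) := by
  have hv : v ∈ ⨆ a, W a := h.iSup_eq_top ▸ Submodule.mem_top
  classical
  refine Submodule.iSup_induction W (motive := fun v => f (p a v) = p' a (f v)) hv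
    (fun b v hv => ?_) ?_ fun v w hv hw => ?_
  · by_cases hab : a = b
    · subst hab
      rw [h.apply_self a v hv, h'.apply_self a _ (hf a v hv)]
    · rw [h.apply_ne a b hab v hv, h'.apply_ne a b hab _ (hf b v hv), map_zero]
  · simp
  · rw [map_add, map_add, map_add, map_add, hv, hw]

end IsProjectionFamily

end Projections

/-! ### The grading of `R_{x_F}` by the coaction. -/

section LocGrading

variable {K : Type u} [Field K] {n : ℕ} (I : Ideal (MvPolynomial (Fin n) K))

/-- The class of a monomial in `S/I`. -/
noncomputable def monom (b : Fin n →₀ ℕ) : QuotRing I :=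
  Ideal.Quotient.mk I (MvPolynomial.monomial b (1 : K))

theorem monom_add (b c : Fin n →₀ ℕ) : monom I (b + c) = monom I b * monom I c := by
  rw [monom, monom, monom, ← map_mul, MvPolynomial.monomial_mul, one_mul]

/-- The exponent vector of `x_F^l`. -/
noncomputable def expo (F : Finset (Fin n)) (l : ℕ) : Fin n →₀ ℕ :=
  Finsupp.equivFunOnFinite.symm fun j => if j ∈ F then l else 0

theorem expo_apply (F : Finset (Fin n)) (l : ℕ) (j : Fin n) :
    expo F l j = if j ∈ F then l else 0 := rfl

theorem xProd_eq_monom (F : Finset (Fin n)) : xProd I F = monom I (expo F 1) := by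
  have : expo F 1 = ∑ j ∈ F, Finsupp.single j 1 := by
    ext k
    simp [expo_apply, Finsupp.single_apply, Finsupp.finsetSum_apply]
  rw [this, monom, MvPolynomial.monomial_sum_one, map_prod]
  rfl

theorem xProd_pow (F : Finset (Fin n)) (l : ℕ) : xProd I F ^ l = monom I (expo F l) := by
  induction l with
  | zero =>
    have : expo F 0 = 0 := by ext j; simp [expo_apply]
    rw [pow_zero, this]
    exact (map_one _).symm
  | succ l ih =>
    have : expo F (l + 1) = expo F l + expo F 1 := by
      ext j
      simp only [expo_apply, Finsupp.add_apply]
      split_ifs <;> rfl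
    rw [pow_succ, ih, xProd_eq_monom, this, monom_add]

/-- The fraction `x^b / x_F^l`. -/
noncomputable def frac (F : Finset (Fin n)) (b : Fin n →₀ ℕ) (l : ℕ) : Loc I F :=
  IsLocalization.mk' (Loc I F) (monom I b)
    (⟨xProd I F ^ l, l, rfl⟩ : Submonoid.powers (xProd I F))

theorem locDegree_eq (F : Finset (Fin n)) (a : Fin n → ℤ) : locDegree I F a =
    Submodule.span K {y | ∃ (b : Fin n →₀ ℕ) (l : ℕ),
      (∀ j, (b j : ℤ) - (if j ∈ F then (l : ℤ) else 0) = a j) ∧ y = frac I F b l} := rfl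

theorem frac_mul (F : Finset (Fin n)) (b : Fin n →₀ ℕ) (l : ℕ) :
    frac I F b l * algebraMap (QuotRing I) (Loc I F) (monom I (expo F l)) =
      algebraMap (QuotRing I) (Loc I F) (monom I b) := by
  rw [← xProd_pow]
  exact IsLocalization.mk'_spec (Loc I F) (monom I b)
    (⟨xProd I F ^ l, l, rfl⟩ : Submonoid.powers (xProd I F))

theorem iSup_locDegree (F : Finset (Fin n)) : ⨆ a, locDegree I F a = ⊤ := by
  rw [eq_top_iff]
  rintro y -
  obtain ⟨r, ⟨_, l, rfl⟩, rfl⟩ := IsLocalization.exists_mk'_eq (Submonoid.powers (xProd I F)) y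
  obtain ⟨p, rfl⟩ := Ideal.Quotient.mk_surjective r
  let s : Submonoid.powers (xProd I F) := ⟨xProd I F ^ l, l, rfl⟩
  change IsLocalization.mk' (Loc I F) (Ideal.Quotient.mk I p) s ∈ _
  induction p using MvPolynomial.induction_on' with
  | monomial b c =>
    have : IsLocalization.mk' (Loc I F) (Ideal.Quotient.mk I (MvPolynomial.monomial b c)) s =
        c • frac I F b l := by
      have h₁ : (Ideal.Quotient.mk I (MvPolynomial.monomial b c)) = c • monom I b := by
        rw [← mul_one c, ← smul_eq_mul, ← MvPolynomial.smul_monomial, smul_eq_mul, mul_one]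
        rfl
      have h₂ : algebraMap (QuotRing I) (Loc I F) (c • monom I b) =
          c • algebraMap (QuotRing I) (Loc I F) (monom I b) := by
        rw [Algebra.algebraMap_eq_smul_one, smul_assoc, ← Algebra.algebraMap_eq_smul_one]
      rw [h₁, IsLocalization.mk'_eq_mul_mk'_one, h₂, smul_mul_assoc,
        ← IsLocalization.mk'_eq_mul_mk'_one]
      rfl
    refine Submodule.mem_iSup_of_mem (fun j => (b j : ℤ) - (if j ∈ F then (l : ℤ) else 0)) ?_
    exact this ▸ Submodule.smul_mem _ _ (Submodule.subset_span ⟨b, l, fun j => rfl, rfl⟩)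
  | add p q hp hq =>
    rw [IsLocalization.mk'_eq_mul_mk'_one] at hp hq ⊢
    rw [map_add, map_add, add_mul]
    exact add_mem hp hq

variable {I} (hI : IsMonomialIdeal I)

/-- The coaction on polynomials: `X_j ↦ x_j t^{e_j}`. -/
noncomputable def polyCoaction (I : Ideal (MvPolynomial (Fin n) K)) (F : Finset (Fin n)) :
    MvPolynomial (Fin n) K →ₐ[K] AddMonoidAlgebra (Loc I F) (Fin n → ℤ) :=
  MvPolynomial.aeval fun j =>
    AddMonoidAlgebra.single (Pi.single j 1) (algebraMap (QuotRing I) (Loc I F) (x I j))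

theorem polyCoaction_monomial (F : Finset (Fin n)) (b : Fin n →₀ ℕ) :
    polyCoaction I F (MvPolynomial.monomial b 1) =
      AddMonoidAlgebra.single (fun j => (b j : ℤ))
        (algebraMap (QuotRing I) (Loc I F) (monom I b)) := by
  induction b using Finsupp.induction_linear with
  | zero =>
    have h₁ : MvPolynomial.monomial 0 (1 : K) = (1 : MvPolynomial (Fin n) K) := rfl
    have h₂ : monom I 0 = 1 := map_one _
    rw [h₁, h₂, map_one, map_one, AddMonoidAlgebra.one_def]
    congr 1
  | add b c hb hc =>
    have h₁ : MvPolynomial.monomial (b + c) (1 : K) =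
        MvPolynomial.monomial b 1 * MvPolynomial.monomial c 1 := by
      rw [MvPolynomial.monomial_mul, one_mul]
    rw [h₁, map_mul, hb, hc, AddMonoidAlgebra.single_mul_single, monom_add, map_mul]
    congr 1
  | single j k =>
    have h : monom I (Finsupp.single j k) = x I j ^ k := by
      rw [monom, ← MvPolynomial.X_pow_eq_monomial, map_pow]
      rfl
    rw [← MvPolynomial.X_pow_eq_monomial, map_pow, polyCoaction, MvPolynomial.aeval_X,
      AddMonoidAlgebra.single_pow, ← map_pow, h]
    congr 1
    ext i
    simp [Pi.single_apply, Finsupp.single_apply, eq_comm]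

-- The only place where it matters for the grading that `I` is monomial: the coaction multiplies a
-- generating monomial by a power of `t`, so its class stays zero.
include hI in
theorem polyCoaction_eq_zero (F : Finset (Fin n)) {p : MvPolynomial (Fin n) K} (hp : p ∈ I) :
    polyCoaction I F p = 0 := by
  obtain ⟨B, hB⟩ := hI
  have : I ≤ RingHom.ker (polyCoaction I F) := by
    conv_lhs => rw [hB]
    rw [Ideal.span_le]
    rintro _ ⟨b, hb, rfl⟩
    have hm : monom I b = 0 :=
      Ideal.Quotient.eq_zero_iff_mem.2 (hB ▸ Ideal.subset_span ⟨b, hb, rfl⟩)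
    change polyCoaction I F (MvPolynomial.monomial b 1) = 0
    rw [polyCoaction_monomial, hm, map_zero, AddMonoidAlgebra.single_zero]
  exact this hp

/-- The coaction on `S/I`. -/
noncomputable def quotCoaction (F : Finset (Fin n)) :
    QuotRing I →ₐ[K] AddMonoidAlgebra (Loc I F) (Fin n → ℤ) :=
  Ideal.Quotient.liftₐ I (polyCoaction I F) fun _ => polyCoaction_eq_zero hI F

theorem quotCoaction_monom (F : Finset (Fin n)) (b : Fin n →₀ ℕ) :
    quotCoaction hI F (monom I b) = AddMonoidAlgebra.single (fun j => (b j : ℤ))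
        (algebraMap (QuotRing I) (Loc I F) (monom I b)) :=
  polyCoaction_monomial F b

/-- `x_F^l` goes to `x_F^l` times a power of `t`. Its inverse has negative degree, which is why the
exponents lie in `ℤ^n`. -/
theorem isUnit_quotCoaction (F : Finset (Fin n)) (y : Submonoid.powers (xProd I F)) :
    IsUnit (quotCoaction hI F y) := by
  obtain ⟨_, l, rfl⟩ := y
  dsimp only
  rw [xProd_pow, quotCoaction_monom, ← xProd_pow]
  obtain ⟨v, hv⟩ := (IsLocalization.map_units (Loc I F)
    (⟨_, l, rfl⟩ : Submonoid.powers (xProd I F))).exists_right_inv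
  refine IsUnit.of_mul_eq_one (AddMonoidAlgebra.single (fun j => -(expo F l j : ℤ)) v) ?_
  rw [AddMonoidAlgebra.single_mul_single, hv, AddMonoidAlgebra.one_def]
  congr 1
  ext j
  simp

/-- The coaction `Loc I F → (Loc I F)[ℤ^n]` that defines the grading. -/
noncomputable def coaction (F : Finset (Fin n)) :
    Loc I F →ₐ[K] AddMonoidAlgebra (Loc I F) (Fin n → ℤ) :=
  IsLocalization.liftAlgHom (M := Submonoid.powers (xProd I F)) (f := quotCoaction hI F)
    (isUnit_quotCoaction hI F)

theorem coaction_algebraMap (F : Finset (Fin n)) (r : QuotRing I) :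
    coaction hI F (algebraMap (QuotRing I) (Loc I F) r) = quotCoaction hI F r :=
  IsLocalization.lift_eq _ r

theorem coaction_frac (F : Finset (Fin n)) (b : Fin n →₀ ℕ) (l : ℕ) :
    coaction hI F (frac I F b l) = AddMonoidAlgebra.single
      (fun j => (b j : ℤ) - (if j ∈ F then (l : ℤ) else 0)) (frac I F b l) := by
  have hu : IsUnit (coaction hI F (algebraMap (QuotRing I) (Loc I F) (monom I (expo F l)))) := by
    rw [coaction_algebraMap, ← xProd_pow]
    exact isUnit_quotCoaction hI F ⟨_, l, rfl⟩
  refine hu.mul_right_cancel ?_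
  rw [← map_mul, frac_mul, coaction_algebraMap, coaction_algebraMap, quotCoaction_monom,
    quotCoaction_monom, AddMonoidAlgebra.single_mul_single, frac_mul]
  congr 1
  ext j
  simp [expo_apply]

/-- This makes the coefficient at `a` a projection: it returns `y` in degree `a`, and `0` on
elements of any other degree. -/
theorem coaction_of_mem (F : Finset (Fin n)) (a : Fin n → ℤ) {y : Loc I F}
    (hy : y ∈ locDegree I F a) : coaction hI F y = AddMonoidAlgebra.single a y := by
  rw [locDegree_eq] at hy
  induction hy using Submodule.span_induction with
  | mem y h =>
    obtain ⟨b, l, h, rfl⟩ := h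
    rw [coaction_frac, funext h]
  | zero => rw [map_zero, AddMonoidAlgebra.single_zero]
  | add y z _ _ hy hz => rw [map_add, hy, hz, AddMonoidAlgebra.single_add]
  | smul c y _ hy => rw [map_smul, hy, AddMonoidAlgebra.smul_single]

/-- The component of degree `a`. -/
noncomputable def locProj (F : Finset (Fin n)) (a : Fin n → ℤ) : Loc I F →ₗ[K] Loc I F :=
  Finsupp.lapply a ∘ₗ (AddMonoidAlgebra.coeffLinearEquiv K).toLinearMap ∘ₗ
    (coaction hI F).toLinearMap

theorem locProj_family (F : Finset (Fin n)) :
    IsProjectionFamily (locDegree I F) (locProj hI F) where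
  apply_self a v hv := by
    have : locProj hI F a v = (coaction hI F v).coeff a := rfl
    rw [this, coaction_of_mem hI F a hv]
    simp
  apply_ne a b hab v hv := by
    have : locProj hI F a v = (coaction hI F v).coeff a := rfl
    rw [this, coaction_of_mem hI F b hv]
    simp [hab.symm]
  iSup_eq_top := iSup_locDegree I F

end LocGrading
end MonomialLC

end

section


universe u

namespace MonomialLC

/-! ### Gradings and dimensions of subquotients. -/

section Subquotient

variable {K R X σ : Type*} [Field K] [CommRing R] [Algebra K R] [AddCommGroup X] [Module R X]
  [Module K X] [IsScalarTower K R X] {W : σ → Submodule K X} {p : σ → X →ₗ[K] X}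

variable (K) in
/-- The image in a subquotient `Z / B` of a `K`-subspace. -/
abbrev subquotientImage (Z B : Submodule R X) (W : Submodule K X) :
    Submodule K (Z ⧸ B.submoduleOf Z) :=
  (W.comap (Z.subtype.restrictScalars K)).map ((B.submoduleOf Z).mkQ.restrictScalars K)

/-- Projections that preserve `Z` and `B` induce projections of `Z / B`. -/
theorem IsProjectionFamily.subquotient (h : IsProjectionFamily W p) (Z B : Submodule R X)
    (hZ : ∀ a, ∀ z ∈ Z, p a z ∈ Z) (hB : ∀ a, ∀ z ∈ B, p a z ∈ B) :
    ∃ q, IsProjectionFamily (fun a => subquotientImage K Z B (W a)) q := by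
  let P := B.submoduleOf Z
  let pZ : σ → Z →ₗ[K] Z := fun a =>
    { toFun := fun z => ⟨p a z, hZ a z z.2⟩
      map_add' := fun y z => Subtype.ext (map_add (p a) (y : X) z)
      map_smul' := fun c z => Subtype.ext (map_smul (p a) c (z : X)) }
  let e := Submodule.Quotient.restrictScalarsEquiv K P
  let q : σ → (Z ⧸ P) →ₗ[K] (Z ⧸ P) := fun a =>
    e.toLinearMap ∘ₗ (P.restrictScalars K).mapQ (P.restrictScalars K) (pZ a)
      (fun z hz => hB a z hz) ∘ₗ e.symm.toLinearMap
  have hq : ∀ a z, q a (P.mkQ z) = P.mkQ (pZ a z) := fun a z => rfl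
  refine ⟨q, ?_, ?_, ?_⟩
  · rintro a _ ⟨z, hz, rfl⟩
    refine (hq a z).trans (congrArg P.mkQ (Subtype.ext ?_))
    exact h.apply_self a z hz
  · rintro a b hab _ ⟨z, hz, rfl⟩
    have : pZ a z = 0 := Subtype.ext (h.apply_ne a b hab z hz)
    refine (hq a z).trans ?_
    rw [this, map_zero]
  · rw [eq_top_iff]
    rintro y -
    obtain ⟨z, rfl⟩ := P.mkQ_surjective y
    obtain ⟨s, hs⟩ := h.exists_sum (z : X)
    have : z = ∑ a ∈ s, pZ a z := Subtype.ext (hs.trans (by simp [pZ]))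
    rw [this, map_sum]
    exact sum_mem fun a _ => Submodule.mem_iSup_of_mem a ⟨pZ a z, h.mem a z, rfl⟩

theorem finrank_map_add_finrank_inf_ker {V V' : Type*} [AddCommGroup V] [Module K V]
    [AddCommGroup V'] [Module K V'] (f : V →ₗ[K] V') (U : Submodule K V) [FiniteDimensional K U] :
    Module.finrank K (U.map f) + Module.finrank K (U ⊓ LinearMap.ker f : Submodule K V) =
      Module.finrank K U := by
  have h := LinearMap.finrank_range_add_finrank_ker (f.domRestrict U)
  rw [LinearMap.range_domRestrict, LinearMap.ker_domRestrict] at h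
  rw [← h]
  congr 1
  have : (U ⊓ LinearMap.ker f : Submodule K V) = ((LinearMap.ker f).submoduleOf U).map U.subtype := by
    rw [Submodule.submoduleOf, Submodule.map_comap_subtype]
  rw [this]
  exact Submodule.finrank_map_subtype_eq _ _

/-- The dimension of a subspace of a subquotient. -/
theorem finrank_subquotientImage {Z B : Submodule R X} (hBZ : B ≤ Z) (W : Submodule K X)
    [FiniteDimensional K W] :
    Module.finrank K (subquotientImage K Z B W) +
      Module.finrank K (W ⊓ B.restrictScalars K : Submodule K X) =
      Module.finrank K (W ⊓ Z.restrictScalars K : Submodule K X) := by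
  let ι : Z →ₗ[K] X := Z.subtype.restrictScalars K
  have hι : Function.Injective ι := Subtype.val_injective
  let U : Submodule K Z := W.comap ι
  let π := (B.submoduleOf Z).mkQ.restrictScalars K
  have h₁ : U.map ι = W ⊓ Z.restrictScalars K := by
    ext y
    constructor
    · rintro ⟨z, hz, rfl⟩
      exact ⟨hz, z.2⟩
    · rintro ⟨hy, hy'⟩
      exact ⟨⟨y, hy'⟩, hy, rfl⟩
  have h₂ : (U ⊓ LinearMap.ker π).map ι = W ⊓ B.restrictScalars K := by
    ext y
    constructor
    · rintro ⟨z, ⟨hz, hz'⟩, rfl⟩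
      exact ⟨hz, (Submodule.Quotient.mk_eq_zero (B.submoduleOf Z)).1 hz'⟩
    · rintro ⟨hy, hy'⟩
      exact ⟨⟨y, hBZ hy'⟩, ⟨hy, (Submodule.Quotient.mk_eq_zero (B.submoduleOf Z)).2 hy'⟩, rfl⟩
  have hW : FiniteDimensional K (W ⊓ Z.restrictScalars K : Submodule K X) :=
    Submodule.finiteDimensional_of_le inf_le_left
  have hU : FiniteDimensional K U :=
    Module.Finite.equiv ((Submodule.equivMapOfInjective ι hι U).trans
      (LinearEquiv.ofEq _ _ h₁)).symm
  rw [← h₁, ← h₂, ← (Submodule.equivMapOfInjective ι hι U).finrank_eq,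
    ← (Submodule.equivMapOfInjective ι hι _).finrank_eq]
  exact finrank_map_add_finrank_inf_ker π U

theorem finiteDimensional_subquotientImage (Z B : Submodule R X) (W : Submodule K X)
    [FiniteDimensional K W] : FiniteDimensional K (subquotientImage K Z B W) := by
  let κ := (Z.subtype.restrictScalars K).domRestrict (W.comap (Z.subtype.restrictScalars K))
  have hκ : Function.Injective κ := fun y z h => Subtype.ext (Subtype.ext h)
  have : FiniteDimensional K (W.comap (Z.subtype.restrictScalars K)) :=
    Module.Finite.of_injective (κ.codRestrict W fun z => z.2)
      ((LinearMap.injective_codRestrict_iff _).2 hκ)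
  exact Module.Finite.map _ _

end Subquotient

end MonomialLC

end

section


universe u

namespace MonomialLC

/-! ### The grading of the Čech complex and of its cohomology. -/

section TotalGrading

variable {K : Type u} [Field K] {n : ℕ} {I : Ideal (MvPolynomial (Fin n) K)}

noncomputable local instance quotRingDistribMulAction :
    DistribMulAction (QuotRing I) (QuotRing I) := inferInstance

noncomputable local instance locModule (F : Finset (Fin n)) : Module K (Loc I F) := inferInstance

noncomputable local instance cechTotalAddCommGroup : AddCommGroup (CechTotal I) := inferInstance

noncomputable local instance cechTotalModule : Module K (CechTotal I) := inferInstance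

local instance cechTotalIsScalarTower : IsScalarTower K (QuotRing I) (CechTotal I) := inferInstance

theorem frac_mem (F : Finset (Fin n)) (b : Fin n →₀ ℕ) (l : ℕ) {a : Fin n → ℤ}
    (h : ∀ j, (b j : ℤ) - (if j ∈ F then (l : ℤ) else 0) = a j) :
    frac I F b l ∈ locDegree I F a := Submodule.subset_span ⟨b, l, h, rfl⟩

theorem isUnit_monom_expo (F : Finset (Fin n)) (l : ℕ) :
    IsUnit (algebraMap (QuotRing I) (Loc I F) (monom I (expo F l))) := by
  rw [← xProd_pow]
  exact IsLocalization.map_units (Loc I F) (⟨_, l, rfl⟩ : Submonoid.powers (xProd I F))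

/-- A fraction is determined by its defining equation. -/
theorem eq_frac {F : Finset (Fin n)} {b : Fin n →₀ ℕ} {l : ℕ} {y : Loc I F}
    (h : y * algebraMap (QuotRing I) (Loc I F) (monom I (expo F l)) =
      algebraMap (QuotRing I) (Loc I F) (monom I b)) : y = frac I F b l :=
  (isUnit_monom_expo F l).mul_right_cancel (h.trans (frac_mul I F b l).symm)

/-- Numerator and denominator are multiplied by `x_{F' ∖ F}^l`. -/
theorem nat_frac {F F' : Finset (Fin n)} (h : F ⊆ F') (b : Fin n →₀ ℕ) (l : ℕ) :
    nat I h (frac I F b l) = frac I F' (b + expo (F' \ F) l) l := by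
  apply eq_frac
  have he : expo F' l = expo F l + expo (F' \ F) l := by
    ext j
    have := @h j
    simp only [Finsupp.add_apply, expo_apply, Finset.mem_sdiff]
    by_cases h₁ : j ∈ F <;> by_cases h₂ : j ∈ F' <;> first | exact absurd (this h₁) h₂ | simp [h₁, h₂]
  have h₁ := congrArg (nat I h) (frac_mul I F b l)
  rw [map_mul, AlgHom.commutes, AlgHom.commutes] at h₁
  rw [he, monom_add, map_mul, ← mul_assoc, h₁, ← map_mul, ← monom_add]

theorem nat_mem {F F' : Finset (Fin n)} (h : F ⊆ F') (a : Fin n → ℤ) {y : Loc I F}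
    (hy : y ∈ locDegree I F a) : nat I h y ∈ locDegree I F' a := by
  rw [locDegree_eq] at hy
  induction hy using Submodule.span_induction with
  | mem y hy =>
    obtain ⟨b, l, hb, rfl⟩ := hy
    rw [nat_frac]
    refine frac_mem F' _ l fun j => ?_
    rw [← hb j]
    have := @h j
    simp only [Finsupp.add_apply, expo_apply, Finset.mem_sdiff]
    by_cases h₁ : j ∈ F <;> by_cases h₂ : j ∈ F' <;> first | exact absurd (this h₁) h₂ | simp [h₁, h₂]
  | zero => rw [map_zero]; exact zero_mem _
  | add y z _ _ hy hz => rw [map_add]; exact add_mem hy hz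
  | smul c y _ hy =>
    have : nat I h (c • y) = c • nat I h y := map_smul ((nat I h).restrictScalars K) c y
    rw [this]
    exact Submodule.smul_mem _ c hy

theorem x_smul_mem (F : Finset (Fin n)) (a : Fin n → ℤ) (j : Fin n) {y : Loc I F}
    (hy : y ∈ locDegree I F a) : x I j • y ∈ locDegree I F (a + Pi.single j 1) := by
  rw [locDegree_eq] at hy
  induction hy using Submodule.span_induction with
  | mem y hy =>
    obtain ⟨b, l, hb, rfl⟩ := hy
    have : x I j • frac I F b l = frac I F (b + Finsupp.single j 1) l := by
      apply eq_frac
      have h := frac_mul I F b l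
      have hx : x I j • frac I F b l =
        algebraMap (QuotRing I) (Loc I F) (x I j) * frac I F b l :=
        Algebra.smul_def (R := QuotRing I) (A := Loc I F) _ _
      rw [hx, mul_assoc, h, add_comm, monom_add, map_mul]
      rfl
    rw [this]
    refine frac_mem F _ l fun k => ?_
    rw [Pi.add_apply, ← hb k, Finsupp.add_apply, Finsupp.single_apply, Pi.single_apply]
    push_cast
    simp only [eq_comm (a := j)]
    ring
  | zero => 
    have h : x I j • (0 : Loc I F) = 0 := smul_zero (M := QuotRing I) (A := Loc I F) _
    exact h.symm ▸ zero_mem _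
  | add y z _ _ hy hz => 
    have h : x I j • (y + z) = x I j • y + x I j • z :=
      smul_add (M := QuotRing I) (A := Loc I F) _ _ _
    exact h ▸ add_mem hy hz
  | smul c y _ hy =>
    have h : x I j • c • y = c • x I j • y :=
      (smul_comm (M := K) (N := QuotRing I) (α := Loc I F) c (x I j) y).symm
    exact h ▸ Submodule.smul_mem _ c hy

variable (I) in
/-- The component of degree `a` of the Čech complex. -/
noncomputable abbrev totDegree (a : Fin n → ℤ) : Submodule K (CechTotal I) :=
  Submodule.pi Set.univ (fun F => locDegree I F a)

theorem mem_totDegree {a : Fin n → ℤ} {z : CechTotal I} :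
    z ∈ totDegree I a ↔ ∀ F, z F ∈ locDegree I F a :=
  ⟨fun h F => h F (Set.mem_univ F), fun h F _ => h F⟩

theorem neg_one_pow_smul {M : Type*} [AddCommGroup M] [Module K M] [Module (QuotRing I) M] (k : ℕ)
    (y : M) : (-1 : QuotRing I) ^ k • y = (-1 : K) ^ k • y := by
  rcases Nat.even_or_odd k with hk | hk
  · rw [hk.neg_one_pow (α := QuotRing I), hk.neg_one_pow (α := K), one_smul, one_smul]
  · rw [hk.neg_one_pow (α := QuotRing I), hk.neg_one_pow (α := K), neg_smul, neg_smul, one_smul, one_smul]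

theorem cechDifferential_apply (z : CechTotal I) (F : Finset (Fin n)) :
    cechDifferential I z F =
      ∑ j ∈ F, (-1 : K) ^ position F j • nat I (F.erase_subset j) (z (F.erase j)) := by
  rw [cechDifferential_eq, subsetD_apply]
  exact Finset.sum_congr rfl fun j _ => neg_one_pow_smul _ _

theorem cechDifferential_mem {a : Fin n → ℤ} {z : CechTotal I} (hz : z ∈ totDegree I a) :
    cechDifferential I z ∈ totDegree I a := by
  rw [mem_totDegree] at hz ⊢
  intro F
  rw [cechDifferential_apply]
  exact sum_mem fun j _ => Submodule.smul_mem _ _ (nat_mem _ a (hz _))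

theorem nat_nat {F F' F'' : Finset (Fin n)} (h : F ⊆ F') (h' : F' ⊆ F'') (y : Loc I F) :
    nat I h' (nat I h y) = nat I (h.trans h') y := by
  obtain ⟨y, rfl⟩ := (locEquiv I F).surjective y
  rw [← locEquiv_cechι, ← locEquiv_cechι, ← locEquiv_cechι, cechι_cechι]

theorem cechDifferential_cechDifferential (z : CechTotal I) :
    cechDifferential I (cechDifferential I z) = 0 :=
  subsetD_subsetD (A := Loc I) (fun {_ _} h => (nat I h).toLinearMap) nat_nat z

theorem cechCoboundaries_le (t : ℤ) : cechCoboundaries I t ≤ cechCocycles I t := by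
  rintro _ ⟨y, hy, rfl⟩
  refine ⟨?_, cechDifferential_cechDifferential y⟩
  have : cechDifferential I y ∈ cechTerm I (t - 1 + 1) :=
    subsetD_mem (A := Loc I) (fun {_ _} h => (nat I h).toLinearMap) hy
  rwa [sub_add_cancel] at this

variable (hI : IsMonomialIdeal I)

/-- The projection of the Čech complex to the component of degree `a`. -/
noncomputable def totProj (a : Fin n → ℤ) : CechTotal I →ₗ[K] CechTotal I :=
  LinearMap.pi fun F => locProj hI F a ∘ₗ LinearMap.proj F

theorem totProj_family : IsProjectionFamily (totDegree I) (totProj hI) where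
  apply_self a z hz := funext fun F => (locProj_family hI F).apply_self a _ (mem_totDegree.1 hz F)
  apply_ne a b hab z hz :=
    funext fun F => (locProj_family hI F).apply_ne a b hab _ (mem_totDegree.1 hz F)
  iSup_eq_top := by
    rw [eq_top_iff]
    rintro z -
    rw [← Finset.univ_sum_single z]
    refine sum_mem fun F _ => ?_
    have hF : z F ∈ ⨆ a, locDegree I F a := (iSup_locDegree I F) ▸ Submodule.mem_top
    have : (⨆ a, locDegree I F a) ≤ (⨆ a, totDegree I a).comap (LinearMap.single K (Loc I) F) := by
      refine iSup_le fun a y hy => Submodule.mem_iSup_of_mem a (mem_totDegree.2 fun F' => ?_)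
      by_cases h : F' = F
      · subst h
        simpa using hy
      · rw [LinearMap.single_apply, Pi.single_eq_of_ne h]
        exact zero_mem _
    exact this hF

theorem totProj_cechDifferential (a : Fin n → ℤ) (z : CechTotal I) :
    cechDifferential I (totProj hI a z) = totProj hI a (cechDifferential I z) :=
  (totProj_family hI).comm (totProj_family hI) ((cechDifferential I).restrictScalars K)
    (fun _ _ hv => cechDifferential_mem hv) a z

theorem totProj_mem_cechTerm (a : Fin n → ℤ) {t : ℤ} {z : CechTotal I} (hz : z ∈ cechTerm I t) :
    totProj hI a z ∈ cechTerm I t := fun F hF => by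
  change locProj hI F a (z F) = 0
  rw [hz F hF, map_zero]

theorem totProj_mem_cechCocycles (a : Fin n → ℤ) {t : ℤ} {z : CechTotal I}
    (hz : z ∈ cechCocycles I t) : totProj hI a z ∈ cechCocycles I t := by
  refine ⟨totProj_mem_cechTerm hI a hz.1, ?_⟩
  change cechDifferential I _ = 0
  rw [totProj_cechDifferential, LinearMap.mem_ker.1 hz.2, map_zero]

theorem totProj_mem_cechCoboundaries (a : Fin n → ℤ) {t : ℤ} {z : CechTotal I}
    (hz : z ∈ cechCoboundaries I t) : totProj hI a z ∈ cechCoboundaries I t := by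
  obtain ⟨y, hy, rfl⟩ := hz
  exact ⟨_, totProj_mem_cechTerm hI a hy, totProj_cechDifferential hI a y⟩

include hI in
/-- The Čech cohomology is the direct sum of its components. -/
theorem isInternal_cechDegree (t : ℤ) : DirectSum.IsInternal (cechDegree I t) := by
  obtain ⟨q, hq⟩ := (totProj_family hI).subquotient (cechCocycles I t) (cechCoboundaries I t)
    (fun a z => totProj_mem_cechCocycles hI a) (fun a z => totProj_mem_cechCoboundaries hI a)
  exact hq.isInternal

theorem x_smul_mem_cechDegree (t : ℤ) (a : Fin n → ℤ) (j : Fin n) {y : CechCohomology I t}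
    (hy : y ∈ cechDegree I t a) : x I j • y ∈ cechDegree I t (a + Pi.single j 1) := by
  obtain ⟨z, hz, rfl⟩ := hy
  exact ⟨x I j • z, mem_totDegree.2 fun F => x_smul_mem F a j (mem_totDegree.1 hz F), rfl⟩

/-- The homogeneous elements of degree `a` in the term `C^t`. -/
noncomputable def strand (I : Ideal (MvPolynomial (Fin n) K)) (t : ℤ) (a : Fin n → ℤ) :
    Submodule K (CechTotal I) :=
  totDegree I a ⊓ (cechTerm I t).restrictScalars K

variable (I) in
/-- The Čech differential as a `K`-linear map. -/
noncomputable abbrev cechD : CechTotal I →ₗ[K] CechTotal I := (cechDifferential I).restrictScalars K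

-- If `d y` is homogeneous of degree `a`, then `y` may be replaced by its component of degree `a`,
-- because the projection commutes with `d`. Hence cohomology in degree `a` can be computed inside
-- the strand.
include hI in
theorem totDegree_inf_cechCoboundaries (t : ℤ) (a : Fin n → ℤ) :
    totDegree I a ⊓ (cechCoboundaries I t).restrictScalars K =
      (strand I (t - 1) a).map (cechD I) := by
  apply le_antisymm
  · rintro z ⟨hz, y, hy, rfl⟩
    refine ⟨totProj hI a y, ⟨(totProj_family hI).mem a y, totProj_mem_cechTerm hI a hy⟩, ?_⟩
    exact (totProj_cechDifferential hI a y).trans ((totProj_family hI).apply_self a _ hz)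
  · rintro _ ⟨y, hy, rfl⟩
    exact ⟨cechDifferential_mem hy.1, y, hy.2, rfl⟩

theorem totDegree_inf_cechCocycles (t : ℤ) (a : Fin n → ℤ) :
    totDegree I a ⊓ (cechCocycles I t).restrictScalars K =
      strand I t a ⊓ LinearMap.ker (cechD I) := by
  ext z
  exact and_assoc.symm

include hI in
/-- The dimension of the component of degree `a` of the Čech cohomology. -/
theorem finrank_cechDegree (t : ℤ) (a : Fin n → ℤ) [FiniteDimensional K (totDegree I a)] :
    Module.finrank K (cechDegree I t a) + Module.finrank K ((strand I (t - 1) a).map (cechD I)) +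
      Module.finrank K ((strand I t a).map (cechD I)) = Module.finrank K (strand I t a) := by
  have h₁ := finrank_subquotientImage (cechCoboundaries_le (I := I) t) (totDegree I a)
  rw [totDegree_inf_cechCoboundaries hI, totDegree_inf_cechCocycles] at h₁
  have : FiniteDimensional K (strand I t a) := Submodule.finiteDimensional_of_le inf_le_left
  have h₂ := finrank_map_add_finrank_inf_ker (cechD I) (strand I t a)
  have h₃ : Module.finrank K (cechDegree I t a) + Module.finrank K
      ((strand I (t - 1) a).map (cechD I)) =
    Module.finrank K (strand I t a ⊓ LinearMap.ker (cechD I) : Submodule K (CechTotal I)) := h₁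
  omega

theorem finiteDimensional_cechDegree (t : ℤ) (a : Fin n → ℤ) [FiniteDimensional K (totDegree I a)] :
    FiniteDimensional K (cechDegree I t a) :=
  finiteDimensional_subquotientImage (cechCocycles I t) (cechCoboundaries I t) (totDegree I a)

end TotalGrading
end MonomialLC

end

section


universe u

namespace MonomialLC

open Matrix

/-! ### Ranks of adjoint maps. -/

section Transpose

variable {K ι : Type*} [Field K] [Fintype ι] [DecidableEq ι]

/-- Two endomorphisms of `K^ι` that are adjoint for the dot product have the same rank. -/
theorem finrank_range_eq_of_adjoint {f g : (ι → K) →ₗ[K] (ι → K)}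
    (h : ∀ v w, f v ⬝ᵥ w = v ⬝ᵥ g w) :
    Module.finrank K (LinearMap.range f) = Module.finrank K (LinearMap.range g) := by
  have ht : (LinearMap.toMatrix' f)ᵀ = LinearMap.toMatrix' g := by
    ext i j
    have := h (Pi.single i 1) (Pi.single j 1)
    rw [dotProduct_single_one, single_one_dotProduct] at this
    rw [transpose_apply, LinearMap.toMatrix'_apply, LinearMap.toMatrix'_apply]
    simpa [Pi.single_apply, eq_comm] using this
  have hr : ∀ k : (ι → K) →ₗ[K] (ι → K),
      (LinearMap.toMatrix' k).rank = Module.finrank K (LinearMap.range k) := fun k => by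
    rw [Matrix.rank, ← Matrix.toLin'_apply', Matrix.toLin'_toMatrix']
  rw [← hr, ← hr, ← ht, rank_transpose]

end Transpose

/-! ### Reduced simplicial homology and the coboundary map. -/

section Simplicial

variable {K : Type*} [Field K] {n : ℕ}

variable (K n) in
/-- The simplicial coboundary on all the subsets of `{1, …, n}`. -/
noncomputable abbrev coboundary : (Finset (Fin n) → K) →ₗ[K] (Finset (Fin n) → K) :=
  subsetD (A := fun _ => K) fun {_ _} _ => LinearMap.id

theorem coboundary_apply (e : Finset (Fin n) → K) (F : Finset (Fin n)) :
    coboundary K n e F = ∑ j ∈ F, (-1 : K) ^ position F j * e (F.erase j) :=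
  subsetD_apply _ _ _

theorem boundary_apply (c : Finset (Fin n) → K) :
    boundary K n c = ∑ F, c F • ∑ j ∈ F,
      (-1 : K) ^ position F j • (Pi.single (F.erase j) 1 : Finset (Fin n) → K) :=
  Fintype.linearCombination_apply K _ c

/-- The coboundary is the transpose of the boundary, in the basis of subsets. This is the bridge
from Čech cohomology to simplicial homology. -/
theorem boundary_dotProduct (c e : Finset (Fin n) → K) :
    boundary K n c ⬝ᵥ e = c ⬝ᵥ coboundary K n e := by
  rw [boundary_apply, sum_dotProduct]
  refine Finset.sum_congr rfl fun F _ => ?_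
  rw [smul_dotProduct, sum_dotProduct, coboundary_apply, smul_eq_mul]
  congr 1
  refine Finset.sum_congr rfl fun j _ => ?_
  rw [smul_dotProduct, single_one_dotProduct, smul_eq_mul]

theorem boundary_boundary (c : Finset (Fin n) → K) : boundary K n (boundary K n c) = 0 := by
  refine dotProduct_eq _ _ fun e => ?_
  rw [boundary_dotProduct, boundary_dotProduct, zero_dotProduct]
  have : coboundary K n (coboundary K n e) = 0 :=
    by
    refine subsetD_subsetD (R := K) (A := fun _ => K) (fun {_ _} _ => LinearMap.id) ?_ e
    intros
    rfl
  rw [this, dotProduct_zero]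

variable (D : SimplicialCx n) (p : ℤ)

theorem mem_chains {D : SimplicialCx n} {p : ℤ} {c : Finset (Fin n) → K} :
    c ∈ chains K D p ↔ ∀ F, ¬ (F ∈ D ∧ (F.card : ℤ) = p + 1) → c F = 0 := Iff.rfl

open Classical in
variable (K) in
/-- The projection to the chains of dimension `p`. -/
noncomputable def chainProj : (Finset (Fin n) → K) →ₗ[K] (Finset (Fin n) → K) :=
  LinearMap.pi fun F => if F ∈ D ∧ (F.card : ℤ) = p + 1 then LinearMap.proj F else 0

variable {D p} in
theorem chainProj_of_mem {F : Finset (Fin n)} (h : F ∈ D ∧ (F.card : ℤ) = p + 1)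
    (c : Finset (Fin n) → K) : chainProj K D p c F = c F := by
  simp [chainProj, h]

variable {D p} in
theorem chainProj_of_notMem {F : Finset (Fin n)} (h : ¬ (F ∈ D ∧ (F.card : ℤ) = p + 1))
    (c : Finset (Fin n) → K) : chainProj K D p c F = 0 := by
  simp only [chainProj, LinearMap.pi_apply, if_neg h, LinearMap.zero_apply]

theorem chainProj_mem (c : Finset (Fin n) → K) : chainProj K D p c ∈ chains K D p :=
  fun _ hF => chainProj_of_notMem hF c

variable {D p} in
theorem chainProj_eq_self {c : Finset (Fin n) → K} (hc : c ∈ chains K D p) :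
    chainProj K D p c = c := by
  ext F
  by_cases h : F ∈ D ∧ (F.card : ℤ) = p + 1
  · exact chainProj_of_mem h c
  · rw [chainProj_of_notMem h, mem_chains.1 hc F h]

theorem range_chainProj : LinearMap.range (chainProj K D p) = chains K D p :=
  le_antisymm (by rintro _ ⟨c, rfl⟩; exact chainProj_mem D p c)
    fun c hc => ⟨c, chainProj_eq_self hc⟩

theorem chainProj_dotProduct (c e : Finset (Fin n) → K) :
    chainProj K D p c ⬝ᵥ e = c ⬝ᵥ chainProj K D p e := by
  refine Finset.sum_congr rfl fun F _ => ?_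
  by_cases h : F ∈ D ∧ (F.card : ℤ) = p + 1
  · rw [chainProj_of_mem h, chainProj_of_mem h]
  · rw [chainProj_of_notMem h, chainProj_of_notMem h, zero_mul, mul_zero]

theorem boundary_mem {c : Finset (Fin n) → K} (hc : c ∈ chains K D (p + 1)) :
    boundary K n c ∈ chains K D p := by
  rw [boundary_apply]
  refine sum_mem fun F _ => ?_
  by_cases h : F ∈ D ∧ (F.card : ℤ) = p + 1 + 1
  · refine Submodule.smul_mem _ _ (sum_mem fun j hj => Submodule.smul_mem _ _ fun F' hF' => ?_)
    refine Pi.single_eq_of_ne ?_ _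
    rintro rfl
    refine hF' ⟨D.lower (F.erase_subset j) h.1, ?_⟩
    have := Finset.card_erase_add_one hj
    omega
  · rw [mem_chains.1 hc F h, zero_smul]
    exact zero_mem _

theorem boundaries_le_cycles : boundaries K D p ≤ cycles K D p := by
  rintro _ ⟨c, hc, rfl⟩
  exact ⟨boundary_mem D p hc, boundary_boundary c⟩

/-- The rank of the coboundary map equals the dimension of the space of boundaries. -/
theorem finrank_map_coboundary :
    Module.finrank K ((chains K D p).map (chainProj K D (p + 1) ∘ₗ coboundary K n)) =
      Module.finrank K (boundaries K D p) := by
  -- Both maps are compressed by the self-adjoint projections `chainProj`. They become adjoint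
  -- endomorphisms of the whole space, to which equality of ranks applies.
  have h₁ : (chains K D p).map (chainProj K D (p + 1) ∘ₗ coboundary K n) =
      LinearMap.range (chainProj K D (p + 1) ∘ₗ coboundary K n ∘ₗ chainProj K D p) := by
    rw [← LinearMap.comp_assoc, LinearMap.range_comp, range_chainProj]
  have h₂ : boundaries K D p =
      LinearMap.range (chainProj K D p ∘ₗ boundary K n ∘ₗ chainProj K D (p + 1)) := by
    rw [LinearMap.range_comp, LinearMap.range_comp, range_chainProj]
    ext c
    constructor
    · rintro ⟨e, he, rfl⟩
      exact ⟨_, ⟨e, he, rfl⟩, chainProj_eq_self (boundary_mem D p he)⟩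
    · rintro ⟨_, ⟨e, he, rfl⟩, rfl⟩
      exact ⟨e, he, (chainProj_eq_self (boundary_mem D p he)).symm⟩
  rw [h₁, h₂]
  refine (finrank_range_eq_of_adjoint fun v w => ?_).symm
  simp only [LinearMap.comp_apply]
  rw [chainProj_dotProduct, boundary_dotProduct, chainProj_dotProduct]

/-- Rank–nullity in the same shape as `finrank_cechDegree`. Under transposition the coboundary
leaving dimension `p` has the rank of the boundary entering it, so the two equations match term by
term. -/
theorem finrank_reducedHomology :
    Module.finrank K (ReducedHomology K D p) + Module.finrank K (boundaries K D (p - 1)) +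
      Module.finrank K (boundaries K D p) = Module.finrank K (chains K D p) := by
  have h₁ := Submodule.finrank_quotient_add_finrank ((boundaries K D p).submoduleOf (cycles K D p))
  rw [(Submodule.submoduleOfEquivOfLe (boundaries_le_cycles D p)).finrank_eq] at h₁
  have h₂ := finrank_map_add_finrank_inf_ker (boundary K n) (chains K D p)
  have h₃ : boundaries K D (p - 1) = (chains K D p).map (boundary K n) := by
    rw [boundaries, sub_add_cancel]
  rw [h₃]
  have h₄ : Module.finrank K (ReducedHomology K D p) + Module.finrank K (boundaries K D p) =
    Module.finrank K (chains K D p ⊓ LinearMap.ker (boundary K n) :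
      Submodule K (Finset (Fin n) → K)) := h₁
  omega

end Simplicial
end MonomialLC

end

section


universe u

namespace MonomialLC

attribute [local instance] quotRingDistribMulAction locModule cechTotalAddCommGroup cechTotalModule
  cechTotalIsScalarTower

/-! ### The component of degree `a` of `R_{x_F}` is at most one-dimensional. -/

section DegreeFraction

variable {K : Type u} [Field K] {n : ℕ} {I : Ideal (MvPolynomial (Fin n) K)}

theorem monomial_mem_iff {c : Fin n →₀ ℕ} :
    MvPolynomial.monomial c (1 : K) ∈ I ↔ ∃ u ∈ minGens I, u ≤ c := by
  constructor
  · intro h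
    obtain ⟨u, hu, hm⟩ := exists_minimal_le_of_wellFoundedLT
      (fun c : Fin n →₀ ℕ => MvPolynomial.monomial c (1 : K) ∈ I) c h
    exact ⟨u, hm, hu⟩
  · rintro ⟨u, hu, huc⟩
    obtain ⟨d, rfl⟩ := exists_add_of_le huc
    rw [← one_mul (1 : K), ← MvPolynomial.monomial_mul]
    exact I.mul_mem_right _ (show Minimal (fun c : Fin n →₀ ℕ =>
      MvPolynomial.monomial c (1 : K) ∈ I) u from hu).prop

/-- The fraction vanishes iff `x_F^k x^b` is zero in `R` for some `k`. A high power of `x_F` meets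
all the conditions on exponents inside `F`, so only those outside `F` remain. -/
theorem frac_eq_zero_iff {F : Finset (Fin n)} {b : Fin n →₀ ℕ} {l : ℕ} :
    frac I F b l = 0 ↔ ∃ u ∈ minGens I, ∀ j, j ∉ F → u j ≤ b j := by
  have h₁ : frac I F b l = 0 ↔ ∃ k, monom I (expo F k + b) = 0 := by
    rw [frac, IsLocalization.mk'_eq_zero_iff]
    constructor
    · rintro ⟨⟨_, k, rfl⟩, h⟩
      exact ⟨k, by rwa [monom_add, ← xProd_pow]⟩
    · rintro ⟨k, h⟩
      exact ⟨⟨_, k, rfl⟩, by rwa [monom_add, ← xProd_pow] at h⟩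
  rw [h₁]
  constructor
  · rintro ⟨k, h⟩
    obtain ⟨u, hu, hle⟩ := monomial_mem_iff.1 (Ideal.Quotient.eq_zero_iff_mem.1 h)
    refine ⟨u, hu, fun j hj => (hle j).trans ?_⟩
    simp [expo_apply, hj]
  · rintro ⟨u, hu, h⟩
    -- The sum of the exponents serves as a common upper bound for all `u j`.
    refine ⟨∑ j, u j, Ideal.Quotient.eq_zero_iff_mem.2 (monomial_mem_iff.2 ⟨u, hu, fun j => ?_⟩)⟩
    rw [Finsupp.add_apply, expo_apply]
    by_cases hj : j ∈ F
    · rw [if_pos hj]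
      exact (Finset.single_le_sum (f := fun j => u j) (fun _ _ => Nat.zero_le _)
        (Finset.mem_univ j)).trans (Nat.le_add_right _ _)
    · rw [if_neg hj, zero_add]
      exact h j hj

theorem frac_eq_frac {F : Finset (Fin n)} {b b' : Fin n →₀ ℕ} {l l' : ℕ}
    (h : ∀ j, (b j : ℤ) - (if j ∈ F then (l : ℤ) else 0) =
      (b' j : ℤ) - (if j ∈ F then (l' : ℤ) else 0)) : frac I F b l = frac I F b' l' := by
  apply eq_frac
  refine (isUnit_monom_expo F l).mul_right_cancel ?_
  rw [mul_right_comm, frac_mul, ← map_mul, ← map_mul, ← monom_add, ← monom_add]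
  congr 2
  ext j
  have := h j
  simp only [Finsupp.add_apply, expo_apply]
  split_ifs at this ⊢ <;> omega

/-- An exponent vector `b` with `x^b / x_F^l` of degree `a`, for `l = ∑ |a_j|`. -/
noncomputable def numExpo (a : Fin n → ℤ) (F : Finset (Fin n)) : Fin n →₀ ℕ :=
  Finsupp.equivFunOnFinite.symm fun j =>
    (a j + if j ∈ F then ((∑ k, (a k).natAbs : ℕ) : ℤ) else 0).toNat

/-- The truncation `toNat` loses nothing: on `F` the added sum is at least `|a_j|`, and off `F` one
has `a_j ≥ 0` because `G_a ⊆ F`. -/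
theorem numExpo_sub {a : Fin n → ℤ} {F : Finset (Fin n)} (h : negSupport a ⊆ F) (j : Fin n) :
    (numExpo a F j : ℤ) - (if j ∈ F then ((∑ k, (a k).natAbs : ℕ) : ℤ) else 0) = a j := by
  have h₁ : (a j).natAbs ≤ ∑ k, (a k).natAbs :=
    Finset.single_le_sum (f := fun k => (a k).natAbs) (fun _ _ => Nat.zero_le _)
      (Finset.mem_univ j)
  have h₂ : j ∉ F → 0 ≤ a j := fun hj => by
    by_contra hneg
    exact hj (h (Finset.mem_filter.2 ⟨Finset.mem_univ j, not_le.1 hneg⟩))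
  have h₃ : (numExpo a F j : ℤ) =
    ((a j + if j ∈ F then ((∑ k, (a k).natAbs : ℕ) : ℤ) else 0).toNat : ℤ) := rfl
  rw [h₃]
  by_cases hj : j ∈ F
  · rw [if_pos hj]
    omega
  · have := h₂ hj
    rw [if_neg hj]
    omega

variable (I) in
/-- The generator of the component of degree `a` of `R_{x_F}`. -/
noncomputable def degFrac (a : Fin n → ℤ) (F : Finset (Fin n)) : Loc I F :=
  if negSupport a ⊆ F then frac I F (numExpo a F) (∑ k, (a k).natAbs) else 0

theorem degFrac_of_subset {a : Fin n → ℤ} {F : Finset (Fin n)} (h : negSupport a ⊆ F) :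
    degFrac I a F = frac I F (numExpo a F) (∑ k, (a k).natAbs) := if_pos h

theorem degFrac_of_not_subset {a : Fin n → ℤ} {F : Finset (Fin n)} (h : ¬ negSupport a ⊆ F) :
    degFrac I a F = 0 := if_neg h

/-- Fractions of equal degree are equal by `frac_eq_frac`. When `G_a ⊄ F` there is none of degree
`a`, and the generator is `0`. -/
theorem locDegree_eq_span (a : Fin n → ℤ) (F : Finset (Fin n)) :
    locDegree I F a = Submodule.span K {degFrac I a F} := by
  apply le_antisymm
  · rw [locDegree_eq, Submodule.span_le]
    rintro _ ⟨b, l, hb, rfl⟩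
    have hF : negSupport a ⊆ F := fun j hj => by
      by_contra hjF
      have h₁ := hb j
      have h₂ := (Finset.mem_filter.1 hj).2
      rw [if_neg hjF] at h₁
      omega
    rw [SetLike.mem_coe, degFrac_of_subset hF, frac_eq_frac (fun j => (hb j).trans
      (numExpo_sub hF j).symm)]
    exact Submodule.mem_span_singleton_self _
  · rw [Submodule.span_singleton_le_iff_mem]
    by_cases hF : negSupport a ⊆ F
    · rw [degFrac_of_subset hF]
      exact frac_mem F _ _ (numExpo_sub hF)
    · rw [degFrac_of_not_subset hF]
      exact zero_mem _

theorem mem_locDegree_iff {a : Fin n → ℤ} {F : Finset (Fin n)} {y : Loc I F} :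
    y ∈ locDegree I F a ↔ ∃ c : K, c • degFrac I a F = y := by
  rw [locDegree_eq_span, Submodule.mem_span_singleton]

theorem nat_degFrac {a : Fin n → ℤ} {F F' : Finset (Fin n)} (hF : negSupport a ⊆ F)
    (h : F ⊆ F') : nat I h (degFrac I a F) = degFrac I a F' := by
  rw [degFrac_of_subset hF, degFrac_of_subset (hF.trans h), nat_frac]
  refine frac_eq_frac fun j => ?_
  rw [numExpo_sub (hF.trans h), ← numExpo_sub hF j, Finsupp.add_apply, expo_apply]
  by_cases h₁ : j ∈ F
  · simp [h₁, h h₁]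
  · by_cases h₂ : j ∈ F' <;> simp [h₁, h₂]

theorem sdiff_mem_degreeComplex_iff {a : Fin n → ℤ} {F : Finset (Fin n)} (hF : negSupport a ⊆ F) :
    F \ negSupport a ∈ degreeComplex I a ↔
      ∀ u ∈ minGens I, ∃ j, j ∉ F ∧ a j < (u j : ℤ) ∧ 0 ≤ a j := by
  constructor
  · rintro ⟨F', hF', h, he⟩
    have : F = F' := by
      rw [← Finset.sdiff_union_of_subset hF, he, Finset.sdiff_union_of_subset hF']
    rwa [this]
  · exact fun h => ⟨F, hF, h, rfl⟩

/-- Off `F` the numerator has exponent `a_j ≥ 0`, so the failure of `u_j ≤ b_j` for some `j ∉ F` is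
literally the condition defining `Δ_a`. -/
theorem degFrac_ne_zero_iff {a : Fin n → ℤ} {F : Finset (Fin n)} (hF : negSupport a ⊆ F) :
    degFrac I a F ≠ 0 ↔ F \ negSupport a ∈ degreeComplex I a := by
  rw [sdiff_mem_degreeComplex_iff hF, degFrac_of_subset hF, Ne, frac_eq_zero_iff]
  push Not
  refine forall₂_congr fun u _ => exists_congr fun j => and_congr_right fun hj => ?_
  have h := numExpo_sub hF j
  rw [if_neg hj] at h
  omega

/-- The components of degree `a` of the Čech complex are finite dimensional. -/
instance (a : Fin n → ℤ) : FiniteDimensional K (totDegree I a) := by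
  have h : ∀ F, FiniteDimensional K (locDegree I F a) := fun F => by
    rw [locDegree_eq_span]
    infer_instance
  let f : totDegree I a →ₗ[K] (∀ F, locDegree I F a) :=
    LinearMap.pi fun F => (LinearMap.proj F ∘ₗ (totDegree I a).subtype).codRestrict _
      fun z => mem_totDegree.1 z.2 F
  refine Module.Finite.of_injective f fun y z hyz => Subtype.ext (funext fun F => ?_)
  exact congrArg Subtype.val (congrFun hyz F)

end DegreeFraction

/-! ### The strand of degree `a` as the cochain complex of `Δ_a`. -/

section Comparison

variable {K : Type u} [Field K] {n : ℕ} (I : Ideal (MvPolynomial (Fin n) K)) (a : Fin n → ℤ)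

/-- The product of the signs `(-1)^{#{k ∈ G | k < j}}` over `j ∈ L`. -/
def shiftSign (K : Type*) [Field K] (G L : Finset (Fin n)) : K := ∏ j ∈ L, (-1) ^ position G j

theorem shiftSign_mul_self (G L : Finset (Fin n)) : shiftSign K G L * shiftSign K G L = 1 := by
  rw [shiftSign, ← Finset.prod_mul_distrib]
  refine Finset.prod_eq_one fun j _ => ?_
  rw [← mul_pow, neg_one_mul, neg_neg, one_pow]

theorem shiftSign_ne_zero (G L : Finset (Fin n)) : shiftSign K G L ≠ 0 :=
  left_ne_zero_of_mul_eq_one (shiftSign_mul_self G L)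

theorem position_eq_add {G F : Finset (Fin n)} (h : G ⊆ F) (j : Fin n) :
    position F j = position G j + position (F \ G) j := by
  unfold position
  rw [← Finset.card_union_of_disjoint, ← Finset.filter_union, Finset.union_sdiff_of_subset h]
  exact Finset.disjoint_filter_filter Finset.disjoint_sdiff

/-- The position of `j` in `F` exceeds that in `F ∖ G` by the number of smaller elements of `G`.
`shiftSign` collects the resulting sign over all of `F ∖ G`. -/
theorem neg_one_pow_position_mul_shiftSign {G F : Finset (Fin n)} (h : G ⊆ F) {j : Fin n}
    (hj : j ∈ F \ G) : (-1 : K) ^ position F j * shiftSign K G ((F \ G).erase j) =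
      shiftSign K G (F \ G) * (-1) ^ position (F \ G) j := by
  have : shiftSign K G (F \ G) = (-1) ^ position G j * shiftSign K G ((F \ G).erase j) :=
    (Finset.mul_prod_erase _ _ hj).symm
  rw [this, position_eq_add h, pow_add]
  ring

/-- The comparison between simplicial cochains and the component of degree `a` of the Čech
complex. -/
noncomputable def cochainMap : (Finset (Fin n) → K) →ₗ[K] CechTotal I :=
  LinearMap.pi fun F => shiftSign K (negSupport a) (F \ negSupport a) •
    (LinearMap.toSpanSingleton K (Loc I F) (degFrac I a F) ∘ₗ LinearMap.proj (F \ negSupport a))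

theorem cochainMap_apply (c : Finset (Fin n) → K) (F : Finset (Fin n)) :
    cochainMap I a c F = shiftSign K (negSupport a) (F \ negSupport a) •
      c (F \ negSupport a) • degFrac I a F := rfl

variable {I a} {p : ℤ}

theorem cechDifferential_cochainMap {c : Finset (Fin n) → K}
    (hc : c ∈ chains K (degreeComplex I a) p) : cechDifferential I (cochainMap I a c) =
      cochainMap I a (chainProj K (degreeComplex I a) (p + 1) (coboundary K n c)) := by
  set G := negSupport a with hG
  ext F
  rw [cechDifferential_apply, cochainMap_apply]
  by_cases hF : G ⊆ F
  · have h₁ : ∑ j ∈ F, (-1 : K) ^ position F j •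
        nat I (F.erase_subset j) (cochainMap I a c (F.erase j)) =
        ∑ j ∈ F \ G, (-1 : K) ^ position F j •
          nat I (F.erase_subset j) (cochainMap I a c (F.erase j)) := by
      -- Removing some `j ∈ G_a` leaves a set not containing `G_a`, where the component of degree
      -- `a` is zero.
      refine (Finset.sum_subset Finset.sdiff_subset fun j hjF hj => ?_).symm
      have hjG : j ∈ G := by
        by_contra h
        exact hj (Finset.mem_sdiff.2 ⟨hjF, h⟩)
      have : ¬ negSupport a ⊆ F.erase j := fun h => Finset.notMem_erase j F (h hjG)
      rw [cochainMap_apply, degFrac_of_not_subset this, smul_zero, smul_zero, map_zero, smul_zero]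
    have h₂ : ∀ j ∈ F \ G, (-1 : K) ^ position F j •
        nat I (F.erase_subset j) (cochainMap I a c (F.erase j)) =
        (shiftSign K G (F \ G) * ((-1) ^ position (F \ G) j * c ((F \ G).erase j))) •
          degFrac I a F := by
      intro j hj
      have hjG : negSupport a ⊆ F.erase j := fun k hk => Finset.mem_erase.2
        ⟨fun h => (Finset.mem_sdiff.1 hj).2 (h ▸ hk), hF hk⟩
      have hn : ∀ (k : K) (y : Loc I (F.erase j)), nat I (F.erase_subset j) (k • y) =
          k • nat I (F.erase_subset j) y :=
        fun k y => map_smul ((nat I (F.erase_subset j)).restrictScalars K) k y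
      rw [cochainMap_apply, hn, hn, nat_degFrac hjG, smul_smul, smul_smul, ← hG,
        Finset.erase_sdiff_comm, ← mul_assoc, neg_one_pow_position_mul_shiftSign hF hj, mul_assoc]
    rw [h₁, Finset.sum_congr rfl h₂, ← Finset.sum_smul, ← Finset.mul_sum, ← coboundary_apply,
      ← hG, smul_smul]
    -- The truncation `chainProj` is harmless: off `Δ_a` the generator is zero, and in the wrong
    -- dimension the coboundary of `c` is zero.
    by_cases hD : F \ G ∈ degreeComplex I a
    · by_cases hp : ((F \ G).card : ℤ) = p + 1 + 1
      · rw [chainProj_of_mem ⟨hD, hp⟩]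
      · rw [chainProj_of_notMem (fun h => hp h.2), coboundary_apply,
          Finset.sum_eq_zero fun j hj => ?_]
        rw [mem_chains.1 hc _ fun h => ?_, mul_zero]
        have := Finset.card_erase_add_one hj
        omega
    · have : degFrac I a F = 0 := by
        by_contra h
        exact hD ((degFrac_ne_zero_iff hF).1 h)
      rw [this, smul_zero, smul_zero]
  · rw [degFrac_of_not_subset hF, smul_zero, smul_zero]
    refine Finset.sum_eq_zero fun j _ => ?_
    rw [cochainMap_apply, degFrac_of_not_subset fun h => hF (h.trans (F.erase_subset j)),
      smul_zero, smul_zero, map_zero, smul_zero]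

/-- A face of dimension `p` has `p + 1` elements, and adjoining `G_a` gives the shift by `|G_a| +
1`. -/
theorem cochainMap_mem {c : Finset (Fin n) → K} (hc : c ∈ chains K (degreeComplex I a) p) :
    cochainMap I a c ∈ strand I (p + (negSupport a).card + 1) a := by
  refine ⟨mem_totDegree.2 fun F => mem_locDegree_iff.2
    ⟨_, (smul_smul (shiftSign K (negSupport a) (F \ negSupport a)) (c (F \ negSupport a))
      (degFrac I a F)).symm⟩, fun F hF => ?_⟩
  change cochainMap I a c F = 0
  rw [cochainMap_apply]
  by_cases hG : negSupport a ⊆ F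
  · rw [mem_chains.1 hc _ fun h => hF ?_, zero_smul, smul_zero]
    have := Finset.card_sdiff_add_card_eq_card hG
    have := h.2
    omega
  · rw [degFrac_of_not_subset hG, smul_zero, smul_zero]

theorem union_sdiff_of_mem {L : Finset (Fin n)} (hL : L ∈ degreeComplex I a) :
    (L ∪ negSupport a) \ negSupport a = L := by
  obtain ⟨F, -, -, rfl⟩ := hL
  rw [Finset.union_sdiff_right, Finset.sdiff_idem]

theorem map_cochainMap_chains : (chains K (degreeComplex I a) p).map (cochainMap I a) =
    strand I (p + (negSupport a).card + 1) a := by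
  apply le_antisymm
  · rintro _ ⟨c, hc, rfl⟩
    exact cochainMap_mem hc
  · rintro z ⟨hz, hz'⟩
    choose k hk using fun F => mem_locDegree_iff.1 (mem_totDegree.1 hz F)
    -- The sign is its own inverse, so it is applied again to undo it. Coefficients `k` at zero
    -- generators are arbitrary and get projected away.
    refine ⟨chainProj K (degreeComplex I a) p fun L =>
      shiftSign K (negSupport a) L * k (L ∪ negSupport a), chainProj_mem _ _ _, ?_⟩
    ext F
    rw [cochainMap_apply]
    by_cases hG : negSupport a ⊆ F
    · by_cases hD : F \ negSupport a ∈ degreeComplex I a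
      · by_cases hp : ((F \ negSupport a).card : ℤ) = p + 1
        · rw [chainProj_of_mem ⟨hD, hp⟩, smul_smul, ← mul_assoc, shiftSign_mul_self, one_mul,
            Finset.sdiff_union_of_subset hG, hk]
        · have : z F = 0 := hz' F fun h => hp (by
            have := Finset.card_sdiff_add_card_eq_card hG
            omega)
          rw [chainProj_of_notMem (fun h => hp h.2), zero_smul, smul_zero, this]
      · have : degFrac I a F = 0 := by
          by_contra h
          exact hD ((degFrac_ne_zero_iff hG).1 h)
        rw [← hk F, this, smul_zero, smul_zero, smul_zero]
    · rw [← hk F, degFrac_of_not_subset hG, smul_zero, smul_zero, smul_zero]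

theorem eq_zero_of_cochainMap_eq_zero {c : Finset (Fin n) → K}
    (hc : c ∈ chains K (degreeComplex I a) p) (h : cochainMap I a c = 0) : c = 0 := by
  ext L
  by_cases hL : L ∈ degreeComplex I a ∧ (L.card : ℤ) = p + 1
  · have h₁ := congrFun h (L ∪ negSupport a)
    have h₂ : degFrac I a (L ∪ negSupport a) ≠ 0 := by
      rw [degFrac_ne_zero_iff Finset.subset_union_right, union_sdiff_of_mem hL.1]
      exact hL.1
    rw [cochainMap_apply, union_sdiff_of_mem hL.1, smul_smul] at h₁
    exact (mul_eq_zero.1 ((smul_eq_zero.1 h₁).resolve_right h₂)).resolve_left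
      (shiftSign_ne_zero _ _)
  · exact mem_chains.1 hc L hL

theorem finrank_map_cochainMap {U : Submodule K (Finset (Fin n) → K)}
    (hU : U ≤ chains K (degreeComplex I a) p) :
    Module.finrank K (U.map (cochainMap I a)) = Module.finrank K U := by
  have h := finrank_map_add_finrank_inf_ker (cochainMap I a) U
  have : U ⊓ LinearMap.ker (cochainMap I a) = ⊥ :=
    (Submodule.eq_bot_iff _).2 fun c hc => eq_zero_of_cochainMap_eq_zero (hU hc.1) hc.2
  rwa [this, finrank_bot, add_zero] at h

theorem finrank_strand : Module.finrank K (strand I (p + (negSupport a).card + 1) a) =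
    Module.finrank K (chains K (degreeComplex I a) p) := by
  rw [← map_cochainMap_chains, finrank_map_cochainMap le_rfl]

theorem finrank_map_strand :
    Module.finrank K ((strand I (p + (negSupport a).card + 1) a).map (cechD I)) =
      Module.finrank K (boundaries K (degreeComplex I a) p) := by
  rw [← finrank_map_coboundary, ← finrank_map_cochainMap (I := I) (a := a) (p := p + 1)
    (by rintro _ ⟨c, -, rfl⟩; exact chainProj_mem _ _ _)]
  have : (strand I (p + (negSupport a).card + 1) a).map (cechD I) =
      ((chains K (degreeComplex I a) p).map
        (chainProj K (degreeComplex I a) (p + 1) ∘ₗ coboundary K n)).map (cochainMap I a) := by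
    rw [← map_cochainMap_chains]
    ext z
    constructor
    · rintro ⟨_, ⟨c, hc, rfl⟩, rfl⟩
      exact ⟨_, ⟨c, hc, rfl⟩, (cechDifferential_cochainMap hc).symm⟩
    · rintro ⟨_, ⟨c, hc, rfl⟩, rfl⟩
      exact ⟨_, ⟨c, hc, rfl⟩, cechDifferential_cochainMap hc⟩
  rw [this]

/-- The components of the Čech cohomology are given by the reduced homology of `Δ_a`. -/
theorem finrank_cechDegree_eq (hI : IsMonomialIdeal I) (t : ℤ) (a : Fin n → ℤ) :
    Module.finrank K (cechDegree I t a) = Module.finrank K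
      (ReducedHomology K (degreeComplex I a) (t - (negSupport a).card - 1)) := by
  have h₁ := finrank_cechDegree hI t a
  have h₂ := finrank_reducedHomology (K := K) (degreeComplex I a) (t - (negSupport a).card - 1)
  have e₁ : t - (negSupport a).card - 1 + (negSupport a).card + 1 = t := by ring
  have e₂ : t - (negSupport a).card - 1 - 1 + (negSupport a).card + 1 = t - 1 := by ring
  have h₃ := finrank_strand (I := I) (a := a) (p := t - (negSupport a).card - 1)
  have h₄ := finrank_map_strand (I := I) (a := a) (p := t - (negSupport a).card - 1)
  have h₅ := finrank_map_strand (I := I) (a := a) (p := t - (negSupport a).card - 1 - 1)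
  rw [e₁] at h₃ h₄
  rw [e₂] at h₅
  omega

end Comparison
end MonomialLC

end

section


universe u

namespace MonomialLC

attribute [local instance] quotRingDistribMulAction locModule cechTotalAddCommGroup cechTotalModule
  cechTotalIsScalarTower

/-! ### Vanishing for `a_j ≥ ρ_j` or `G_a ∉ Δ`, and the Hilbert function. -/

section Vanishing

variable {K : Type u} [Field K] {n : ℕ} {I : Ideal (MvPolynomial (Fin n) K)}

variable (I) in
/-- The natural map on the components of degree `a`. -/
noncomputable def natDegree (a : Fin n → ℤ) {F F' : Finset (Fin n)} (h : F ⊆ F') :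
    locDegree I F a →ₗ[K] locDegree I F' a :=
  ((nat I h).restrictScalars K).toLinearMap.restrict fun _ hy => nat_mem h a hy

theorem coe_natDegree (a : Fin n → ℤ) {F F' : Finset (Fin n)} (h : F ⊆ F')
    (y : locDegree I F a) : (natDegree I a h y : Loc I F') = nat I h y := rfl

theorem le_rho {u : Fin n →₀ ℕ} (hu : u ∈ minGens I) (j : Fin n) : u j ≤ rho I j :=
  Finset.le_sup (f := fun u : Fin n →₀ ℕ => u j) ((minGens_finite I).mem_toFinset.2 hu)

/-- An index `k` with `u_k > a_k` cannot be `j`, since `u_j ≤ ρ_j ≤ a_j`. The witness therefore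
stays outside `F ∪ {j}`. -/
theorem degFrac_insert_ne_zero {a : Fin n → ℤ} {j : Fin n} (hj : (rho I j : ℤ) ≤ a j)
    {F : Finset (Fin n)} (h : degFrac I a F ≠ 0) : degFrac I a (insert j F) ≠ 0 := by
  have hF : negSupport a ⊆ F := by
    by_contra hF
    exact h (degFrac_of_not_subset hF)
  rw [degFrac_ne_zero_iff hF, sdiff_mem_degreeComplex_iff hF] at h
  have hF' := hF.trans (Finset.subset_insert j F)
  rw [degFrac_ne_zero_iff hF', sdiff_mem_degreeComplex_iff hF']
  intro u hu
  obtain ⟨k, hk, hlt, h0⟩ := h u hu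
  refine ⟨k, fun hk' => ?_, hlt, h0⟩
  rcases Finset.mem_insert.1 hk' with rfl | hk'
  · have := le_rho hu k
    omega
  · exact hk hk'

/-- As `a_j ≥ ρ_j ≥ 0`, the index `j` is not in `G_a`, so `F` and `F ∪ {j}` contain `G_a`
simultaneously. The generator maps to the generator, and does not become zero. -/
theorem natDegree_bijective {a : Fin n → ℤ} {j : Fin n} (hj : (rho I j : ℤ) ≤ a j)
    (F : Finset (Fin n)) : Function.Bijective (natDegree I a (Finset.subset_insert j F)) := by
  have hn : ∀ k : K, nat I (Finset.subset_insert j F) (k • degFrac I a F) =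
      k • nat I (Finset.subset_insert j F) (degFrac I a F) := fun k =>
    map_smul ((nat I (Finset.subset_insert j F)).restrictScalars K) k _
  constructor
  · rw [injective_iff_map_eq_zero]
    rintro ⟨y, hy⟩ h
    have h : nat I (Finset.subset_insert j F) y = 0 := congrArg Subtype.val h
    obtain ⟨c, rfl⟩ := mem_locDegree_iff.1 hy
    refine Subtype.ext ?_
    change c • degFrac I a F = 0
    by_contra hne
    have hu : degFrac I a F ≠ 0 := right_ne_zero_of_smul hne
    have hF : negSupport a ⊆ F := by
      by_contra hF
      exact hu (degFrac_of_not_subset hF)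
    rw [hn, nat_degFrac hF] at h
    rcases smul_eq_zero.1 h with h | h
    · exact hne (by rw [h, zero_smul])
    · exact degFrac_insert_ne_zero hj hu h
  · rintro ⟨y, hy⟩
    obtain ⟨c, rfl⟩ := mem_locDegree_iff.1 hy
    refine ⟨⟨c • degFrac I a F, mem_locDegree_iff.2 ⟨c, rfl⟩⟩, Subtype.ext ?_⟩
    rw [coe_natDegree]
    change nat I (Finset.subset_insert j F) (c • degFrac I a F) = c • degFrac I a (insert j F)
    rw [hn]
    by_cases hF : negSupport a ⊆ F
    · rw [nat_degFrac hF]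
    · have hF' : ¬ negSupport a ⊆ insert j F := fun h => hF fun k hk => by
        rcases Finset.mem_insert.1 (h hk) with rfl | hk'
        · have := (Finset.mem_filter.1 hk).2
          omega
        · exact hk'
      rw [degFrac_of_not_subset hF, degFrac_of_not_subset hF', map_zero]

variable (I) in
/-- The component of degree `a` of the Čech complex. -/
noncomputable abbrev degreeD (a : Fin n → ℤ) :
    (∀ F, locDegree I F a) →ₗ[K] (∀ F, locDegree I F a) :=
  subsetD (R := K) (A := fun F => locDegree I F a) fun {_ _} h => natDegree I a h

theorem coe_degreeD (a : Fin n → ℤ) (w : ∀ F, locDegree I F a) (F : Finset (Fin n)) :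
    (degreeD I a w F : Loc I F) = cechDifferential I (fun F => (w F : Loc I F)) F := by
  rw [subsetD_apply, cechDifferential_apply, AddSubmonoidClass.coe_finsetSum]
  rfl

theorem natDegree_natDegree (a : Fin n → ℤ) {F F' F'' : Finset (Fin n)} (h : F ⊆ F')
    (h' : F' ⊆ F'') (y : locDegree I F a) :
    natDegree I a h' (natDegree I a h y) = natDegree I a (h.trans h') y :=
  Subtype.ext (nat_nat h h' (y : Loc I F))

theorem degreeD_exact {a : Fin n → ℤ} {j : Fin n} (hj : (rho I j : ℤ) ≤ a j) (t : ℤ) :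
    subsetTerm K (fun F => locDegree I F a) t ⊓ LinearMap.ker (degreeD I a) ≤
      (subsetTerm K (fun F => locDegree I F a) (t - 1)).map (degreeD I a) :=
  subset_exact_of_bijective (R := K) (A := fun F => locDegree I F a)
    (fun {_ _} h => natDegree I a h) (natDegree_natDegree a) j
    (fun F _ => natDegree_bijective hj F) t

theorem strand_inf_ker_le {a : Fin n → ℤ} {j : Fin n} (hj : (rho I j : ℤ) ≤ a j) (t : ℤ) :
    strand I t a ⊓ LinearMap.ker (cechD I) ≤ (strand I (t - 1) a).map (cechD I) := by
  rintro z ⟨⟨hz, hzt⟩, hdz⟩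
  let z' : ∀ F, locDegree I F a := fun F => ⟨z F, mem_totDegree.1 hz F⟩
  have h₁ : z' ∈ subsetTerm K (fun F => locDegree I F a) t :=
    fun F hF => Subtype.ext (hzt F hF)
  have h₂ : degreeD I a z' = 0 :=
    funext fun F => Subtype.ext ((coe_degreeD a z' F).trans (congrFun hdz F))
  obtain ⟨w, hw, hwz⟩ := degreeD_exact hj t ⟨h₁, h₂⟩
  refine ⟨fun F => w F, ⟨mem_totDegree.2 fun F => (w F).2, fun F hF => ?_⟩, funext fun F => ?_⟩
  · exact congrArg Subtype.val (hw F hF)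
  · exact (coe_degreeD a w F).symm.trans (congrArg Subtype.val (congrFun hwz F))

/-- The component of degree `a` of the Čech cohomology vanishes if `a_j ≥ ρ_j` for some `j`. -/
theorem finrank_cechDegree_eq_zero (hI : IsMonomialIdeal I) {a : Fin n → ℤ} {j : Fin n}
    (hj : (rho I j : ℤ) ≤ a j) (t : ℤ) : Module.finrank K (cechDegree I t a) = 0 := by
  have hfin : ∀ s, FiniteDimensional K (strand I s a) := fun s =>
    Submodule.finiteDimensional_of_le inf_le_left
  have h₁ := finrank_cechDegree hI t a
  have h₂ := finrank_map_add_finrank_inf_ker (cechD I) (strand I t a)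
  have : FiniteDimensional K ((strand I (t - 1) a).map (cechD I)) := Module.Finite.map _ _
  have h₃ := Submodule.finrank_mono (strand_inf_ker_le hj t)
  omega

theorem prod_X_pow (F : Finset (Fin n)) (k : ℕ) :
    (∏ j ∈ F, (MvPolynomial.X j : MvPolynomial (Fin n) K)) ^ k =
      MvPolynomial.monomial (expo F k) 1 := by
  have : expo F k = ∑ j ∈ F, Finsupp.single j k := by
    ext i
    simp [expo_apply, Finsupp.single_apply, Finsupp.finsetSum_apply]
  rw [this, MvPolynomial.monomial_sum_one, ← Finset.prod_pow]
  exact Finset.prod_congr rfl fun j _ => MvPolynomial.X_pow_eq_monomial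

/-- If a power of `∏_{j ∈ G_a} X_j` lies in `I`, some `u ∈ G(I)` is supported in `G_a`. No `j`
outside a set `F ⊇ G_a` can have `u_j > a_j ≥ 0`, so not even the empty face survives. -/
theorem notMem_degreeComplex {a : Fin n → ℤ} (ha : negSupport a ∉ radicalComplex I)
    (L : Finset (Fin n)) : L ∉ degreeComplex I a := by
  rintro ⟨F, hF, h, -⟩
  have hr : ∏ j ∈ negSupport a, (MvPolynomial.X j : MvPolynomial (Fin n) K) ∈ I.radical :=
    not_not.1 ha
  obtain ⟨k, hk⟩ := hr
  rw [prod_X_pow] at hk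
  obtain ⟨u, hu, hle⟩ := monomial_mem_iff.1 hk
  obtain ⟨j, hj, hlt, h0⟩ := h u hu
  have := hle j
  rw [expo_apply, if_neg fun hj' => hj (hF hj')] at this
  omega

theorem finrank_reducedHomology_eq_zero {a : Fin n → ℤ} (ha : negSupport a ∉ radicalComplex I)
    (p : ℤ) : Module.finrank K (ReducedHomology K (degreeComplex I a) p) = 0 := by
  have h := finrank_reducedHomology (K := K) (degreeComplex I a) p
  have : chains K (degreeComplex I a) p = ⊥ := (Submodule.eq_bot_iff _).2 fun c hc =>
    funext fun F => mem_chains.1 hc F fun hF => notMem_degreeComplex ha F hF.1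
  rw [this, finrank_bot] at h
  omega

/-- The Hilbert function of the Čech cohomology. -/
theorem finrank_cechDegree_eq_sum (hI : IsMonomialIdeal I) (t : ℤ) (a : Fin n → ℤ) :
    Module.finrank K (cechDegree I t a) = (∑ F ∈ faces (radicalComplex I),
      formalSum {a : Fin n → ℤ | negSupport a = F ∧ ∀ j, a j ≤ (rho I j : ℤ) - 1}
        (fun a => Module.finrank K
          (ReducedHomology K (degreeComplex I a) (t - (F.card : ℤ) - 1)))) a := by
  have hmem : ∀ F, F ∈ faces (radicalComplex I) ↔ F ∈ radicalComplex I := fun F =>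
    Set.Finite.mem_toFinset _
  rw [Finset.sum_apply]
  simp only [formalSum]
  by_cases hρ : ∀ j, a j ≤ (rho I j : ℤ) - 1
  · rw [finrank_cechDegree_eq hI]
    by_cases ha : negSupport a ∈ radicalComplex I
    -- For a fixed `a` only the summand `F = G_a` can contribute.
    · rw [Finset.sum_eq_single_of_mem _ ((hmem _).2 ha)]
      · rw [Set.indicator_of_mem]
        exact ⟨rfl, hρ⟩
      · intro F _ hF
        refine Set.indicator_of_notMem (M := ℕ) (fun h => hF ?_) _
        exact h.1.symm
    · rw [finrank_reducedHomology_eq_zero ha, Finset.sum_eq_zero]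
      intro F hF
      refine Set.indicator_of_notMem (fun h => ha ?_) _
      rw [h.1]
      exact (hmem F).1 hF
  · obtain ⟨j, hj⟩ := not_forall.1 hρ
    rw [finrank_cechDegree_eq_zero hI (j := j) (by omega), Finset.sum_eq_zero]
    exact fun F _ => Set.indicator_of_notMem (fun h => hρ h.2) _

end Vanishing

section Transport

theorem isInternal_comap {K V V' σ : Type*} [Field K] [AddCommGroup V] [Module K V]
    [AddCommGroup V'] [Module K V'] [DecidableEq σ] (e : V ≃ₗ[K] V') {W : σ → Submodule K V'}
    (h : DirectSum.IsInternal W) : DirectSum.IsInternal fun a => (W a).comap e.toLinearMap := by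
  rw [DirectSum.isInternal_submodule_iff_iSupIndep_and_iSup_eq_top] at h ⊢
  have hW : (fun a => (W a).comap e.toLinearMap) = fun a => (W a).map e.symm.toLinearMap :=
    funext fun a => Submodule.comap_equiv_eq_map_symm e (W a)
  rw [hW]
  refine ⟨h.1.map_orderIso (Submodule.orderIsoMapComap e.symm), ?_⟩
  rw [← Submodule.map_iSup, h.2, Submodule.map_top]
  exact LinearMap.range_eq_top.2 e.symm.surjective

end Transport

/-! ### Transport of the grading to local cohomology. -/

section LocalCohomology

variable {K : Type u} [Field K] {n : ℕ} {I : Ideal (MvPolynomial (Fin n) K)} {i : ℕ}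
  (e : LocalCoh I i ≃ₗ[QuotRing I] CechCohomology I i)

/-- The restriction of `e` to the components of degree `a`. -/
noncomputable def localCohDegreeEquiv (a : Fin n → ℤ) :
    localCohDegree I i e a ≃ₗ[K] cechDegree I i a :=
  (e.restrictScalars K).submoduleMap (localCohDegree I i e a) ≪≫ₗ LinearEquiv.ofEq _ _
    (Submodule.map_comap_eq_of_surjective (f := (e.restrictScalars K).toLinearMap)
      e.surjective (cechDegree I i a))

theorem isInternal_localCohDegree (hI : IsMonomialIdeal I) :
    DirectSum.IsInternal (localCohDegree I i e) :=
  isInternal_comap (e.restrictScalars K) (isInternal_cechDegree hI i)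

theorem x_smul_mem_localCohDegree (a : Fin n → ℤ) (j : Fin n) {m : LocalCoh I i}
    (hm : m ∈ localCohDegree I i e a) :
    x I j • m ∈ localCohDegree I i e (a + Pi.single j 1) := by
  have : e (x I j • m) = x I j • e m := map_smul e _ _
  change e (x I j • m) ∈ cechDegree I (i : ℤ) (a + Pi.single j 1)
  rw [this]
  exact x_smul_mem_cechDegree (i : ℤ) a j hm

theorem finiteDimensional_localCohDegree (a : Fin n → ℤ) :
    FiniteDimensional K (localCohDegree I i e a) :=
  have := finiteDimensional_cechDegree (I := I) (i : ℤ) a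
  Module.Finite.equiv (localCohDegreeEquiv e a).symm

end LocalCohomology
end MonomialLC

end

theorem mainTheorem1 {K : Type*} [Field K] {n : ℕ}
    (I : Ideal (MvPolynomial (Fin n) K)) (hI : MonomialLC.IsMonomialIdeal I) (i : ℕ) :
    ∃ e : MonomialLC.LocalCoh I i ≃ₗ[MonomialLC.QuotRing I] MonomialLC.CechCohomology I (i : ℤ),
      DirectSum.IsInternal (MonomialLC.localCohDegree I i e) ∧
      (∀ (a : Fin n → ℤ) (j : Fin n), ∀ m ∈ MonomialLC.localCohDegree I i e a,
        MonomialLC.x I j • m ∈ MonomialLC.localCohDegree I i e (a + Pi.single j 1)) ∧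
      (∀ a : Fin n → ℤ, FiniteDimensional K (MonomialLC.localCohDegree I i e a)) ∧
      MonomialLC.hilbertSeries (MonomialLC.localCohDegree I i e) =
        ∑ F ∈ MonomialLC.faces (MonomialLC.radicalComplex I),
          MonomialLC.formalSum
            {a : Fin n → ℤ | MonomialLC.negSupport a = F ∧
              ∀ j, a j ≤ (MonomialLC.rho I j : ℤ) - 1}
            (fun a => Module.finrank K
              (MonomialLC.ReducedHomology K (MonomialLC.degreeComplex I a)
                ((i : ℤ) - (F.card : ℤ) - 1))) := by
  -- Any `R`-linear isomorphism will do, because the grading is defined by transport along it.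
  obtain ⟨e⟩ := MonomialLC.nonempty_localCoh_equiv I i
  refine ⟨e, MonomialLC.isInternal_localCohDegree e hI,
    fun a j m hm => MonomialLC.x_smul_mem_localCohDegree e a j hm,
    MonomialLC.finiteDimensional_localCohDegree e, funext fun a => ?_⟩
  exact (MonomialLC.localCohDegreeEquiv e a).finrank_eq.trans
    (MonomialLC.finrank_cechDegree_eq_sum hI i a)
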